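/- Let $k$ be a field. A multiplicative Hom-Lie algebra $(\mathfrak g,\phi)$ is a $k$-vector space with an antisymmetric bilinear bracket and a linear map $\phi$ with $\phi[\xi,\xi']=[\phi\xi,\phi\xi']$ and $[\phi(\xi),[\xi',\xi'']]+[\phi(\xi''),[\xi,\xi']]+[\phi(\xi'),[\xi'',\xi]]=0$. Multiplicative Hom-Lie algebras $(\mathfrak g,\phi)$, $(\mathfrak h,\alpha)$ with bilinear maps $\triangleright:\mathfrak h\times\mathfrak g\to\mathfrak g$, $\triangleleft:\mathfrak h\times\mathfrak g\to\mathfrak h$ form a *matched pair* if $\phi(\eta\triangleright\xi)=\alpha(\eta)\triangleright\phi(\xi)$, $\alpha(\eta\triangleleft\xi)=\alpha(\eta)\triangleleft\phi(\xi)$ and $$[\eta,\eta']\triangleright\phi(\xi)=\alpha(\eta)\triangleright(\eta'\triangleright\xi)-\alpha(\eta')\triangleright(\eta\triangleright\xi),\qquad \alpha(\eta)\triangleleft[\xi,\xi']=(\eta\triangleleft\xi)\triangleleft\phi(\xi')-(\eta\triangleleft\xi')\triangleleft\phi(\xi),$$ $$\alpha(\eta)\triangleright[\xi,\xi']=[\eta\triangleright\xi,\phi(\xi')]+[\phi(\xi),\eta\triangleright\xi']+(\eta\triangleleft\xi)\triangleright\phi(\xi')-(\eta\triangleleft\xi')\triangleright\phi(\xi),$$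 $$[\eta,\eta']\triangleleft\phi(\xi)=[\alpha(\eta),\eta'\triangleleft\xi]+[\eta\triangleleft\xi,\alpha(\eta')]+\alpha(\eta)\triangleleft(\eta'\triangleright\xi)-\alpha(\eta')\triangleleft(\eta\triangleright\xi).$$ *Enveloping algebra.* Let $\mathbb T^{\mathfrak g}$ be spanned by a symbol $\mathbf 1$ and by planar binary trees whose leaves carry a weight $s\in\mathbb N$ and a label $\xi\in\mathfrak g$, multilinearly in the labels; $(s,\xi)$ is the one-leaf tree. Let $\mathfrak a$ fix $\mathbf 1$ and apply $\phi$ to all labels of a tree, let $t^{+}$ be $t$ with all weights raised by $1$, and let $\vee$ be grafting of trees, with $\mathbf 1\vee\mathbf 1=\mathbf 1$ and $t\vee\mathbf 1=\mathbf 1\vee t=\mathfrak a(t)$. Let $\mathcal U(\mathfrak g)$ be the quotient of $\mathbb T^{\mathfrak g}$ by the two-sided ideal (for $\vee$) generated by $(t\vee t')\vee t''^{+}-t^{+}\vee(t'\vee t'')$, by $(s,\xi)-(0,\phi^s(\xi))$ and by $(0,\xi)\vee(0,\xi')-(0,\xi')\vee(0,\xi)-(0,[\xi,\xi'])$. It carries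 the maps induced by $\vee$, $\mathbf 1$, $\mathfrak a$ (again written $\phi$); $\Delta(\mathbf 1)=\mathbf 1\otimes\mathbf 1$, $\Delta(t)=\sum_{I\sqcup J}t_I\otimes t_J$ over partitions of the leaves of $t$, where in $t_I$ the leaves outside $I$ are replaced by $\mathbf 1$; $\varepsilon(\mathbf 1)=1$, $\varepsilon(t)=0$; and $S(\mathbf 1)=\mathbf 1$, $S(s,\xi)=-(s,\xi)$, $S(t\vee t')=S(t')\vee S(t)$. *Hom-Hopf algebras.* An $(\alpha,\beta)$-Hom-Hopf algebra $(\mathcal H,\mu,1,\alpha,\Delta,\varepsilon,\beta,S)$ satisfies: $\alpha(x)(yz)=(xy)\alpha(z)$, $1x=x1=\alpha(x)$, $\alpha(1)=1$; $(\beta\otimes\Delta)\Delta=(\Delta\otimes\beta)\Delta$, $(\varepsilon\otimes\mathrm{Id})\Delta=(\mathrm{Id}\otimes\varepsilon)\Delta=\beta$, $\varepsilon\beta=\varepsilon$; $\Delta$, $\varepsilon$, $\beta$ are multiplicative, unital and compatible with $\alpha$ (that is $\Delta\alpha=(\alpha\otimes\alpha)\Delta$, $\varepsilon\alpha=\varepsilon$,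 $\beta\alpha=\alpha\beta$); $\mu(S\otimes\mathrm{Id})\Delta=\mu(\mathrm{Id}\otimes S)\Delta=\varepsilon(\cdot)1$, and $S$ commutes with $\alpha$ and $\beta$. Let $\mathcal U$, $\mathcal V$ be Hom-Hopf algebras of types $(\phi,\psi)$, $(\alpha,\beta)$ with $\phi,\psi,\alpha,\beta$ bijective. They form a *matched pair* through $\triangleright:\mathcal V\otimes\mathcal U\to\mathcal U$ and $\triangleleft:\mathcal V\otimes\mathcal U\to\mathcal V$ if (i) $(\mathcal U,\phi)$ is a left $\mathcal V$-Hom-module coalgebra: $\phi$ is a Hom-coalgebra endomorphism, $\alpha(v)\triangleright(v'\triangleright u)=(vv')\triangleright\phi(u)$, $1\triangleright u=\phi(u)$, $\psi(v\triangleright u)=\beta(v)\triangleright\psi(u)$, $\Delta(v\triangleright u)=v_{1}\triangleright u_{1}\otimes v_{2}\triangleright u_{2}$, $\varepsilon(v\triangleright u)=\varepsilon(v)\varepsilon(u)$; moreover $\phi(v\triangleright u)=\alpha(v)\triangleright\phi(u)$; (ii) symmetrically, $(\mathcal V,\alpha)$ is a right $\mathcal U$-Hom-module coalgebra through $\triangleleft$,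 with $\alpha(v\triangleleft u)=\alpha(v)\triangleleft\phi(u)$; (iii) $v\triangleright 1=\varepsilon(v)1$, $1\triangleleft u=\varepsilon(u)1$, $v_1\triangleleft u_1\otimes v_2\triangleright u_2=v_2\triangleleft u_2\otimes v_1\triangleright u_1$, and $$v\triangleright(uu')=\big(\alpha^{-1}\beta^{-1}(v_1)\triangleright\psi^{-1}(u_1)\big)\Big(\big(\alpha^{-2}\beta^{-1}(v_2)\triangleleft\phi^{-1}\psi^{-1}(u_2)\big)\triangleright u'\Big),$$ $$(vv')\triangleleft u=\Big(v\triangleleft\big(\alpha^{-1}\beta^{-1}(v'_1)\triangleright\phi^{-2}\psi^{-1}(u_1)\big)\Big)\big(\beta^{-1}(v'_2)\triangleleft\phi^{-1}\psi^{-1}(u_2)\big).$$ **Proposition.** Let $(\mathfrak g,\phi)$, $(\mathfrak h,\alpha)$ be a matched pair of multiplicative Hom-Lie algebras over $k$ with $\phi$ and $\alpha$ bijective. Then there are unique bilinear maps satisfying the following formulas, where $x,y,u\in\mathcal U(\mathfrak g)$, $v,w\in\mathcal U(\mathfrak h)$, $\xi\in\mathfrak g$, $\eta\in\mathfrak h$,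 $s\in\mathbb N$: * $\mathfrak h\times\mathcal U(\mathfrak g)\to\mathfrak h$: $\eta\triangleleft\mathbf 1=\alpha(\eta)$, $\eta\triangleleft(s,\xi)=\eta\triangleleft\phi^s(\xi)$, $\alpha(\eta)\triangleleft(x\vee y)=(\eta\triangleleft x)\triangleleft\phi(y)$; * $\mathfrak h\times\mathcal U(\mathfrak g)\to\mathcal U(\mathfrak g)$: $\eta\triangleright\mathbf 1=0$, $\eta\triangleright(s,\xi)=(s,\alpha^{-s}(\eta)\triangleright\xi)$, $\eta\triangleright(x\vee y)=(\alpha^{-1}(\eta)\triangleright x)\vee\phi(y)+\phi(x_1)\vee\big((\alpha^{-2}(\eta)\triangleleft\phi^{-1}(x_2))\triangleright y\big)$; * $\mathcal U(\mathfrak h)\times\mathfrak g\to\mathfrak g$: $\mathbf 1\triangleright\xi=\phi(\xi)$, $(s,\eta)\triangleright\xi=\alpha^s(\eta)\triangleright\xi$, $(v\vee w)\triangleright\phi(\xi)=\alpha(v)\triangleright(w\triangleright\xi)$; * $\mathcal U(\mathfrak h)\times\mathfrak g\to\mathcal U(\mathfrak h)$: $\mathbf 1\triangleleft\xi=0$,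 $(s,\eta)\triangleleft\xi=(s,\eta\triangleleft\phi^{-s}(\xi))$, $(v\vee w)\triangleleft\xi=\alpha(v)\vee(w\triangleleft\phi^{-1}(\xi))+\big(v\triangleleft(\alpha^{-1}(w_1)\triangleright\phi^{-2}(\xi))\big)\vee\alpha(w_2)$; * $\mathcal U(\mathfrak h)\times\mathcal U(\mathfrak g)\to\mathcal U(\mathfrak g)$: $\mathbf 1\triangleright u=\phi(u)$, $(s,\eta)\triangleright u=\alpha^s(\eta)\triangleright u$, $(v\vee w)\triangleright\phi(u)=\alpha(v)\triangleright(w\triangleright u)$; * $\mathcal U(\mathfrak h)\times\mathcal U(\mathfrak g)\to\mathcal U(\mathfrak h)$: $v\triangleleft\mathbf 1=\alpha(v)$, $v\triangleleft(s,\xi)=v\triangleleft\phi^s(\xi)$, $\alpha(v)\triangleleft(x\vee y)=(v\triangleleft x)\triangleleft\phi(y)$. With the last two as $\triangleright$ and $\triangleleft$, $(\mathcal U(\mathfrak g),\vee,\mathbf 1,\phi,\Delta,\varepsilon,\mathrm{Id},S)$ and $(\mathcal U(\mathfrak h),\vee,\mathbf 1,\alpha,\Delta,\varepsilon,\mathrm{Id},S)$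 form a matched pair of Hom-Hopf algebras (in particular both are Hom-Hopf algebras, of types $(\phi,\mathrm{Id})$ and $(\alpha,\mathrm{Id})$, with bijective structure maps). -/

import Mathlib

open scoped TensorProduct

set_option linter.unusedSectionVars false

noncomputable section

/-- The inverse of a bijective linear endomorphism (and `0` when it is not bijective; every use
below is accompanied by a bijectivity hypothesis or conclusion). -/
def linInv {k V : Type*} [Field k] [AddCommGroup V] [Module k V] (f : V →ₗ[k] V) : V →ₗ[k] V :=
  open Classical in
  if h : Function.Bijective f then ((LinearEquiv.ofBijective f h).symm : V →ₗ[k] V) else 0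

/-! ### Hom-Lie algebras and their matched pairs -/

/-- A multiplicative Hom-Lie algebra structure on the vector space `g`. -/
structure HomLieAlg (k g : Type*) [Field k] [AddCommGroup g] [Module k g] where
  bracket : g →ₗ[k] g →ₗ[k] g
  twist : g →ₗ[k] g
  skew : ∀ x y, bracket x y = -bracket y x
  jacobi : ∀ x y z, bracket (twist x) (bracket y z) + bracket (twist z) (bracket x y)
    + bracket (twist y) (bracket z x) = 0
  twist_bracket : ∀ x y, twist (bracket x y) = bracket (twist x) (twist y)

/-- A matched pair of multiplicative Hom-Lie algebras `(g, φ)`, `(h, α)`: a left action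
`lact η ξ = η ▷ ξ` of `h` on `g` and a right action `ract η ξ = η ◁ ξ` of `g` on `h`. -/
structure HomLieMatchedPair {k g h : Type*} [Field k] [AddCommGroup g] [Module k g]
    [AddCommGroup h] [Module k h] (G : HomLieAlg k g) (H : HomLieAlg k h) where
  lact : h →ₗ[k] g →ₗ[k] g
  ract : h →ₗ[k] g →ₗ[k] h
  twist_lact : ∀ η ξ, G.twist (lact η ξ) = lact (H.twist η) (G.twist ξ)
  bracket_lact : ∀ η η' ξ, lact (H.bracket η η') (G.twist ξ)
    = lact (H.twist η) (lact η' ξ) - lact (H.twist η') (lact η ξ)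
  twist_ract : ∀ η ξ, H.twist (ract η ξ) = ract (H.twist η) (G.twist ξ)
  ract_bracket : ∀ η ξ ξ', ract (H.twist η) (G.bracket ξ ξ')
    = ract (ract η ξ) (G.twist ξ') - ract (ract η ξ') (G.twist ξ)
  lact_bracket : ∀ η ξ ξ', lact (H.twist η) (G.bracket ξ ξ')
    = G.bracket (lact η ξ) (G.twist ξ') + G.bracket (G.twist ξ) (lact η ξ')
      + lact (ract η ξ) (G.twist ξ') - lact (ract η ξ') (G.twist ξ)
  bracket_ract : ∀ η η' ξ, ract (H.bracket η η') (G.twist ξ)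
    = H.bracket (H.twist η) (ract η' ξ) + H.bracket (ract η ξ) (H.twist η')
      + ract (H.twist η) (lact η' ξ) - ract (H.twist η') (lact η ξ)

/-! ### Hom-Hopf algebras and their matched pairs -/

/-- The structure maps `(μ, η(1), α, Δ, ε, β, S)` of a Hom-Hopf algebra, without their laws. -/
structure HomHopfData (k V : Type*) [Field k] [AddCommGroup V] [Module k V] where
  mul : V →ₗ[k] V →ₗ[k] V
  one : V
  twist : V →ₗ[k] V
  comul : V →ₗ[k] V ⊗[k] V
  counit : V →ₗ[k] k
  cotwist : V →ₗ[k] V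
  antipode : V →ₗ[k] V

/-- The laws of a Hom-Hopf algebra of type `(α, β)`. Here
`TensorProduct.map₂ mul mul (a ⊗ b) (c ⊗ d) = mul a c ⊗ mul b d`. -/
structure IsHomHopf {k V : Type*} [Field k] [AddCommGroup V] [Module k V]
    (A : HomHopfData k V) : Prop where
  -- unital Hom-algebra
  hom_assoc : ∀ x y z, A.mul (A.twist x) (A.mul y z) = A.mul (A.mul x y) (A.twist z)
  one_mul : ∀ x, A.mul A.one x = A.twist x
  mul_one : ∀ x, A.mul x A.one = A.twist x
  twist_one : A.twist A.one = A.one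
  -- counital Hom-coalgebra
  hom_coassoc : ∀ x, TensorProduct.assoc k V V V
      (TensorProduct.map A.comul A.cotwist (A.comul x))
    = TensorProduct.map A.cotwist A.comul (A.comul x)
  counit_left : ∀ x, TensorProduct.lid k V (A.counit.rTensor V (A.comul x)) = A.cotwist x
  counit_right : ∀ x, TensorProduct.rid k V (A.counit.lTensor V (A.comul x)) = A.cotwist x
  counit_cotwist : ∀ x, A.counit (A.cotwist x) = A.counit x
  -- the Hom-coalgebra structure maps are unital Hom-algebra morphisms
  comul_one : A.comul A.one = A.one ⊗ₜ[k] A.one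
  comul_mul : ∀ x y, A.comul (A.mul x y)
    = TensorProduct.map₂ A.mul A.mul (A.comul x) (A.comul y)
  comul_twist : ∀ x, A.comul (A.twist x) = TensorProduct.map A.twist A.twist (A.comul x)
  counit_one : A.counit A.one = 1
  counit_mul : ∀ x y, A.counit (A.mul x y) = A.counit x * A.counit y
  counit_twist : ∀ x, A.counit (A.twist x) = A.counit x
  cotwist_one : A.cotwist A.one = A.one
  cotwist_mul : ∀ x y, A.cotwist (A.mul x y) = A.mul (A.cotwist x) (A.cotwist y)
  cotwist_twist : ∀ x, A.cotwist (A.twist x) = A.twist (A.cotwist x)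
  -- antipode
  antipode_left : ∀ x, TensorProduct.lift A.mul
    (TensorProduct.map A.antipode LinearMap.id (A.comul x)) = A.counit x • A.one
  antipode_right : ∀ x, TensorProduct.lift A.mul
    (TensorProduct.map LinearMap.id A.antipode (A.comul x)) = A.counit x • A.one
  antipode_twist : ∀ x, A.antipode (A.twist x) = A.twist (A.antipode x)
  antipode_cotwist : ∀ x, A.antipode (A.cotwist x) = A.cotwist (A.antipode x)

/-- `γ` is an endomorphism of the counital Hom-coalgebra underlying `A`. -/
structure IsHomCoalgEnd {k V : Type*} [Field k] [AddCommGroup V] [Module k V]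
    (A : HomHopfData k V) (γ : V →ₗ[k] V) : Prop where
  comul_map : ∀ x, A.comul (γ x) = TensorProduct.map γ γ (A.comul x)
  counit_map : ∀ x, A.counit (γ x) = A.counit x
  cotwist_map : ∀ x, γ (A.cotwist x) = A.cotwist (γ x)

/-- `(C, γ)` is a left `B`-Hom-module coalgebra through `act b c = b ▷ c`. Here
`TensorProduct.map₂ act act (b ⊗ b') (c ⊗ c') = (b ▷ c) ⊗ (b' ▷ c')`. -/
structure IsLeftHomModuleCoalg {k V W : Type*} [Field k] [AddCommGroup V] [Module k V]
    [AddCommGroup W] [Module k W] (B : HomHopfData k V) (C : HomHopfData k W)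
    (γ : W →ₗ[k] W) (act : V →ₗ[k] W →ₗ[k] W) : Prop where
  coalgEnd : IsHomCoalgEnd C γ
  act_act : ∀ b b' c, act (B.twist b) (act b' c) = act (B.mul b b') (γ c)
  one_act : ∀ c, act B.one c = γ c
  cotwist_act : ∀ b c, C.cotwist (act b c) = act (B.cotwist b) (C.cotwist c)
  comul_act : ∀ b c, C.comul (act b c) = TensorProduct.map₂ act act (B.comul b) (C.comul c)
  counit_act : ∀ b c, C.counit (act b c) = B.counit b * C.counit c

/-- `(C, γ)` is a right `B`-Hom-module coalgebra through `act c b = c ◁ b`. -/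
structure IsRightHomModuleCoalg {k V W : Type*} [Field k] [AddCommGroup V] [Module k V]
    [AddCommGroup W] [Module k W] (B : HomHopfData k V) (C : HomHopfData k W)
    (γ : W →ₗ[k] W) (act : W →ₗ[k] V →ₗ[k] W) : Prop where
  coalgEnd : IsHomCoalgEnd C γ
  act_act : ∀ c b b', act (act c b) (B.twist b') = act (γ c) (B.mul b b')
  act_one : ∀ c, act c B.one = γ c
  cotwist_act : ∀ c b, C.cotwist (act c b) = act (C.cotwist c) (B.cotwist b)
  comul_act : ∀ c b, C.comul (act c b) = TensorProduct.map₂ act act (C.comul c) (B.comul b)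
  counit_act : ∀ c b, C.counit (act c b) = C.counit c * B.counit b

/-- `(A, B)` is a matched pair of Hom-Hopf algebras through `L v u = v ▷ u` and `R v u = v ◁ u`,
where `A` has type `(φ, ψ)` and `B` has type `(α, β)`, all four maps invertible. For bilinear `P`,
`Q`, the tensor `TensorProduct.map₂ P Q (Δ v) (Δ u)` is the Sweedler sum
`∑ P v₁ u₁ ⊗ Q v₂ u₂`, and `P.compl₁₂ f g` is `(v, u) ↦ P (f v) (g u)`. -/
structure IsHomHopfMatchedPair {k V W : Type*} [Field k] [AddCommGroup V] [Module k V]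
    [AddCommGroup W] [Module k W] (A : HomHopfData k V) (B : HomHopfData k W)
    (L : W →ₗ[k] V →ₗ[k] V) (R : W →ₗ[k] V →ₗ[k] W) : Prop where
  left_isHomHopf : IsHomHopf A
  right_isHomHopf : IsHomHopf B
  left_twist_bijective : Function.Bijective A.twist
  left_cotwist_bijective : Function.Bijective A.cotwist
  right_twist_bijective : Function.Bijective B.twist
  right_cotwist_bijective : Function.Bijective B.cotwist
  left_module : IsLeftHomModuleCoalg B A A.twist L
  twist_left : ∀ v u, A.twist (L v u) = L (B.twist v) (A.twist u)
  right_module : IsRightHomModuleCoalg A B B.twist R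
  twist_right : ∀ v u, B.twist (R v u) = R (B.twist v) (A.twist u)
  /-- `v ▷ (u u') = ∑ (α⁻¹β⁻¹v₁ ▷ ψ⁻¹u₁) ((α⁻²β⁻¹v₂ ◁ φ⁻¹ψ⁻¹u₂) ▷ u')` -/
  left_mul : ∀ v u u', L v (A.mul u u')
    = TensorProduct.lift (A.mul.compl₂ (L.flip u'))
        (TensorProduct.map₂
          (L.compl₁₂ (linInv B.twist ∘ₗ linInv B.cotwist) (linInv A.cotwist))
          (R.compl₁₂ (linInv B.twist ∘ₗ linInv B.twist ∘ₗ linInv B.cotwist)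
            (linInv A.twist ∘ₗ linInv A.cotwist))
          (B.comul v) (A.comul u))
  /-- `(v v') ◁ u = ∑ (v ◁ (α⁻¹β⁻¹v'₁ ▷ φ⁻²ψ⁻¹u₁)) (β⁻¹v'₂ ◁ φ⁻¹ψ⁻¹u₂)` -/
  mul_right : ∀ v v' u, R (B.mul v v') u
    = TensorProduct.lift (B.mul ∘ₗ R v)
        (TensorProduct.map₂
          (L.compl₁₂ (linInv B.twist ∘ₗ linInv B.cotwist)
            (linInv A.twist ∘ₗ linInv A.twist ∘ₗ linInv A.cotwist))
          (R.compl₁₂ (linInv B.cotwist) (linInv A.twist ∘ₗ linInv A.cotwist))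
          (B.comul v') (A.comul u))
  /-- `∑ (v₁ ◁ u₁) ⊗ (v₂ ▷ u₂) = ∑ (v₂ ◁ u₂) ⊗ (v₁ ▷ u₁)` -/
  switch : ∀ v u, TensorProduct.map₂ R L (B.comul v) (A.comul u)
    = TensorProduct.comm k V W (TensorProduct.map₂ L R (B.comul v) (A.comul u))
  left_one : ∀ v, L v A.one = B.counit v • A.one
  one_right : ∀ u, R B.one u = A.counit u • B.one

/-! ### Weighted trees -/

/-- Planar binary trees whose leaves carry a weight `s : ℕ` and a label in `g`: the symbols
`(φ, s₁, …, sₙ, ξ₁, …, ξₙ)` with `φ` an `n`-tree and `n ≥ 1`. -/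
inductive WTree (g : Type*) where
  | leaf (s : ℕ) (ξ : g) : WTree g
  | node (l r : WTree g) : WTree g

namespace WTree

variable {g : Type*}

/-- All weights raised by one. -/
def shift : WTree g → WTree g
  | leaf s ξ => leaf (s + 1) ξ
  | node l r => node l.shift r.shift

/-- A map applied to all labels. -/
def map {g' : Type*} (f : g → g') : WTree g → WTree g'
  | leaf s ξ => leaf s (f ξ)
  | node l r => node (l.map f) (r.map f)

/-- The set of leaves. -/
def Leaves : WTree g → Type
  | leaf _ _ => Unit
  | node l r => l.Leaves ⊕ r.Leaves

instance instFintypeLeaves : (t : WTree g) → Fintype t.Leaves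
  | leaf _ _ => inferInstanceAs (Fintype Unit)
  | node l r =>
    letI := instFintypeLeaves l
    letI := instFintypeLeaves r
    inferInstanceAs (Fintype (l.Leaves ⊕ r.Leaves))

instance instDecidableEqLeaves : (t : WTree g) → DecidableEq t.Leaves
  | leaf _ _ => inferInstanceAs (DecidableEq Unit)
  | node l r =>
    letI := instDecidableEqLeaves l
    letI := instDecidableEqLeaves r
    inferInstanceAs (DecidableEq (l.Leaves ⊕ r.Leaves))

end WTree

section Trees

variable {k g : Type*} [Field k] [AddCommGroup g] [Module k g] (G : HomLieAlg k g)

/-- The operation `a` on `{1} ∪ {trees}` (`none` is the external symbol `1`): `a(1) = 1`, and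
`φ` is applied to all labels of a tree. -/
def treeTwist (b : Option (WTree g)) : Option (WTree g) := b.map (WTree.map G.twist)

/-- Grafting on `{1} ∪ {trees}`, with `1 ∨ 1 = 1` and `1 ∨ t = t ∨ 1 = a(t)`. -/
def graft : Option (WTree g) → Option (WTree g) → Option (WTree g)
  | none, b => treeTwist G b
  | a, none => treeTwist G a
  | some s, some t => some (WTree.node s t)

/-- `t_I`: the leaves outside `I` are replaced by `1`. -/
def prune : (t : WTree g) → (t.Leaves → Bool) → Option (WTree g)
  | WTree.leaf s ξ, I => if I () then some (WTree.leaf s ξ) else none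
  | WTree.node l r, I => graft G (prune l fun i => I (Sum.inl i)) (prune r fun i => I (Sum.inr i))

/-- The vector space with basis `{1} ∪ {trees labelled by elements of g}`. Multilinearity in the
labels is imposed below (`EnvRel.leaf_add`, `EnvRel.leaf_smul`). -/
abbrev TreeSpace (k g : Type*) [Field k] : Type _ := Option (WTree g) →₀ k

/-- The basis vector of an element of `{1} ∪ {trees}`. -/
abbrev basisVec (k : Type*) {g : Type*} [Field k] (b : Option (WTree g)) : TreeSpace k g :=
  Finsupp.single b 1

/-- The basis vector of a tree. -/
abbrev treeVec (k : Type*) {g : Type*} [Field k] (t : WTree g) : TreeSpace k g :=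
  basisVec k (some t)

/-- Bilinear extension of grafting. -/
def treeMul : TreeSpace k g →ₗ[k] TreeSpace k g →ₗ[k] TreeSpace k g :=
  Finsupp.linearCombination k fun a =>
    Finsupp.linearCombination k fun b => basisVec k (graft G a b)

/-- Linear extension of `a`. -/
def treeTwistLin : TreeSpace k g →ₗ[k] TreeSpace k g :=
  Finsupp.linearCombination k fun b => basisVec k (treeTwist G b)

/-- `Δ(1) = 1 ⊗ 1`, `Δ(t) = ∑ t_I ⊗ t_J` over all partitions `I ⊔ J` of the leaves of `t`. -/
def treeComul : TreeSpace k g →ₗ[k] TreeSpace k g ⊗[k] TreeSpace k g :=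
  Finsupp.linearCombination k fun b => match b with
    | none => basisVec k none ⊗ₜ[k] basisVec k none
    | some t => ∑ I : t.Leaves → Bool,
        basisVec k (prune G t I) ⊗ₜ[k] basisVec k (prune G t fun i => !(I i))

/-- `ε(1) = 1`, `ε(t) = 0`. -/
def treeCounit (k g : Type*) [Field k] : TreeSpace k g →ₗ[k] k :=
  Finsupp.linearCombination k fun b => match b with
    | none => 1
    | some _ => 0

/-- The antipode of a tree: `S(leaf) = - leaf`, `S(t ∨ t') = S(t') ∨ S(t)`. -/
def antipodeTree : WTree g → TreeSpace k g
  | WTree.leaf s ξ => -treeVec k (WTree.leaf s ξ)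
  | WTree.node l r => treeMul G (antipodeTree r) (antipodeTree l)

/-- Linear extension of the antipode, with `S(1) = 1`. -/
def treeAntipode : TreeSpace k g →ₗ[k] TreeSpace k g :=
  Finsupp.linearCombination k fun b => match b with
    | none => basisVec k none
    | some t => antipodeTree G t

/-- The elements obtained from the following by repeated grafting with elements of `{1} ∪ {trees}`
on either side: (multi)linearity in the labels; Hom-associativity; the weight relations
`(s, ξ) - (0, φ^s ξ)`; the bracket relations `ξ ∨ ξ' - ξ' ∨ ξ - [ξ, ξ']`. -/
inductive EnvRel : TreeSpace k g → Prop where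
  | leaf_add (s : ℕ) (ξ ξ' : g) : EnvRel (treeVec k (WTree.leaf s (ξ + ξ'))
      - treeVec k (WTree.leaf s ξ) - treeVec k (WTree.leaf s ξ'))
  | leaf_smul (s : ℕ) (c : k) (ξ : g) : EnvRel (treeVec k (WTree.leaf s (c • ξ))
      - c • treeVec k (WTree.leaf s ξ))
  | assoc (x y z : WTree g) : EnvRel (treeVec k (WTree.node (WTree.node x y) z.shift)
      - treeVec k (WTree.node x.shift (WTree.node y z)))
  | weight (s : ℕ) (ξ : g) : EnvRel (treeVec k (WTree.leaf s ξ)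
      - treeVec k (WTree.leaf 0 ((G.twist ^ s) ξ)))
  | bracket (ξ ξ' : g) : EnvRel (treeVec k (WTree.node (WTree.leaf 0 ξ) (WTree.leaf 0 ξ'))
      - treeVec k (WTree.node (WTree.leaf 0 ξ') (WTree.leaf 0 ξ))
      - treeVec k (WTree.leaf 0 (G.bracket ξ ξ')))
  | mul_left (a : Option (WTree g)) {x : TreeSpace k g} :
      EnvRel x → EnvRel (treeMul G (basisVec k a) x)
  | mul_right (a : Option (WTree g)) {x : TreeSpace k g} :
      EnvRel x → EnvRel (treeMul G x (basisVec k a))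

/-- The two-sided ideal of relations of the universal enveloping Hom-Hopf algebra. -/
def envIdeal : Submodule k (TreeSpace k g) := Submodule.span k {x | EnvRel G x}

/-- The vector space underlying the universal enveloping Hom-Hopf algebra `U(g)`. -/
abbrev Env : Type _ := TreeSpace k g ⧸ envIdeal G

/-- The class in `U(g)`. -/
def envMk : TreeSpace k g →ₗ[k] Env G := (envIdeal G).mkQ

/-- The class of the weighted one-leaf tree `(s, ξ)`. -/
def envLeaf (s : ℕ) (ξ : g) : Env G := envMk G (treeVec k (WTree.leaf s ξ))

variable {G}

@[simp] theorem treeMul_basis (a b : Option (WTree g)) :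
    treeMul G (basisVec k a) (basisVec k b) = basisVec k (graft G a b) := by
  simp [treeMul]

@[simp] theorem treeTwistLin_basis (b : Option (WTree g)) :
    treeTwistLin G (basisVec k b) = basisVec k (treeTwist G b) := by
  simp [treeTwistLin]

theorem envMk_rel {x : TreeSpace k g} (h : EnvRel G x) : envMk G x = 0 :=
  (Submodule.Quotient.mk_eq_zero _).2 (Submodule.subset_span h)

theorem treeSpace_ext {A : Type*} [AddCommGroup A] [Module k A] {f f' : TreeSpace k g →ₗ[k] A}
    (h : ∀ b, f (basisVec k b) = f' (basisVec k b)) : f = f' := by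
  refine Finsupp.lhom_ext' fun b => ?_
  ext
  simpa using h b

theorem env_ext {A : Type*} [AddCommGroup A] [Module k A] {f f' : Env G →ₗ[k] A}
    (h : ∀ b, f (envMk G (basisVec k b)) = f' (envMk G (basisVec k b))) : f = f' := by
  exact Submodule.linearMap_qext _ (treeSpace_ext fun b => h b)

theorem treeMul_mem_left (x : TreeSpace k g) :
    ∀ y ∈ envIdeal G, treeMul G x y ∈ envIdeal G := by
  intro y hy
  induction hy using Submodule.span_induction with
  | mem y hy =>
    induction x using Finsupp.induction_linear with
    | zero => simp
    | add a b ha hb => simpa using Submodule.add_mem _ ha hb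
    | single b c =>
      have : Finsupp.single b c = c • basisVec k b := by simp
      rw [this, map_smul, LinearMap.smul_apply]
      exact Submodule.smul_mem _ _ (Submodule.subset_span (EnvRel.mul_left b hy))
  | zero => simp
  | add a b _ _ ha hb => simpa using Submodule.add_mem _ ha hb
  | smul c a _ ha => simpa using Submodule.smul_mem _ c ha

theorem treeMul_mem_right (x : TreeSpace k g) :
    ∀ y ∈ envIdeal G, treeMul G y x ∈ envIdeal G := by
  intro y hy
  induction hy using Submodule.span_induction with
  | mem y hy =>
    induction x using Finsupp.induction_linear with
    | zero => simp
    | add a b ha hb => simpa using Submodule.add_mem _ ha hb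
    | single b c =>
      have : Finsupp.single b c = c • basisVec k b := by simp
      rw [this, map_smul]
      exact Submodule.smul_mem _ _ (Submodule.subset_span (EnvRel.mul_right b hy))
  | zero => simp
  | add a b _ _ ha hb => simpa using Submodule.add_mem _ ha hb
  | smul c a _ ha => simpa using Submodule.smul_mem _ c ha

variable (G)

/-- The multiplication of `U(g)`, induced by grafting. -/
def envMul : Env G →ₗ[k] Env G →ₗ[k] Env G :=
  (envIdeal G).liftQ
    { toFun := fun x => (envIdeal G).liftQ (envMk G ∘ₗ treeMul G x) (by
        intro y hy
        exact (Submodule.Quotient.mk_eq_zero _).2 (treeMul_mem_left x y hy))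
      map_add' := by
        intro x y
        refine Submodule.linearMap_qext _ (LinearMap.ext fun z => ?_)
        change envMk G (treeMul G (x + y) z) = envMk G (treeMul G x z) + envMk G (treeMul G y z)
        simp
      map_smul' := by
        intro c x
        refine Submodule.linearMap_qext _ (LinearMap.ext fun z => ?_)
        change envMk G (treeMul G (c • x) z) = c • envMk G (treeMul G x z)
        simp } (by
    intro y hy
    refine Submodule.linearMap_qext _ (LinearMap.ext fun z => ?_)
    exact (Submodule.Quotient.mk_eq_zero _).2 (treeMul_mem_right z y hy))

variable {G}

@[simp] theorem envMul_mk (x y : TreeSpace k g) :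
    envMul G (envMk G x) (envMk G y) = envMk G (treeMul G x y) := rfl

/-- A linear map out of the tree space that turns grafting into a bilinear operation and kills the
four families of relations kills the ideal. -/
theorem kills_envIdeal {A : Type*} [AddCommGroup A] [Module k A] (m : A →ₗ[k] A →ₗ[k] A)
    (f : TreeSpace k g →ₗ[k] A)
    (hm : ∀ a b, f (basisVec k (graft G a b)) = m (f (basisVec k a)) (f (basisVec k b)))
    (hadd : ∀ s ξ ξ', f (treeVec k (WTree.leaf s (ξ + ξ')))
      = f (treeVec k (WTree.leaf s ξ)) + f (treeVec k (WTree.leaf s ξ')))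
    (hsmul : ∀ s (c : k) ξ, f (treeVec k (WTree.leaf s (c • ξ)))
      = c • f (treeVec k (WTree.leaf s ξ)))
    (hassoc : ∀ x y z : WTree g, f (treeVec k (WTree.node (WTree.node x y) z.shift))
      = f (treeVec k (WTree.node x.shift (WTree.node y z))))
    (hweight : ∀ s ξ, f (treeVec k (WTree.leaf s ξ))
      = f (treeVec k (WTree.leaf 0 ((G.twist ^ s) ξ))))
    (hbracket : ∀ ξ ξ', f (treeVec k (WTree.node (WTree.leaf 0 ξ) (WTree.leaf 0 ξ')))
      - f (treeVec k (WTree.node (WTree.leaf 0 ξ') (WTree.leaf 0 ξ)))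
      = f (treeVec k (WTree.leaf 0 (G.bracket ξ ξ')))) :
    envIdeal G ≤ LinearMap.ker f := by
  have hm' : ∀ x y, f (treeMul G x y) = m (f x) (f y) := by
    intro x y
    have : (treeMul G).compr₂ f = m.compl₁₂ f f := by
      refine treeSpace_ext fun a => treeSpace_ext fun b => ?_
      simpa using hm a b
    exact LinearMap.congr_fun₂ this x y
  refine Submodule.span_le.2 fun x hx => ?_
  change f x = 0
  replace hx : EnvRel G x := hx
  clear hm
  induction hx with
  | leaf_add s ξ ξ' => simp [hadd]
  | leaf_smul s c ξ => rw [map_sub, hsmul, map_smul, sub_self]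
  | assoc x y z => rw [map_sub, hassoc, sub_self]
  | weight s ξ => rw [map_sub, hweight, sub_self]
  | bracket ξ ξ' => rw [map_sub, map_sub, hbracket, sub_self]
  | mul_left a _ ih => rw [hm', ih, map_zero]
  | mul_right a _ ih => rw [hm', ih, map_zero, LinearMap.zero_apply]

theorem envMk_leaf_add (s : ℕ) (ξ ξ' : g) : envMk G (treeVec k (WTree.leaf s (ξ + ξ')))
    = envMk G (treeVec k (WTree.leaf s ξ)) + envMk G (treeVec k (WTree.leaf s ξ')) := by
  have := envMk_rel (EnvRel.leaf_add (G := G) s ξ ξ')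
  rw [map_sub, map_sub, sub_sub] at this
  exact sub_eq_zero.1 this

theorem envMk_leaf_smul (s : ℕ) (c : k) (ξ : g) : envMk G (treeVec k (WTree.leaf s (c • ξ)))
    = c • envMk G (treeVec k (WTree.leaf s ξ)) := by
  have := envMk_rel (EnvRel.leaf_smul (G := G) s c ξ)
  rw [map_sub, map_smul] at this
  exact sub_eq_zero.1 this

theorem envMk_leaf (s : ℕ) (ξ : g) : envMk G (treeVec k (WTree.leaf s ξ))
    = envMk G (treeVec k (WTree.leaf 0 ((G.twist ^ s) ξ))) := by
  have := envMk_rel (EnvRel.weight (G := G) s ξ)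
  rw [map_sub] at this
  exact sub_eq_zero.1 this

theorem envMk_bracket (ξ ξ' : g) :
    envMk G (treeVec k (WTree.node (WTree.leaf 0 ξ) (WTree.leaf 0 ξ')))
      - envMk G (treeVec k (WTree.node (WTree.leaf 0 ξ') (WTree.leaf 0 ξ)))
      = envMk G (treeVec k (WTree.leaf 0 (G.bracket ξ ξ'))) := by
  have := envMk_rel (EnvRel.bracket (G := G) ξ ξ')
  rw [map_sub, map_sub] at this
  exact sub_eq_zero.1 this

theorem envMk_node (l r : WTree g) : envMk G (treeVec k (WTree.node l r))
    = envMul G (envMk G (treeVec k l)) (envMk G (treeVec k r)) := by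
  rw [envMul_mk, treeMul_basis]; rfl

/-- In `U(g)`, raising the weights by one is the same as applying `φ` to the labels. -/
theorem envMk_shift (t : WTree g) :
    envMk G (treeVec k t.shift) = envMk G (treeVec k (t.map G.twist)) := by
  induction t with
  | leaf s ξ =>
    simp only [WTree.shift, WTree.map]
    rw [envMk_leaf, envMk_leaf s, pow_succ]; rfl
  | node l r hl hr =>
    simp only [WTree.shift, WTree.map]
    rw [envMk_node, envMk_node, hl, hr]

theorem treeTwist_graft (a b : Option (WTree g)) :
    treeTwist G (graft G a b) = graft G (treeTwist G a) (treeTwist G b) := by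
  rcases a with _ | a <;> rcases b with _ | b <;> simp [treeTwist, graft, WTree.map]

theorem map_shift (t : WTree g) (f : g → g) : t.shift.map f = (t.map f).shift := by
  induction t with
  | leaf s ξ => rfl
  | node l r hl hr => simp [WTree.shift, WTree.map, hl, hr]

theorem twist_pow_comm (s : ℕ) (ξ : g) : G.twist ((G.twist ^ s) ξ) = (G.twist ^ s) (G.twist ξ) := by
  rw [← Module.End.mul_apply, ← Module.End.mul_apply, ← pow_succ, ← pow_succ']

variable (G)

/-- The structure map `φ` of `U(g)`, induced by `a`. -/
def envTwist : Env G →ₗ[k] Env G :=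
  (envIdeal G).liftQ (envMk G ∘ₗ treeTwistLin G) (by
    refine kills_envIdeal (envMul G) _ ?_ ?_ ?_ ?_ ?_ ?_
    · intro a b
      simp [treeTwist_graft]
    · intro s ξ ξ'
      simpa [treeTwist, WTree.map] using envMk_leaf_add s (G.twist ξ) (G.twist ξ')
    · intro s c ξ
      simpa [treeTwist, WTree.map] using envMk_leaf_smul s c (G.twist ξ)
    · intro x y z
      have := envMk_rel (EnvRel.assoc (G := G) (x.map G.twist) (y.map G.twist) (z.map G.twist))
      rw [map_sub, sub_eq_zero] at this
      simpa [treeTwist, WTree.map, map_shift] using this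
    · intro s ξ
      have := envMk_leaf (G := G) s (G.twist ξ)
      simpa [treeTwist, WTree.map, twist_pow_comm] using this
    · intro ξ ξ'
      have := envMk_bracket (G := G) (G.twist ξ) (G.twist ξ')
      simpa [treeTwist, WTree.map, G.twist_bracket] using this)

variable {G}

@[simp] theorem envTwist_mk (x : TreeSpace k g) :
    envTwist G (envMk G x) = envMk G (treeTwistLin G x) := rfl

theorem envTwist_mul (x y : Env G) :
    envTwist G (envMul G x y) = envMul G (envTwist G x) (envTwist G y) := by
  have : (envMul G).compr₂ (envTwist G) = (envMul G).compl₁₂ (envTwist G) (envTwist G) := by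
    refine env_ext fun a => env_ext fun b => ?_
    simp [treeTwist_graft]
  exact LinearMap.congr_fun₂ this x y

theorem envMk_shift' (t : WTree g) :
    envMk G (treeVec k t.shift) = envTwist G (envMk G (treeVec k t)) := by
  rw [envMk_shift, envTwist_mk, treeTwistLin_basis]; rfl

theorem envMul_assoc (x y z : Env G) :
    envMul G (envMul G x y) (envTwist G z) = envMul G (envTwist G x) (envMul G y z) := by
  have hT : ∀ a b c : Option (WTree g),
      envMul G (envMul G (envMk G (basisVec k a)) (envMk G (basisVec k b)))
        (envTwist G (envMk G (basisVec k c)))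
      = envMul G (envTwist G (envMk G (basisVec k a)))
        (envMul G (envMk G (basisVec k b)) (envMk G (basisVec k c))) := by
    intro a b c
    rcases a with _ | a
    · rcases b with _ | b <;> rcases c with _ | c <;> simp [graft, treeTwist, WTree.map]
    rcases b with _ | b
    · rcases c with _ | c <;> simp [graft, treeTwist]
    rcases c with _ | c
    · simp [graft, treeTwist, WTree.map]
    · have := envMk_rel (EnvRel.assoc (G := G) a b c)
      rw [map_sub, sub_eq_zero, envMk_node, envMk_node, envMk_node, envMk_node, envMk_shift',
        envMk_shift'] at this
      exact this
  have h1 : ∀ a b : Option (WTree g),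
      (envMul G (envMul G (envMk G (basisVec k a)) (envMk G (basisVec k b)))) ∘ₗ envTwist G
      = (envMul G (envTwist G (envMk G (basisVec k a)))) ∘ₗ
          (envMul G (envMk G (basisVec k b))) := fun a b => env_ext fun c => hT a b c
  have h2 : ∀ a : Option (WTree g),
      (envMul G).compl₁₂ (envMul G (envMk G (basisVec k a))) (envTwist G)
      = (envMul G).compr₂ (envMul G (envTwist G (envMk G (basisVec k a)))) := fun a =>
    env_ext fun b => h1 a b
  have h3 : ((envMul G).compl₁₂ ((envMul G).flip y) (envTwist G)).flip z
      = ((envMul G).flip (envMul G y z)) ∘ₗ envTwist G := env_ext fun a =>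
    LinearMap.congr_fun₂ (h2 a) y z
  exact LinearMap.congr_fun h3 x

/-- The coproduct of trees, followed by the projection to `U(g) ⊗ U(g)`. -/
def preComul (G : HomLieAlg k g) : TreeSpace k g →ₗ[k] Env G ⊗[k] Env G :=
  TensorProduct.map (envMk G) (envMk G) ∘ₗ treeComul G

theorem preComul_none : preComul G (basisVec k none)
    = envMk G (basisVec k none) ⊗ₜ[k] envMk G (basisVec k none) := by
  simp [preComul, treeComul]

theorem preComul_leaf (s : ℕ) (ξ : g) : preComul G (treeVec k (WTree.leaf s ξ))
    = envMk G (treeVec k (WTree.leaf s ξ)) ⊗ₜ[k] envMk G (basisVec k none)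
      + envMk G (basisVec k none) ⊗ₜ[k] envMk G (treeVec k (WTree.leaf s ξ)) := by
  have key : ∀ F : (Unit → Bool) → Env G ⊗[k] Env G,
      ∑ I : Unit → Bool, F I = F (fun _ => true) + F (fun _ => false) := by
    intro F
    rw [← (Equiv.funUnique Unit Bool).symm.sum_comp]
    simp
    rfl
  simp only [preComul, treeComul, LinearMap.comp_apply, Finsupp.linearCombination_single, one_smul,
    map_sum, TensorProduct.map_tmul]
  refine (key fun I => envMk G (basisVec k (prune G (WTree.leaf s ξ) I)) ⊗ₜ[k]
    envMk G (basisVec k (prune G (WTree.leaf s ξ) fun i => !(I i)))).trans ?_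
  simp [prune]

theorem preComul_node (l r : WTree g) : preComul G (treeVec k (WTree.node l r))
    = TensorProduct.map₂ (envMul G) (envMul G) (preComul G (treeVec k l))
        (preComul G (treeVec k r)) := by
  have key : ∀ F : (l.Leaves ⊕ r.Leaves → Bool) → Env G ⊗[k] Env G,
      ∑ I, F I = ∑ I : l.Leaves → Bool, ∑ J : r.Leaves → Bool, F (Sum.elim I J) := by
    intro F
    rw [← (Equiv.sumArrowEquivProdArrow l.Leaves r.Leaves Bool).symm.sum_comp,
      Fintype.sum_prod_type]
    rfl
  simp only [preComul, treeComul, LinearMap.comp_apply, Finsupp.linearCombination_single, one_smul,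
    map_sum, TensorProduct.map_tmul, LinearMap.sum_apply]
  refine (key fun I => envMk G (basisVec k (prune G (WTree.node l r) I)) ⊗ₜ[k]
    envMk G (basisVec k (prune G (WTree.node l r) fun i => !(I i)))).trans ?_
  rw [Finset.sum_comm]
  refine Finset.sum_congr rfl fun J _ => Finset.sum_congr rfl fun I _ => ?_
  simp [prune]

theorem tensorMap_map₂ {A B : Type*} [AddCommGroup A] [Module k A] [AddCommGroup B] [Module k B]
    (m : A →ₗ[k] A →ₗ[k] A) (n : B →ₗ[k] B →ₗ[k] B) (f : A →ₗ[k] A) (f' : B →ₗ[k] B)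
    (hf : ∀ x y, f (m x y) = m (f x) (f y)) (hf' : ∀ x y, f' (n x y) = n (f' x) (f' y))
    (u v : A ⊗[k] B) : TensorProduct.map f f' (TensorProduct.map₂ m n u v)
      = TensorProduct.map₂ m n (TensorProduct.map f f' u) (TensorProduct.map f f' v) := by
  induction u with
  | zero => simp
  | add a b ha hb => simp [ha, hb]
  | tmul a b =>
    induction v with
    | zero => simp
    | add c d hc hd => simp only [map_add, hc, hd]
    | tmul c d => simp [hf, hf']

theorem preComul_map (t : WTree g) : preComul G (treeVec k (t.map G.twist))
    = TensorProduct.map (envTwist G) (envTwist G) (preComul G (treeVec k t)) := by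
  induction t with
  | leaf s ξ => simp [WTree.map, preComul_leaf, treeTwist]
  | node l r hl hr =>
    simp only [WTree.map]
    rw [preComul_node, preComul_node, hl, hr, tensorMap_map₂ _ _ _ _ envTwist_mul envTwist_mul]

theorem envOne_mul (x : Env G) : envMul G (envMk G (basisVec k none)) x = envTwist G x := by
  have : envMul G (envMk G (basisVec k none)) = envTwist G := env_ext fun b => by
    simp [graft]
  rw [this]

theorem envMul_one (x : Env G) : envMul G x (envMk G (basisVec k none)) = envTwist G x := by
  have : (envMul G).flip (envMk G (basisVec k none)) = envTwist G := env_ext fun b => by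
    rcases b with _ | b <;> simp [graft]
  rw [← this]; rfl

theorem preComul_graft (a b : Option (WTree g)) : preComul G (basisVec k (graft G a b))
    = TensorProduct.map₂ (envMul G) (envMul G) (preComul G (basisVec k a))
        (preComul G (basisVec k b)) := by
  have hl : envMul G (envMk G (basisVec k none)) = envTwist G := LinearMap.ext envOne_mul
  have h1 : ∀ u, TensorProduct.map₂ (envMul G) (envMul G)
      (envMk G (basisVec k none) ⊗ₜ[k] envMk G (basisVec k none)) u
      = TensorProduct.map (envTwist G) (envTwist G) u := by
    intro u
    rw [TensorProduct.map₂_apply_tmul, hl]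
  have h2 : ∀ u, TensorProduct.map₂ (envMul G) (envMul G) u
      (envMk G (basisVec k none) ⊗ₜ[k] envMk G (basisVec k none))
      = TensorProduct.map (envTwist G) (envTwist G) u := by
    intro u
    induction u with
    | zero => simp
    | add a b ha hb => simp [ha, hb]
    | tmul a b => rw [TensorProduct.map₂_apply_tmul, TensorProduct.map_tmul,
        TensorProduct.map_tmul, envMul_one, envMul_one]
  rcases a with _ | a
  · rw [preComul_none, h1]
    rcases b with _ | b
    · simp [graft, treeTwist, preComul_none]
    · exact preComul_map b
  · rcases b with _ | b
    · rw [preComul_none, h2]; exact preComul_map a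
    · exact preComul_node a b

theorem preComul_shift (t : WTree g) : preComul G (treeVec k t.shift)
    = preComul G (treeVec k (t.map G.twist)) := by
  induction t with
  | leaf s ξ =>
    simp only [WTree.shift, WTree.map]
    have h : envMk G (treeVec k (WTree.leaf (s + 1) ξ))
      = envMk G (treeVec k (WTree.leaf s (G.twist ξ))) := envMk_shift (WTree.leaf s ξ)
    rw [preComul_leaf, preComul_leaf, h]
  | node l r hl hr =>
    simp only [WTree.shift, WTree.map]
    rw [preComul_node, preComul_node, hl, hr]

theorem map₂_envMul_assoc (u v w : Env G ⊗[k] Env G) :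
    TensorProduct.map₂ (envMul G) (envMul G)
      (TensorProduct.map₂ (envMul G) (envMul G) u v)
      (TensorProduct.map (envTwist G) (envTwist G) w)
    = TensorProduct.map₂ (envMul G) (envMul G)
      (TensorProduct.map (envTwist G) (envTwist G) u)
      (TensorProduct.map₂ (envMul G) (envMul G) v w) := by
  induction u with
  | zero => simp
  | add a b ha hb => simp [ha, hb]
  | tmul a b =>
    induction v with
    | zero => simp
    | add c d hc hd => simp only [map_add, LinearMap.add_apply, hc, hd]
    | tmul c d =>
      induction w with
      | zero => simp
      | add e f he hf => simp only [map_add, he, hf]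
      | tmul e f => simp only [TensorProduct.map₂_apply_tmul, TensorProduct.map_tmul, envMul_assoc]

variable (G)

/-- The coproduct of `U(g)`. -/
def envComul : Env G →ₗ[k] Env G ⊗[k] Env G :=
  (envIdeal G).liftQ (preComul G) (by
    refine kills_envIdeal (TensorProduct.map₂ (envMul G) (envMul G)) _ preComul_graft ?_ ?_ ?_ ?_ ?_
    · intro s ξ ξ'
      rw [preComul_leaf, preComul_leaf, preComul_leaf, envMk_leaf_add, TensorProduct.add_tmul,
        TensorProduct.tmul_add]
      abel
    · intro s c ξ
      rw [preComul_leaf, preComul_leaf, envMk_leaf_smul, smul_add, TensorProduct.smul_tmul',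
        TensorProduct.tmul_smul]
    · intro x y z
      rw [preComul_node, preComul_node, preComul_node, preComul_node, preComul_shift,
        preComul_shift, preComul_map, preComul_map, map₂_envMul_assoc]
    · intro s ξ
      rw [preComul_leaf, preComul_leaf, envMk_leaf]
    · intro ξ ξ'
      rw [preComul_node, preComul_node, preComul_leaf, preComul_leaf, preComul_leaf,
        ← envMk_bracket, envMk_node, envMk_node]
      have h1 : envTwist G (envMk G (basisVec k none)) = envMk G (basisVec k none) := by
        rw [envTwist_mk, treeTwistLin_basis]; rfl
      simp only [map_add, LinearMap.add_apply, TensorProduct.map₂_apply_tmul,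
        TensorProduct.map_tmul, envMul_one, envOne_mul, TensorProduct.sub_tmul,
        TensorProduct.tmul_sub, h1]
      abel)

/-- The counit of `U(g)`. -/
def envCounit : Env G →ₗ[k] k :=
  (envIdeal G).liftQ (treeCounit k g) (by
    refine kills_envIdeal (LinearMap.mul k k) _ ?_ ?_ ?_ ?_ ?_ ?_
    · intro a b
      rcases a with _ | a <;> rcases b with _ | b <;> simp [treeCounit, graft, treeTwist]
    all_goals intros; simp [treeCounit])

variable {G}

theorem antipodeTree_map (t : WTree g) : antipodeTree (k := k) G (t.map G.twist)
    = treeTwistLin G (antipodeTree G t) := by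
  have hmul : ∀ x y, treeTwistLin G (treeMul G x y)
      = treeMul G (treeTwistLin G x) (treeTwistLin G y) := by
    intro x y
    have : (treeMul G).compr₂ (treeTwistLin G)
        = (treeMul G).compl₁₂ (treeTwistLin G) (treeTwistLin G) := by
      refine treeSpace_ext fun a => treeSpace_ext fun b => ?_
      simp [treeTwist_graft]
    exact LinearMap.congr_fun₂ this x y
  induction t with
  | leaf s ξ =>
    rw [WTree.map, antipodeTree, antipodeTree, map_neg, treeTwistLin_basis]; rfl
  | node l r hl hr => rw [WTree.map, antipodeTree, antipodeTree, hl, hr, hmul]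

theorem preAntipode_node (l r : WTree g) : envMk G (antipodeTree G (WTree.node l r))
    = envMul G (envMk G (antipodeTree G r)) (envMk G (antipodeTree G l)) := by
  rw [antipodeTree, envMul_mk]

theorem preAntipode_leaf (s : ℕ) (ξ : g) : envMk G (antipodeTree G (WTree.leaf s ξ))
    = -envMk G (treeVec k (WTree.leaf s ξ)) := by
  rw [antipodeTree, map_neg]

theorem preAntipode_shift (t : WTree g) : envMk G (antipodeTree G t.shift)
    = envTwist G (envMk G (antipodeTree G t)) := by
  induction t with
  | leaf s ξ =>
    have h := envMk_shift' (G := G) (WTree.leaf s ξ)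
    rw [WTree.shift] at h ⊢
    rw [preAntipode_leaf, preAntipode_leaf, map_neg, h]
  | node l r hl hr =>
    rw [WTree.shift, preAntipode_node, preAntipode_node, hl, hr, envTwist_mul]

variable (G)

/-- The antipode of `U(g)`. -/
def envAntipode : Env G →ₗ[k] Env G :=
  (envIdeal G).liftQ (envMk G ∘ₗ treeAntipode G) (by
    have ht : ∀ t : WTree g, (envMk G ∘ₗ treeAntipode G) (treeVec k t)
        = envMk G (antipodeTree G t) := by
      intro t; simp [treeAntipode]
    have h1 : (envMk G ∘ₗ treeAntipode G) (basisVec k none) = envMk G (basisVec k none) := by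
      simp [treeAntipode]
    have hn : ∀ t : WTree g, envMk G (antipodeTree G (t.map G.twist))
        = envTwist G (envMk G (antipodeTree G t)) := by
      intro t; rw [antipodeTree_map, envTwist_mk]
    refine kills_envIdeal (envMul G).flip _ ?_ ?_ ?_ ?_ ?_ ?_
    · intro a b
      rw [LinearMap.flip_apply]
      rcases a with _ | a
      · rcases b with _ | b
        · rw [show graft G none none = none from rfl, h1, envMul_one, envTwist_mk,
            treeTwistLin_basis]
          rfl
        · rw [show graft G none (some b) = some (b.map G.twist) from rfl, h1, envMul_one,
            ht, ht, hn]
      · rcases b with _ | b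
        · rw [show graft G (some a) none = some (a.map G.twist) from rfl, h1, envOne_mul,
            ht, ht, hn]
        · rw [show graft G (some a) (some b) = some (WTree.node a b) from rfl, ht, ht, ht,
            preAntipode_node]
    · intro s ξ ξ'
      rw [ht, ht, ht, preAntipode_leaf, preAntipode_leaf, preAntipode_leaf, envMk_leaf_add, neg_add]
    · intro s c ξ
      rw [ht, ht, preAntipode_leaf, preAntipode_leaf, envMk_leaf_smul, smul_neg]
    · intro x y z
      rw [ht, ht, preAntipode_node, preAntipode_node, preAntipode_node, preAntipode_node,
        preAntipode_shift, preAntipode_shift, envMul_assoc]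
    · intro s ξ
      rw [ht, ht, preAntipode_leaf, preAntipode_leaf, envMk_leaf]
    · intro ξ ξ'
      rw [ht, ht, ht, preAntipode_node, preAntipode_node, preAntipode_leaf, preAntipode_leaf,
        preAntipode_leaf, ← envMk_bracket, envMk_node, envMk_node]
      simp)

/-- The universal enveloping Hom-Hopf algebra `U(g)`, of type `(φ, Id)`: its structure maps. -/
def envHopf : HomHopfData k (Env G) where
  mul := envMul G
  one := envMk G (basisVec k none)
  twist := envTwist G
  comul := envComul G
  counit := envCounit G
  cotwist := LinearMap.id
  antipode := envAntipode G

end Trees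

/-! ### The actions induced on the enveloping algebras -/

/-- The actions `lact = ▷`, `ract = ◁` between `U(g)` and `U(h)` induced by the actions of a matched
pair of Hom-Lie algebras with invertible twists, with the intermediate actions they are built
from. -/
structure InducedActions {k g h : Type*} [Field k] [AddCommGroup g] [Module k g]
    [AddCommGroup h] [Module k h] {G : HomLieAlg k g} {H : HomLieAlg k h}
    (M : HomLieMatchedPair G H) where
  /-- right action of `U(g)` on `h` -/
  ractLie : h →ₗ[k] Env G →ₗ[k] h
  /-- left action of `h` on `U(g)` -/
  lieLact : h →ₗ[k] Env G →ₗ[k] Env G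
  /-- left action of `U(h)` on `g` -/
  lactLie : Env H →ₗ[k] g →ₗ[k] g
  /-- right action of `g` on `U(h)` -/
  lieRact : Env H →ₗ[k] g →ₗ[k] Env H
  /-- left action of `U(h)` on `U(g)` -/
  lact : Env H →ₗ[k] Env G →ₗ[k] Env G
  /-- right action of `U(g)` on `U(h)` -/
  ract : Env H →ₗ[k] Env G →ₗ[k] Env H
  -- `η ◁ 1 = α(η)`, `η ◁ (s, ξ) = η ◁ φ^s(ξ)`, `α(η) ◁ (x ∨ y) = (η ◁ x) ◁ φ(y)`
  ractLie_one : ∀ η, ractLie η (envHopf G).one = H.twist η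
  ractLie_leaf : ∀ η s ξ, ractLie η (envLeaf G s ξ) = M.ract η ((G.twist ^ s) ξ)
  ractLie_mul : ∀ η x y, ractLie (H.twist η) (envMul G x y)
    = ractLie (ractLie η x) (envTwist G y)
  -- `η ▷ 1 = 0`, `η ▷ (s, ξ) = (s, α^{-s}(η) ▷ ξ)`,
  -- `η ▷ (x ∨ y) = (α⁻¹η ▷ x) ∨ φ(y) + ∑ φ(x₁) ∨ ((α⁻²η ◁ φ⁻¹x₂) ▷ y)`
  lieLact_one : ∀ η, lieLact η (envHopf G).one = 0
  lieLact_leaf : ∀ η s ξ, lieLact η (envLeaf G s ξ)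
    = envLeaf G s (M.lact ((linInv H.twist ^ s) η) ξ)
  lieLact_mul : ∀ η x y, lieLact η (envMul G x y)
    = envMul G (lieLact (linInv H.twist η) x) (envTwist G y)
      + TensorProduct.lift ((envMul G).compl₂ (lieLact.flip y))
          (TensorProduct.map (envTwist G)
            (ractLie (linInv H.twist (linInv H.twist η)) ∘ₗ linInv (envTwist G))
            (envComul G x))
  -- `1 ▷ ξ = φ(ξ)`, `(s, η) ▷ ξ = α^s(η) ▷ ξ`, `(v ∨ w) ▷ φ(ξ) = α(v) ▷ (w ▷ ξ)`
  lactLie_one : ∀ ξ, lactLie (envHopf H).one ξ = G.twist ξ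
  lactLie_leaf : ∀ s η ξ, lactLie (envLeaf H s η) ξ = M.lact ((H.twist ^ s) η) ξ
  lactLie_mul : ∀ v w ξ, lactLie (envMul H v w) (G.twist ξ)
    = lactLie (envTwist H v) (lactLie w ξ)
  -- `1 ◁ ξ = 0`, `(s, η) ◁ ξ = (s, η ◁ φ^{-s}(ξ))`,
  -- `(v ∨ w) ◁ ξ = α(v) ∨ (w ◁ φ⁻¹ξ) + ∑ (v ◁ (α⁻¹w₁ ▷ φ⁻²ξ)) ∨ α(w₂)`
  lieRact_one : ∀ ξ, lieRact (envHopf H).one ξ = 0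
  lieRact_leaf : ∀ s η ξ, lieRact (envLeaf H s η) ξ
    = envLeaf H s (M.ract η ((linInv G.twist ^ s) ξ))
  lieRact_mul : ∀ v w ξ, lieRact (envMul H v w) ξ
    = envMul H (envTwist H v) (lieRact w (linInv G.twist ξ))
      + TensorProduct.lift (envMul H ∘ₗ lieRact v)
          (TensorProduct.map
            (lactLie.flip (linInv G.twist (linInv G.twist ξ)) ∘ₗ linInv (envTwist H))
            (envTwist H)
            (envComul H w))
  -- `1 ▷ u = φ(u)`, `(s, η) ▷ u = α^s(η) ▷ u`, `(v ∨ w) ▷ φ(u) = α(v) ▷ (w ▷ u)`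
  lact_one : ∀ u, lact (envHopf H).one u = envTwist G u
  lact_leaf : ∀ s η u, lact (envLeaf H s η) u = lieLact ((H.twist ^ s) η) u
  lact_mul : ∀ v w u, lact (envMul H v w) (envTwist G u) = lact (envTwist H v) (lact w u)
  -- `v ◁ 1 = α(v)`, `v ◁ (s, ξ) = v ◁ φ^s(ξ)`, `α(v) ◁ (x ∨ y) = (v ◁ x) ◁ φ(y)`
  ract_one : ∀ v, ract v (envHopf G).one = envTwist H v
  ract_leaf : ∀ v s ξ, ract v (envLeaf G s ξ) = lieRact v ((G.twist ^ s) ξ)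
  ract_mul : ∀ v x y, ract (envTwist H v) (envMul G x y) = ract (ract v x) (envTwist G y)

end

/-! Because the twists are invertible, the statement is a twisted form of one about ordinary
enveloping algebras. On `g` put [x, y]' = φ⁻¹[x, y], similarly on `h`, and set η ▷' ξ = φ⁻¹(η ▷ ξ),
η ◁' ξ = α⁻¹(η ◁ ξ). Every matched pair identity composes two operations, so after φ² or α² is
cleared it becomes the usual, untwisted identity (`HomLieMatchedPair.untwist`), and φ, α become
automorphisms of the untwisted data. Let U denote the associative algebra in which the untwisted
bracket is the commutator. Sending 1 to 1, (s, ξ) to φ^s(ξ) and x ∨ y to φ(xy) identifies `Env` with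
U linearly (`HomLieAlg.envEquiv`), and it respects Δ and ε. The Hom-Hopf laws are then the laws of
the Hopf algebra U with powers of φ inserted.

For the untwisted problem, form the bracket of the double g ⋈ h on g × h. Multiplication U(g) ⊗ U(h)
→ U(g ⋈ h) is bijective. No PBW basis is used: U(g) ⊗ U(h) is made into a module over U(g ⋈ h), with
`g` acting by left multiplication and `h` by the crossing rule ηξ = η ▷ ξ + η ◁ ξ + ξη (`act_ι_mul`,
`act_comm`), and acting on 1 ⊗ 1 gives the inverse (`factor_mul`, `unfactor_factor`). Applying the
counit to one factor gives projections `fst` and `snd`; the actions v ▷ u and v ◁ u are the two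
projections of the product vu. Since (fst ⊗ snd)Δ is the factorisation itself (`map_fst_snd_comul`),
vu = ∑ (v₁ ▷ u₁)(v₂ ◁ u₂) (`unfactor_left_right`). The module laws and the two product formulas are
associativity in U(g ⋈ h), the coalgebra laws say that the projections are coalgebra maps, and the
switch condition is cocommutativity.

Transporting back with one extra twist, v ▷ u = φ(v ▷' u), gives the matched pair. The recursive
formulas for `h` and `g` acting on the enveloping algebras are the product formulas evaluated at
primitive elements. Uniqueness is induction on products; some of the formulas involve twisted
factors, so there the induction must cover all iterated twists (`env_induction_twist`). -/

noncomputable section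

/-! ### The enveloping algebra of a bilinear bracket -/

section BracketEnvelope

variable {k g : Type*} [Field k] [AddCommGroup g] [Module k g]

/-- The relation `[x, y] + y x ∼ x y` in the tensor algebra. -/
inductive BracketRel (b : g →ₗ[k] g →ₗ[k] g) : TensorAlgebra k g → TensorAlgebra k g → Prop
  | comm (x y : g) : BracketRel b
      (TensorAlgebra.ι k (b x y) + TensorAlgebra.ι k y * TensorAlgebra.ι k x)
      (TensorAlgebra.ι k x * TensorAlgebra.ι k y)

/-- The universal associative algebra in which the bracket `b` becomes the commutator. No axioms on
`b` are imposed. -/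
def BracketEnv (b : g →ₗ[k] g →ₗ[k] g) : Type _ := RingQuot (BracketRel b)

namespace BracketEnv

variable (b : g →ₗ[k] g →ₗ[k] g)

instance : Ring (BracketEnv b) := inferInstanceAs (Ring (RingQuot (BracketRel b)))

instance : Algebra k (BracketEnv b) := inferInstanceAs (Algebra k (RingQuot (BracketRel b)))

/-- The quotient map from the tensor algebra. -/
def mk : TensorAlgebra k g →ₐ[k] BracketEnv b := RingQuot.mkAlgHom k (BracketRel b)

/-- The canonical map of generators. -/
def ι : g →ₗ[k] BracketEnv b := (mk b).toLinearMap ∘ₗ TensorAlgebra.ι k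

theorem ι_mul_ι (x y : g) : ι b x * ι b y = ι b (b x y) + ι b y * ι b x := by
  have h : mk b (TensorAlgebra.ι k (b x y) + TensorAlgebra.ι k y * TensorAlgebra.ι k x)
      = mk b (TensorAlgebra.ι k x * TensorAlgebra.ι k y) :=
    RingQuot.mkAlgHom_rel k (BracketRel.comm x y)
  rw [map_add, map_mul, map_mul] at h
  exact h.symm

variable {b}

section Lift

variable {A : Type*} [Semiring A] [Algebra k A]

/-- The universal property. -/
def lift (f : g →ₗ[k] A) (hf : ∀ x y, f x * f y = f (b x y) + f y * f x) : BracketEnv b →ₐ[k] A :=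
  RingQuot.liftAlgHom k ⟨TensorAlgebra.lift k f, by
    rintro _ _ ⟨x, y⟩
    simp [hf x y]⟩

@[simp] theorem lift_ι (f : g →ₗ[k] A) (hf : ∀ x y, f x * f y = f (b x y) + f y * f x) (x : g) :
    lift f hf (ι b x) = f x := by
  change RingQuot.liftAlgHom k _ (RingQuot.mkAlgHom k _ (TensorAlgebra.ι k x)) = f x
  rw [RingQuot.liftAlgHom_mkAlgHom_apply, TensorAlgebra.lift_ι_apply]

theorem algHom_ext {f f' : BracketEnv b →ₐ[k] A} (h : ∀ x, f (ι b x) = f' (ι b x)) : f = f' := by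
  exact RingQuot.ringQuot_ext' k _ _ (TensorAlgebra.hom_ext (LinearMap.ext fun x => h x))

end Lift

theorem induction {C : BracketEnv b → Prop} (algebraMap : ∀ r, C (algebraMap k _ r))
    (ι : ∀ x, C (ι b x)) (mul : ∀ x y, C x → C y → C (x * y)) (add : ∀ x y, C x → C y → C (x + y))
    (z : BracketEnv b) : C z := by
  obtain ⟨t, rfl⟩ : ∃ t, mk b t = z := RingQuot.mkAlgHom_surjective k _ z
  induction t using TensorAlgebra.induction with
  | algebraMap r => rw [AlgHom.commutes]; exact algebraMap r
  | ι x => exact ι x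
  | mul x y hx hy => rw [map_mul]; exact mul _ _ hx hy
  | add x y hx hy => rw [map_add]; exact add _ _ hx hy

-- The claim that left multiplication by `z` preserves `C` is stable under products in `z`, unlike
-- `C z` itself; evaluation at 1 recovers `C z`.
@[elab_as_elim]
theorem induction_left {C : BracketEnv b → Prop} (z : BracketEnv b) (one : C 1)
    (add : ∀ x y, C x → C y → C (x + y)) (smul : ∀ (r : k) x, C x → C (r • x))
    (mul : ∀ ξ x, C x → C (ι b ξ * x)) : C z := by
  suffices ∀ x, C x → C (z * x) by simpa using this 1 one
  induction z using induction with
  | algebraMap r => intro x hx; rw [← Algebra.smul_def]; exact smul r x hx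
  | ι ξ => exact mul ξ
  | mul y z hy hz => intro x hx; rw [mul_assoc]; exact hy _ (hz _ hx)
  | add y z hy hz => intro x hx; rw [add_mul]; exact add _ _ (hy _ hx) (hz _ hx)

@[elab_as_elim]
theorem induction_right {C : BracketEnv b → Prop} (z : BracketEnv b) (one : C 1)
    (add : ∀ x y, C x → C y → C (x + y)) (smul : ∀ (r : k) x, C x → C (r • x))
    (mul : ∀ x ξ, C x → C (x * ι b ξ)) : C z := by
  suffices ∀ x, C x → C (x * z) by simpa using this 1 one
  induction z using induction with
  | algebraMap r => intro x hx; rw [← Algebra.commutes, ← Algebra.smul_def]; exact smul r x hx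
  | ι ξ => exact fun x => mul x ξ
  | mul y z hy hz => intro x hx; rw [← mul_assoc]; exact hz _ (hy _ hx)
  | add y z hy hz => intro x hx; rw [mul_add]; exact add _ _ (hy _ hx) (hz _ hx)

/-- Functoriality in the bracket. -/
def map {g' : Type*} [AddCommGroup g'] [Module k g'] {b' : g' →ₗ[k] g' →ₗ[k] g'} (f : g →ₗ[k] g')
    (hf : ∀ x y, f (b x y) = b' (f x) (f y)) : BracketEnv b →ₐ[k] BracketEnv b' :=
  lift (ι b' ∘ₗ f) fun x y => by simp [hf x y, ι_mul_ι b' (f x)]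

@[simp] theorem map_ι {g' : Type*} [AddCommGroup g'] [Module k g'] {b' : g' →ₗ[k] g' →ₗ[k] g'}
    (f : g →ₗ[k] g') (hf : ∀ x y, f (b x y) = b' (f x) (f y)) (x : g) :
    map f hf (ι b x) = ι b' (f x) := by
  simp [map]

/-! ### The cocommutative bialgebra structure with primitive generators -/

variable (b) in
/-- The coproduct, for which the generators are primitive. -/
def comul : BracketEnv b →ₐ[k] BracketEnv b ⊗[k] BracketEnv b :=
  lift ((TensorProduct.mk k _ _).flip 1 ∘ₗ ι b + TensorProduct.mk k _ _ 1 ∘ₗ ι b) fun x y => by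
    simp only [LinearMap.add_apply, LinearMap.comp_apply, LinearMap.flip_apply,
      TensorProduct.mk_apply, add_mul, mul_add, Algebra.TensorProduct.tmul_mul_tmul, one_mul,
      mul_one, ι_mul_ι b x y, TensorProduct.add_tmul, TensorProduct.tmul_add]
    abel

@[simp] theorem comul_ι (x : g) : comul b (ι b x) = ι b x ⊗ₜ[k] 1 + 1 ⊗ₜ[k] ι b x := by
  simp [comul]

variable (b) in
/-- The counit, which kills the generators. -/
def counit : BracketEnv b →ₐ[k] k := lift 0 (by simp)

@[simp] theorem counit_ι (x : g) : counit b (ι b x) = 0 := by simp [counit]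

theorem counit_rTensor (x : BracketEnv b) :
    TensorProduct.lid k _ ((counit b).toLinearMap.rTensor _ (comul b x)) = x := by
  have : ((Algebra.TensorProduct.lid k (BracketEnv b)).toAlgHom.comp
      (Algebra.TensorProduct.map (counit b) (AlgHom.id k _))).comp (comul b) = AlgHom.id k _ :=
    algHom_ext fun x => by simp
  exact DFunLike.congr_fun this x

theorem counit_lTensor (x : BracketEnv b) :
    TensorProduct.rid k _ ((counit b).toLinearMap.lTensor _ (comul b x)) = x := by
  have : ((Algebra.TensorProduct.rid k k (BracketEnv b)).toAlgHom.comp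
      (Algebra.TensorProduct.map (AlgHom.id k _) (counit b))).comp (comul b) = AlgHom.id k _ :=
    algHom_ext fun x => by simp
  exact DFunLike.congr_fun this x

theorem coassoc (x : BracketEnv b) :
    TensorProduct.assoc k _ _ _ (TensorProduct.map (comul b).toLinearMap LinearMap.id (comul b x))
      = TensorProduct.map LinearMap.id (comul b).toLinearMap (comul b x) := by
  have : ((Algebra.TensorProduct.assoc k k k (BracketEnv b) (BracketEnv b)
      (BracketEnv b)).toAlgHom.comp
      (Algebra.TensorProduct.map (comul b) (AlgHom.id k _))).comp (comul b)
      = (Algebra.TensorProduct.map (AlgHom.id k _) (comul b)).comp (comul b) :=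
    algHom_ext fun x => by
      simp [TensorProduct.add_tmul, TensorProduct.tmul_add, Algebra.TensorProduct.one_def, add_assoc]
  exact DFunLike.congr_fun this x

theorem comm_comul (x : BracketEnv b) : TensorProduct.comm k _ _ (comul b x) = comul b x := by
  have : (Algebra.TensorProduct.comm k (BracketEnv b) (BracketEnv b)).toAlgHom.comp (comul b)
      = comul b := algHom_ext fun x => by simp [add_comm]
  exact DFunLike.congr_fun this x

theorem comul_map {g' : Type*} [AddCommGroup g'] [Module k g'] {b' : g' →ₗ[k] g' →ₗ[k] g'}
    (f : g →ₗ[k] g') (hf : ∀ x y, f (b x y) = b' (f x) (f y)) (x : BracketEnv b) :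
    comul b' (map f hf x) = Algebra.TensorProduct.map (map f hf) (map f hf) (comul b x) := by
  have : (comul b').comp (map f hf)
      = (Algebra.TensorProduct.map (map f hf) (map f hf)).comp (comul b) :=
    algHom_ext fun x => by simp
  exact DFunLike.congr_fun this x

theorem counit_map {g' : Type*} [AddCommGroup g'] [Module k g'] {b' : g' →ₗ[k] g' →ₗ[k] g'}
    (f : g →ₗ[k] g') (hf : ∀ x y, f (b x y) = b' (f x) (f y)) (x : BracketEnv b) :
    counit b' (map f hf x) = counit b x := by
  have : (counit b').comp (map f hf) = counit b := algHom_ext fun x => by simp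
  exact DFunLike.congr_fun this x

/-- An antimultiplicative map that negates the generators is a left antipode. -/
theorem antipode_left (S : BracketEnv b →ₗ[k] BracketEnv b) (h1 : S 1 = 1)
    (hmul : ∀ x y, S (x * y) = S y * S x) (hι : ∀ x, S (ι b x) = -ι b x) (x : BracketEnv b) :
    TensorProduct.lift (LinearMap.mul k _) (TensorProduct.map S LinearMap.id (comul b x))
      = counit b x • (1 : BracketEnv b) := by
  induction x using induction_left with
  | one => simp [h1, Algebra.TensorProduct.one_def]
  | add x y hx hy => simp only [map_add, hx, hy, add_smul]
  | smul r x hx => simp only [map_smul, hx, smul_assoc]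
  | mul ξ x _ =>
    rw [map_mul (comul b), map_mul (counit b), counit_ι, zero_mul, zero_smul, comul_ι]
    -- No inductive hypothesis is needed: for any tensor a ⊗ c in place of Δ(x), the two
    -- contributions are S(ξa)c = -S(a)ξc and S(a)ξc, which cancel.
    induction comul b x using TensorProduct.induction_on with
    | zero => simp
    | add x y hx hy => rw [mul_add, map_add, map_add, hx, hy, add_zero]
    | tmul x y => simp [add_mul, hmul, hι, mul_assoc]

/-- An antimultiplicative map that negates the generators is a right antipode. -/
theorem antipode_right (S : BracketEnv b →ₗ[k] BracketEnv b) (h1 : S 1 = 1)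
    (hmul : ∀ x y, S (x * y) = S y * S x) (hι : ∀ x, S (ι b x) = -ι b x) (x : BracketEnv b) :
    TensorProduct.lift (LinearMap.mul k _) (TensorProduct.map LinearMap.id S (comul b x))
      = counit b x • (1 : BracketEnv b) := by
  induction x using induction_right with
  | one => simp [h1, Algebra.TensorProduct.one_def]
  | add x y hx hy => simp only [map_add, hx, hy, add_smul]
  | smul r x hx => simp only [map_smul, hx, smul_assoc]
  | mul x ξ _ =>
    rw [map_mul (comul b), map_mul (counit b), counit_ι, mul_zero, zero_smul, comul_ι]
    -- Here the generator stands on the right, so that aξS(c) and aS(cξ) = -aξS(c) cancel.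
    induction comul b x using TensorProduct.induction_on with
    | zero => simp
    | add x y hx hy => rw [add_mul, map_add, map_add, hx, hy, add_zero]
    | tmul x y => simp [mul_add, hmul, hι, ← mul_assoc]

end BracketEnv

end BracketEnvelope

/-! ### The double of a matched pair of brackets -/

/-- A matched pair of brackets: the untwisted form of `HomLieMatchedPair`. -/
structure BracketMatchedPair {k g h : Type*} [Field k] [AddCommGroup g] [Module k g]
    [AddCommGroup h] [Module k h] (bg : g →ₗ[k] g →ₗ[k] g) (bh : h →ₗ[k] h →ₗ[k] h) where
  lact : h →ₗ[k] g →ₗ[k] g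
  ract : h →ₗ[k] g →ₗ[k] h
  bracket_lact : ∀ η η' ξ, lact (bh η η') ξ = lact η (lact η' ξ) - lact η' (lact η ξ)
  ract_bracket : ∀ η ξ ξ', ract η (bg ξ ξ') = ract (ract η ξ) ξ' - ract (ract η ξ') ξ
  lact_bracket : ∀ η ξ ξ', lact η (bg ξ ξ') = bg (lact η ξ) ξ' + bg ξ (lact η ξ')
    + lact (ract η ξ) ξ' - lact (ract η ξ') ξ
  bracket_ract : ∀ η η' ξ, ract (bh η η') ξ = bh η (ract η' ξ) + bh (ract η ξ) η'
    + ract η (lact η' ξ) - ract η' (lact η ξ)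

namespace BracketMatchedPair

open BracketEnv

variable {k g h : Type*} [Field k] [AddCommGroup g] [Module k g] [AddCommGroup h] [Module k h]
  {bg : g →ₗ[k] g →ₗ[k] g} {bh : h →ₗ[k] h →ₗ[k] h} (M : BracketMatchedPair bg bh)

/-! ### The action of `h` on `U(g) ⊗ U(h)` -/

/-- The action of a generator `ξ` on pairs `(u, f)`, where `f η` stands for `η · (u ⊗ 1)`. -/
def crossOp : g →ₗ[k] Module.End k
    (BracketEnv bg × (h →ₗ[k] BracketEnv bg ⊗[k] BracketEnv bh)) :=
  LinearMap.mk₂ k (fun ξ n => (ι bg ξ * n.1,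
      -- These are the three terms of ηξ = η ▷ ξ + η ◁ ξ + ξη applied to u ⊗ 1. The first needs `u`
      -- and the second needs the value at another element of `h`, which is why the module consists
      -- of pairs (u, f) with f defined on all of `h`.
      (TensorProduct.mk k _ _).flip 1 ∘ₗ LinearMap.mulRight k n.1 ∘ₗ ι bg ∘ₗ M.lact.flip ξ
        + n.2 ∘ₗ M.ract.flip ξ + LinearMap.mulLeft k (ι bg ξ ⊗ₜ[k] 1) ∘ₗ n.2))
    (fun ξ ξ' n => Prod.ext (by simp [add_mul]) (LinearMap.ext fun η => by
      simp [add_mul, TensorProduct.add_tmul]; abel))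
    (fun c ξ n => Prod.ext (by simp) (LinearMap.ext fun η => by
      simp only [map_smul, ← TensorProduct.smul_tmul', LinearMap.add_apply, LinearMap.smul_apply,
        LinearMap.comp_apply, LinearMap.mulLeft_apply, LinearMap.mulRight_apply, smul_mul_assoc,
        LinearMap.flip_apply, TensorProduct.mk_apply, smul_add, Prod.smul_snd]))
    (fun ξ n n' => Prod.ext (by simp [mul_add]) (LinearMap.ext fun η => by
      simp [mul_add]; abel))
    (fun c ξ n => Prod.ext (by simp) (LinearMap.ext fun η => by
      simp [TensorProduct.smul_tmul']))

theorem crossOp_fst (ξ : g) (n : BracketEnv bg × (h →ₗ[k] BracketEnv bg ⊗[k] BracketEnv bh)) :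
    (M.crossOp ξ n).1 = ι bg ξ * n.1 := rfl

theorem crossOp_snd (ξ : g) (n : BracketEnv bg × (h →ₗ[k] BracketEnv bg ⊗[k] BracketEnv bh))
    (η : h) : (M.crossOp ξ n).2 η = (ι bg (M.lact η ξ) * n.1) ⊗ₜ[k] 1 + n.2 (M.ract η ξ)
      + (ι bg ξ ⊗ₜ[k] 1) * n.2 η := rfl

/-- The compatibility of both actions with the bracket of `g` is exactly what makes the crossing
recursion independent of how `u` is written as a product of generators. -/
theorem crossOp_comm (ξ ξ' : g) :
    M.crossOp ξ * M.crossOp ξ' = M.crossOp (bg ξ ξ') + M.crossOp ξ' * M.crossOp ξ := by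
  refine LinearMap.ext fun n => Prod.ext ?_ (LinearMap.ext fun η => ?_)
  · simp only [Module.End.mul_apply, LinearMap.add_apply, Prod.fst_add, crossOp_fst, ← mul_assoc,
      ι_mul_ι bg ξ ξ', add_mul]
  · have e : ∀ x y z, (ι bg x ⊗ₜ[k] (1 : BracketEnv bh)) * ((ι bg y * z) ⊗ₜ[k] 1)
        = (ι bg x * ι bg y * z) ⊗ₜ[k] 1 := fun x y z => by
      rw [Algebra.TensorProduct.tmul_mul_tmul, mul_one, mul_assoc]
    have e' : ∀ x y, (ι bg x ⊗ₜ[k] (1 : BracketEnv bh)) * (ι bg y ⊗ₜ[k] 1)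
        = (ι bg x * ι bg y) ⊗ₜ[k] 1 := fun x y => by
      rw [Algebra.TensorProduct.tmul_mul_tmul, mul_one]
    simp only [Module.End.mul_apply, LinearMap.add_apply, Prod.snd_add, crossOp_snd, crossOp_fst,
      mul_add, e, M.lact_bracket, M.ract_bracket, map_add, map_sub, ← mul_assoc, e',
      ι_mul_ι bg ξ ξ', ι_mul_ι bg (M.lact η ξ) ξ', ι_mul_ι bg ξ (M.lact η ξ'), add_mul, sub_mul,
      TensorProduct.add_tmul, TensorProduct.sub_tmul]
    abel

/-- The action of `U(g)` on pairs. -/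
def cross : BracketEnv bg →ₐ[k]
    Module.End k (BracketEnv bg × (h →ₗ[k] BracketEnv bg ⊗[k] BracketEnv bh)) :=
  BracketEnv.lift M.crossOp M.crossOp_comm

/-- `(u, η) ↦ η · (u ⊗ 1)`. -/
def preAct : BracketEnv bg →ₗ[k] h →ₗ[k] BracketEnv bg ⊗[k] BracketEnv bh :=
  LinearMap.snd k _ _ ∘ₗ M.cross.toLinearMap.flip (1, TensorProduct.mk k _ _ 1 ∘ₗ ι bh)

/-- The first component only keeps track of `u`; this turns the module action into a recursion for
`preAct`. -/
theorem cross_fst (u : BracketEnv bg) (f : h →ₗ[k] BracketEnv bg ⊗[k] BracketEnv bh) :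
    (M.cross u (1, f)).1 = u := by
  induction u using induction_left with
  | one => simp
  | add x y hx hy => simp [hx, hy]
  | smul r x hx => simp [hx]
  | mul ξ x hx =>
    rw [map_mul, Module.End.mul_apply, cross, lift_ι, crossOp_fst]
    exact congrArg _ hx

theorem preAct_one (η : h) : M.preAct 1 η = 1 ⊗ₜ[k] ι bh η := by
  simp [preAct]

theorem preAct_ι_mul (ξ : g) (u : BracketEnv bg) (η : h) : M.preAct (ι bg ξ * u) η
    = (ι bg (M.lact η ξ) * u) ⊗ₜ[k] 1 + M.preAct u (M.ract η ξ)
      + (ι bg ξ ⊗ₜ[k] 1) * M.preAct u η := by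
  change (M.cross (ι bg ξ * u) _).2 η = _
  rw [map_mul, Module.End.mul_apply]
  conv_lhs => rw [cross, lift_ι]
  rw [crossOp_snd]
  have := M.cross_fst u (TensorProduct.mk k _ _ 1 ∘ₗ ι bh)
  rw [cross] at this
  rw [this]
  rfl

/-- The action of `h` on `U(g) ⊗ U(h)`. -/
def act : h →ₗ[k] Module.End k (BracketEnv bg ⊗[k] BracketEnv bh) :=
  LinearMap.flip (TensorProduct.lift (LinearMap.mk₂ k
    (fun u v => LinearMap.mulRight k (1 ⊗ₜ[k] v) ∘ₗ M.preAct u)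
    (fun u u' v => LinearMap.ext fun η => by simp [add_mul])
    (fun c u v => LinearMap.ext fun η => by simp)
    (fun u v v' => LinearMap.ext fun η => by simp [mul_add, TensorProduct.tmul_add])
    (fun c u v => LinearMap.ext fun η => by simp)))

theorem act_tmul (η : h) (u : BracketEnv bg) (v : BracketEnv bh) :
    M.act η (u ⊗ₜ[k] v) = M.preAct u η * (1 ⊗ₜ[k] v) := rfl

theorem act_one_tmul (η : h) (v : BracketEnv bh) :
    M.act η (1 ⊗ₜ[k] v) = 1 ⊗ₜ[k] (ι bh η * v) := by
  rw [act_tmul, preAct_one, Algebra.TensorProduct.tmul_mul_tmul, mul_one]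

/-- Right multiplication by `U(h)` commutes with the action, so identities for `act` need checking
only on tensors u ⊗ 1. -/
theorem act_mul_one_tmul (η : h) (z : BracketEnv bg ⊗[k] BracketEnv bh) (v : BracketEnv bh) :
    M.act η (z * (1 ⊗ₜ[k] v)) = M.act η z * (1 ⊗ₜ[k] v) := by
  induction z with
  | zero => simp
  | add x y hx hy => simp only [add_mul, map_add, hx, hy]
  | tmul u w => simp [act_tmul, mul_assoc]

/-- The crossing rule, now valid on the whole module; it determines `act` together with its values
on 1 ⊗ v. -/
theorem act_ι_mul (η : h) (ξ : g) (z : BracketEnv bg ⊗[k] BracketEnv bh) :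
    M.act η ((ι bg ξ ⊗ₜ[k] 1) * z) = (ι bg (M.lact η ξ) ⊗ₜ[k] 1) * z + M.act (M.ract η ξ) z
      + (ι bg ξ ⊗ₜ[k] 1) * M.act η z := by
  induction z with
  | zero => simp
  | add x y hx hy => simp only [mul_add, map_add, hx, hy]; abel
  | tmul u w =>
    rw [Algebra.TensorProduct.tmul_mul_tmul, one_mul]
    simp only [act_tmul, preAct_ι_mul, add_mul, ← mul_assoc]
    simp

/-- On 1 ⊗ 1 this is the relation of `U(h)`. Crossing a generator of `g` past both operators
preserves it, by the compatibility of the two actions with the bracket of `h`. -/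
theorem act_comm (η η' : h) : M.act η * M.act η' = M.act (bh η η') + M.act η' * M.act η := by
  -- The quantifiers over η, η' stay inside the induction, since crossing ξ replaces η by η ◁ ξ and
  -- η' by η' ◁ ξ.
  have key : ∀ (u : BracketEnv bg) (η η' : h), M.act η (M.act η' (u ⊗ₜ[k] 1))
      = M.act (bh η η') (u ⊗ₜ[k] 1) + M.act η' (M.act η (u ⊗ₜ[k] 1)) := by
    intro u
    induction u using induction_left with
    | one => intro η η'; simp only [act_one_tmul, mul_one, ι_mul_ι bh η η', TensorProduct.tmul_add]
    | add x y hx hy => intro η η'; simp only [TensorProduct.add_tmul, map_add, hx η η', hy η η']; abel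
    | smul r x hx => intro η η'; simp only [← TensorProduct.smul_tmul', map_smul, hx η η', smul_add]
    | mul ξ x hx =>
      intro η η'
      have e : (ι bg ξ * x) ⊗ₜ[k] (1 : BracketEnv bh) = (ι bg ξ ⊗ₜ[k] 1) * (x ⊗ₜ[k] 1) := by simp
      rw [e]
      generalize x ⊗ₜ[k] (1 : BracketEnv bh) = z at hx
      simp only [act_ι_mul, map_add, M.bracket_lact, M.bracket_ract, map_sub, LinearMap.add_apply,
        LinearMap.sub_apply, TensorProduct.sub_tmul, sub_mul, hx η η', hx η (M.ract η' ξ),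
        hx (M.ract η ξ) η', mul_add]
      abel
  refine TensorProduct.ext' fun u v => ?_
  have e : u ⊗ₜ[k] v = (u ⊗ₜ[k] 1) * (1 ⊗ₜ[k] v) := by simp
  simp only [e, Module.End.mul_apply, LinearMap.add_apply, act_mul_one_tmul, key u η η', add_mul]

/-! ### The double and the representation of its enveloping algebra -/

/-- The bracket of the double `g ⋈ h`. -/
def dbl : (g × h) →ₗ[k] (g × h) →ₗ[k] (g × h) :=
  LinearMap.mk₂ k (fun x y => (bg x.1 y.1 + M.lact x.2 y.1 - M.lact y.2 x.1,
      bh x.2 y.2 + M.ract x.2 y.1 - M.ract y.2 x.1))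
    (fun x x' y => by ext <;> simp <;> abel)
    (fun c x y => by ext <;> simp [smul_add, smul_sub])
    (fun x y y' => by ext <;> simp <;> abel)
    (fun c x y => by ext <;> simp [smul_add, smul_sub])

theorem dbl_apply (x y : g × h) : M.dbl x y = (bg x.1 y.1 + M.lact x.2 y.1 - M.lact y.2 x.1,
      bh x.2 y.2 + M.ract x.2 y.1 - M.ract y.2 x.1) := rfl

/-- The action of `g ⋈ h` on `U(g) ⊗ U(h)`. -/
def dblOp : (g × h) →ₗ[k] Module.End k (BracketEnv bg ⊗[k] BracketEnv bh) :=
  LinearMap.coprod (LinearMap.mul k _ ∘ₗ (TensorProduct.mk k _ _).flip 1 ∘ₗ ι bg) M.act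

theorem dblOp_apply (x : g × h) (z : BracketEnv bg ⊗[k] BracketEnv bh) :
    M.dblOp x z = (ι bg x.1 ⊗ₜ[k] 1) * z + M.act x.2 z := rfl

/-- The relation splits into its `g`-`g`, `h`-`h` and mixed parts: the relation of `U(g)`,
`act_comm` and the crossing rule `act_ι_mul`. -/
theorem dblOp_comm (x y : g × h) :
    M.dblOp x * M.dblOp y = M.dblOp (M.dbl x y) + M.dblOp y * M.dblOp x := by
  refine LinearMap.ext fun z => ?_
  have e : ∀ a b, (ι bg a ⊗ₜ[k] (1 : BracketEnv bh)) * ((ι bg b ⊗ₜ[k] 1) * z)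
      = ((ι bg a * ι bg b) ⊗ₜ[k] 1) * z := fun a b => by
    rw [← mul_assoc, Algebra.TensorProduct.tmul_mul_tmul, mul_one]
  have e' := LinearMap.congr_fun (M.act_comm x.2 y.2) z
  simp only [Module.End.mul_apply, LinearMap.add_apply] at e'
  simp only [Module.End.mul_apply, LinearMap.add_apply, dblOp_apply, dbl_apply, map_add, map_sub,
    act_ι_mul, e, ι_mul_ι bg x.1 y.1, TensorProduct.add_tmul, TensorProduct.sub_tmul,
    add_mul, sub_mul, LinearMap.sub_apply, e']
  abel

/-- The enveloping algebra of the double. -/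
abbrev Dbl : Type _ := BracketEnv M.dbl

theorem dbl_inl (x y : g) : LinearMap.inl k g h (bg x y)
    = M.dbl (LinearMap.inl k g h x) (LinearMap.inl k g h y) := by
  simp [dbl_apply]

theorem dbl_inr (x y : h) : LinearMap.inr k g h (bh x y)
    = M.dbl (LinearMap.inr k g h x) (LinearMap.inr k g h y) := by
  simp [dbl_apply]

/-- `U(g) → U(g ⋈ h)`. -/
def inl : BracketEnv bg →ₐ[k] M.Dbl := BracketEnv.map (LinearMap.inl k g h) M.dbl_inl

/-- `U(h) → U(g ⋈ h)`. -/
def inr : BracketEnv bh →ₐ[k] M.Dbl := BracketEnv.map (LinearMap.inr k g h) M.dbl_inr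

theorem inl_ι (x : g) : M.inl (ι bg x) = ι M.dbl (x, 0) := map_ι _ M.dbl_inl x

theorem inr_ι (x : h) : M.inr (ι bh x) = ι M.dbl (0, x) := map_ι _ M.dbl_inr x

theorem ι_dbl (x : g × h) : ι M.dbl x = M.inl (ι bg x.1) + M.inr (ι bh x.2) := by
  rw [inl_ι, inr_ι, ← map_add]; simp

/-- The source of the crossing rule: in the double the bracket of (0, η) with (ξ, 0) is (η ▷ ξ, η ◁
ξ). -/
theorem inr_ι_mul_inl_ι (η : h) (ξ : g) : M.inr (ι bh η) * M.inl (ι bg ξ)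
    = M.inl (ι bg (M.lact η ξ)) + M.inr (ι bh (M.ract η ξ))
      + M.inl (ι bg ξ) * M.inr (ι bh η) := by
  rw [← ι_dbl M (M.lact η ξ, M.ract η ξ), inl_ι, inr_ι, ι_mul_ι]
  simp [dbl_apply]

/-- Multiplication `U(g) ⊗ U(h) → U(g ⋈ h)`. -/
def unfactor : BracketEnv bg ⊗[k] BracketEnv bh →ₗ[k] M.Dbl :=
  TensorProduct.lift ((LinearMap.mul k M.Dbl).compl₁₂ M.inl.toLinearMap M.inr.toLinearMap)

@[simp] theorem unfactor_tmul (u : BracketEnv bg) (v : BracketEnv bh) :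
    M.unfactor (u ⊗ₜ[k] v) = M.inl u * M.inr v := rfl

/-- The representation of `U(g ⋈ h)` on `U(g) ⊗ U(h)`. -/
def rep : M.Dbl →ₐ[k] Module.End k (BracketEnv bg ⊗[k] BracketEnv bh) :=
  BracketEnv.lift M.dblOp M.dblOp_comm

theorem rep_ι (x : g × h) : M.rep (ι M.dbl x) = M.dblOp x := lift_ι _ _ x

theorem rep_inl (u : BracketEnv bg) (z : BracketEnv bg ⊗[k] BracketEnv bh) :
    M.rep (M.inl u) z = (u ⊗ₜ[k] 1) * z := by
  have : M.rep.comp M.inl = (Algebra.lmul k (BracketEnv bg ⊗[k] BracketEnv bh)).comp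
      Algebra.TensorProduct.includeLeft := algHom_ext fun ξ => LinearMap.ext fun z => by
    rw [AlgHom.comp_apply, inl_ι, rep_ι, dblOp_apply]
    simp
  exact LinearMap.congr_fun (DFunLike.congr_fun this u) z

theorem rep_inr (v w : BracketEnv bh) : M.rep (M.inr v) (1 ⊗ₜ[k] w) = 1 ⊗ₜ[k] (v * w) := by
  induction v using induction_left generalizing w with
  | one => simp
  | add x y hx hy => simp [add_mul, hx, hy, TensorProduct.tmul_add]
  | smul r x hx => simp [hx]
  | mul η x hx =>
    rw [map_mul, map_mul, Module.End.mul_apply, hx, inr_ι, rep_ι, dblOp_apply]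
    simp [act_one_tmul, mul_assoc]

/-- Both sides obey the same recursion in the first tensor factor, `act_ι_mul` on the module and
`inr_ι_mul_inl_ι` in the algebra, and agree on 1 ⊗ v. -/
theorem unfactor_act (η : h) (z : BracketEnv bg ⊗[k] BracketEnv bh) :
    M.unfactor (M.act η z) = M.inr (ι bh η) * M.unfactor z := by
  have key : ∀ (u : BracketEnv bg) (η : h) v, M.unfactor (M.act η (u ⊗ₜ[k] v))
      = M.inr (ι bh η) * M.unfactor (u ⊗ₜ[k] v) := by
    intro u
    have hl : ∀ x z, M.unfactor ((x ⊗ₜ[k] 1) * z) = M.inl x * M.unfactor z := by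
      intro x z
      induction z with
      | zero => simp
      | add a b ha hb => simp only [mul_add, map_add, ha, hb]
      | tmul a b => simp [mul_assoc]
    induction u using induction_left with
    | one => intro η v; simp [act_one_tmul]
    | add x y hx hy =>
      intro η v; rw [TensorProduct.add_tmul, map_add, map_add, hx, hy, map_add, mul_add]
    | smul r x hx =>
      intro η v; rw [← TensorProduct.smul_tmul', map_smul, map_smul, hx, map_smul, mul_smul_comm]
    | mul ξ x hx =>
      intro η v
      have e : (ι bg ξ * x) ⊗ₜ[k] v = (ι bg ξ ⊗ₜ[k] 1) * (x ⊗ₜ[k] v) := by simp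
      rw [e, act_ι_mul, map_add, map_add, hl, hl, hl, hx, hx, ← mul_assoc, ← mul_assoc,
        inr_ι_mul_inl_ι, add_mul, add_mul]
  induction z with
  | zero => simp
  | add a b ha hb => simp only [mul_add, map_add, ha, hb]
  | tmul a b => exact key a η b

/-- Multiplication is thus a module map to the left regular representation, which yields one of the
two inverse identities on evaluation at 1 ⊗ 1. -/
theorem unfactor_rep (x : M.Dbl) (z : BracketEnv bg ⊗[k] BracketEnv bh) :
    M.unfactor (M.rep x z) = x * M.unfactor z := by
  induction x using induction_left with
  | one => simp
  | add x y hx hy => simp [add_mul, hx, hy]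
  | smul r x hx => simp [hx]
  | mul ξ x hx =>
    rw [map_mul, Module.End.mul_apply, mul_assoc, ← hx, rep_ι, dblOp_apply, map_add, unfactor_act,
      ι_dbl, add_mul]
    congr 1
    induction M.rep x z with
    | zero => simp
    | add a b ha hb => simp only [mul_add, map_add, ha, hb]
    | tmul a b => simp [mul_assoc]

/-! ### The factorisation of the double and its two projections -/

/-- The inverse `U(g ⋈ h) → U(g) ⊗ U(h)` of multiplication. -/
def factor : M.Dbl →ₗ[k] BracketEnv bg ⊗[k] BracketEnv bh := M.rep.toLinearMap.flip (1 ⊗ₜ[k] 1)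

theorem factor_mul (u : BracketEnv bg) (v : BracketEnv bh) :
    M.factor (M.inl u * M.inr v) = u ⊗ₜ[k] v := by
  change M.rep _ _ = _
  rw [map_mul, Module.End.mul_apply, rep_inr, rep_inl]
  simp

theorem unfactor_factor (z : M.Dbl) : M.unfactor (M.factor z) = z := by
  change M.unfactor (M.rep _ _) = _
  rw [unfactor_rep]
  simp

-- Surjectivity of multiplication: every element is a sum of ordered products with the `U(g)` factor
-- on the left.
@[elab_as_elim]
theorem dbl_induction {C : M.Dbl → Prop} (z : M.Dbl)
    (mul : ∀ u v, C (M.inl u * M.inr v)) (add : ∀ x y, C x → C y → C (x + y)) : C z := by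
  rw [← M.unfactor_factor z]
  induction M.factor z with
  | zero => simpa using mul 0 0
  | add a b ha hb => rw [map_add]; exact add _ _ ha hb
  | tmul a b => exact mul a b

/-- The projection of `U(g ⋈ h)` to `U(g)`. -/
def fst : M.Dbl →ₗ[k] BracketEnv bg :=
  (TensorProduct.rid k _).toLinearMap ∘ₗ (counit bh).toLinearMap.lTensor _ ∘ₗ M.factor

/-- The projection of `U(g ⋈ h)` to `U(h)`. -/
def snd : M.Dbl →ₗ[k] BracketEnv bh :=
  (TensorProduct.lid k _).toLinearMap ∘ₗ (counit bg).toLinearMap.rTensor _ ∘ₗ M.factor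

@[simp] theorem fst_mul (u : BracketEnv bg) (v : BracketEnv bh) :
    M.fst (M.inl u * M.inr v) = counit bh v • u := by
  simp [fst, factor_mul]

@[simp] theorem snd_mul (u : BracketEnv bg) (v : BracketEnv bh) :
    M.snd (M.inl u * M.inr v) = counit bg u • v := by
  simp [snd, factor_mul]

@[simp] theorem fst_inl (u : BracketEnv bg) : M.fst (M.inl u) = u := by
  simpa using M.fst_mul u 1

@[simp] theorem fst_inr (v : BracketEnv bh) : M.fst (M.inr v) = counit bh v • 1 := by
  simpa using M.fst_mul 1 v

@[simp] theorem snd_inl (u : BracketEnv bg) : M.snd (M.inl u) = counit bg u • 1 := by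
  simpa using M.snd_mul u 1

@[simp] theorem snd_inr (v : BracketEnv bh) : M.snd (M.inr v) = v := by
  simpa using M.snd_mul 1 v

theorem fst_inl_mul (u : BracketEnv bg) (z : M.Dbl) : M.fst (M.inl u * z) = u * M.fst z := by
  induction z using dbl_induction with
  | add x y hx hy => simp only [mul_add, map_add, hx, hy]
  | mul a b => rw [← mul_assoc, ← map_mul, fst_mul, fst_mul, mul_smul_comm]

theorem snd_mul_inr (z : M.Dbl) (v : BracketEnv bh) : M.snd (z * M.inr v) = M.snd z * v := by
  induction z using dbl_induction with
  | add x y hx hy => simp only [add_mul, map_add, hx, hy]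
  | mul a b => rw [mul_assoc, ← map_mul, snd_mul, snd_mul, smul_mul_assoc]

theorem fst_mul_inr (z : M.Dbl) (v : BracketEnv bh) :
    M.fst (z * M.inr v) = counit bh v • M.fst z := by
  induction z using dbl_induction with
  | add x y hx hy => simp only [add_mul, map_add, hx, hy, smul_add]
  | mul a b => rw [mul_assoc, ← map_mul, fst_mul, fst_mul, map_mul, mul_comm, mul_smul]

theorem snd_inl_mul (u : BracketEnv bg) (z : M.Dbl) :
    M.snd (M.inl u * z) = counit bg u • M.snd z := by
  induction z using dbl_induction with
  | add x y hx hy => simp only [mul_add, map_add, hx, hy, smul_add]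
  | mul a b => rw [← mul_assoc, ← map_mul, snd_mul, snd_mul, map_mul, mul_smul]

/-- `fst` presents `U(g)` as the left module induced from the trivial `U(h)`-module, so its kernel
is a left ideal. Associativity of the left action follows. -/
theorem fst_mul_inl_fst (x z : M.Dbl) : M.fst (x * M.inl (M.fst z)) = M.fst (x * z) := by
  induction z using dbl_induction with
  | add x y hx hy => simp only [mul_add, map_add, hx, hy]
  | mul a b => rw [fst_mul, ← mul_assoc, fst_mul_inr, map_smul, mul_smul_comm, map_smul]

/-- The mirror image: the kernel of `snd` is a right ideal, which makes ◁ a right action. -/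
theorem snd_inr_snd_mul (x z : M.Dbl) : M.snd (M.inr (M.snd z) * x) = M.snd (z * x) := by
  induction z using dbl_induction with
  | add x y hx hy => simp only [add_mul, map_add, hx, hy]
  | mul a b => rw [snd_mul, mul_assoc, snd_inl_mul, map_smul, smul_mul_assoc, map_smul]

/-! ### Coproduct and counit under the projections -/

theorem comul_inl (u : BracketEnv bg) :
    comul M.dbl (M.inl u) = Algebra.TensorProduct.map M.inl M.inl (comul bg u) :=
  comul_map _ _ u

theorem comul_inr (v : BracketEnv bh) :
    comul M.dbl (M.inr v) = Algebra.TensorProduct.map M.inr M.inr (comul bh v) :=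
  comul_map _ _ v

/-- Since Δ(uv) = ∑ u₁v₁ ⊗ u₂v₂, the projections leave ∑ u₁ε(v₁) ⊗ ε(u₂)v₂ = u ⊗ v. The
factorisation of any element can therefore be read off its coproduct. -/
theorem map_fst_snd_comul (z : M.Dbl) :
    TensorProduct.map M.fst M.snd (comul M.dbl z) = M.factor z := by
  induction z using dbl_induction with
  | add x y hx hy => simp only [map_add, hx, hy]
  | mul u v =>
    rw [factor_mul, map_mul, comul_inl, comul_inr]
    -- With u = ∑ u₁ε(u₂) and v = ∑ ε(v₁)v₂, both sides are bilinear in Δ(u) and Δ(v), and pure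
    -- tensors suffice.
    conv_rhs => rw [← counit_lTensor u, ← counit_rTensor v]
    induction comul bg u with
    | zero => simp
    | add x y hx hy => simp only [map_add, add_mul, hx, hy, TensorProduct.add_tmul]
    | tmul a b =>
      induction comul bh v with
      | zero => simp
      | add x y hx hy => simp only [map_add, mul_add, hx, hy, TensorProduct.tmul_add]
      | tmul c d =>
        simp only [Algebra.TensorProduct.map_tmul, Algebra.TensorProduct.tmul_mul_tmul,
          TensorProduct.map_tmul, fst_mul, snd_mul, LinearMap.lTensor_tmul, LinearMap.rTensor_tmul,
          TensorProduct.rid_tmul, TensorProduct.lid_tmul, AlgHom.toLinearMap_apply,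
          TensorProduct.smul_tmul_smul, mul_comm]

theorem comul_fst (z : M.Dbl) :
    comul bg (M.fst z) = TensorProduct.map M.fst M.fst (comul M.dbl z) := by
  induction z using dbl_induction with
  | add x y hx hy => simp only [map_add, hx, hy]
  | mul u v =>
    rw [fst_mul, map_smul, map_mul, comul_inl, comul_inr]
    -- The scalar is expanded as ε(v) = ∑ ε(v₁)ε(v₂), which makes the right factor depend only on
    -- Δ(v).
    have hv : counit bh v = LinearMap.mul' k k
        (TensorProduct.map (counit bh).toLinearMap (counit bh).toLinearMap (comul bh v)) := by
      conv_lhs => rw [← counit_rTensor v]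
      induction comul bh v with
      | zero => simp
      | add x y hx hy => simp only [map_add, hx, hy]
      | tmul a b => simp
    rw [hv]
    induction comul bg u with
    | zero => simp
    | add x y hx hy => simp only [map_add, add_mul, smul_add, hx, hy]
    | tmul a b =>
      induction comul bh v with
      | zero => simp
      | add x y hx hy => simp only [map_add, mul_add, add_smul, hx, hy]
      | tmul c d => simp [TensorProduct.smul_tmul', smul_smul, mul_comm]

theorem comul_snd (z : M.Dbl) :
    comul bh (M.snd z) = TensorProduct.map M.snd M.snd (comul M.dbl z) := by
  induction z using dbl_induction with
  | add x y hx hy => simp only [map_add, hx, hy]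
  | mul u v =>
    rw [snd_mul, map_smul, map_mul, comul_inl, comul_inr]
    have hu : counit bg u = LinearMap.mul' k k
        (TensorProduct.map (counit bg).toLinearMap (counit bg).toLinearMap (comul bg u)) := by
      conv_lhs => rw [← counit_rTensor u]
      induction comul bg u with
      | zero => simp
      | add x y hx hy => simp only [map_add, hx, hy]
      | tmul a b => simp
    rw [hu]
    induction comul bg u with
    | zero => simp
    | add x y hx hy => simp only [map_add, add_mul, add_smul, hx, hy]
    | tmul a b =>
      induction comul bh v with
      | zero => simp
      | add x y hx hy => simp only [map_add, mul_add, smul_add, hx, hy]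
      | tmul c d => simp [TensorProduct.smul_tmul', smul_smul, mul_comm]

theorem counit_fst (z : M.Dbl) : counit bg (M.fst z) = counit M.dbl z := by
  induction z using dbl_induction with
  | add x y hx hy => simp only [map_add, hx, hy]
  | mul u v => rw [fst_mul, map_smul, map_mul, inl, inr, counit_map, counit_map, smul_eq_mul, mul_comm]

theorem counit_snd (z : M.Dbl) : counit bh (M.snd z) = counit M.dbl z := by
  induction z using dbl_induction with
  | add x y hx hy => simp only [map_add, hx, hy]
  | mul u v => rw [snd_mul, map_smul, map_mul, inl, inr, counit_map, counit_map, smul_eq_mul]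

end BracketMatchedPair

/-! ### The actions of the enveloping algebras of a matched pair of brackets -/

namespace BracketMatchedPair

open BracketEnv

variable {k g h : Type*} [Field k] [AddCommGroup g] [Module k g] [AddCommGroup h] [Module k h]
  {bg : g →ₗ[k] g →ₗ[k] g} {bh : h →ₗ[k] h →ₗ[k] h} (M : BracketMatchedPair bg bh)

/-- The left action of `U(h)` on `U(g)`. -/
def left : BracketEnv bh →ₗ[k] BracketEnv bg →ₗ[k] BracketEnv bg :=
  ((LinearMap.mul k M.Dbl).compl₁₂ M.inr.toLinearMap M.inl.toLinearMap).compr₂ M.fst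

/-- The right action of `U(g)` on `U(h)`. -/
def right : BracketEnv bh →ₗ[k] BracketEnv bg →ₗ[k] BracketEnv bh :=
  ((LinearMap.mul k M.Dbl).compl₁₂ M.inr.toLinearMap M.inl.toLinearMap).compr₂ M.snd

theorem left_apply (v : BracketEnv bh) (u : BracketEnv bg) :
    M.left v u = M.fst (M.inr v * M.inl u) := rfl

theorem right_apply (v : BracketEnv bh) (u : BracketEnv bg) :
    M.right v u = M.snd (M.inr v * M.inl u) := rfl

theorem one_left (u : BracketEnv bg) : M.left 1 u = u := by simp [left_apply]

theorem left_one (v : BracketEnv bh) : M.left v 1 = counit bh v • 1 := by simp [left_apply]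

theorem right_one (v : BracketEnv bh) : M.right v 1 = v := by simp [right_apply]

theorem one_right (u : BracketEnv bg) : M.right 1 u = counit bg u • 1 := by simp [right_apply]

/-- Associativity of (vw)u in the double; the inner projection is invisible by `fst_mul_inl_fst`. -/
theorem mul_left (v w : BracketEnv bh) (u : BracketEnv bg) :
    M.left (v * w) u = M.left v (M.left w u) := by
  simp only [left_apply, fst_mul_inl_fst, map_mul, mul_assoc]

theorem right_mul (v : BracketEnv bh) (x y : BracketEnv bg) :
    M.right v (x * y) = M.right (M.right v x) y := by
  simp only [right_apply, snd_inr_snd_mul, map_mul, mul_assoc]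

theorem left_ι_ι (η : h) (ξ : g) : M.left (ι bh η) (ι bg ξ) = ι bg (M.lact η ξ) := by
  rw [left_apply, inr_ι_mul_inl_ι, map_add, map_add]
  simp

theorem right_ι_ι (η : h) (ξ : g) : M.right (ι bh η) (ι bg ξ) = ι bh (M.ract η ξ) := by
  rw [right_apply, inr_ι_mul_inl_ι, map_add, map_add]
  simp

/-! ### The coalgebra and product formulas of the actions -/

/-- The projections are left arbitrary because the pairs (`fst`, `fst`), (`snd`, `snd`) and (`fst`,
`snd`) are all needed. -/
theorem map_comul_inr_mul_inl {X Y : Type*} [AddCommGroup X] [Module k X] [AddCommGroup Y]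
    [Module k Y] (p : M.Dbl →ₗ[k] X) (q : M.Dbl →ₗ[k] Y) (v : BracketEnv bh) (u : BracketEnv bg) :
    TensorProduct.map p q (comul M.dbl (M.inr v * M.inl u))
      = TensorProduct.map₂
          (((LinearMap.mul k M.Dbl).compl₁₂ M.inr.toLinearMap M.inl.toLinearMap).compr₂ p)
          (((LinearMap.mul k M.Dbl).compl₁₂ M.inr.toLinearMap M.inl.toLinearMap).compr₂ q)
          (comul bh v) (comul bg u) := by
  rw [map_mul, comul_inl, comul_inr]
  induction comul bh v with
  | zero => simp
  | add x y hx hy => simp only [map_add, add_mul, LinearMap.add_apply, hx, hy]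
  | tmul a b =>
    induction comul bg u with
    | zero => simp
    | add x y hx hy => simp only [map_add, mul_add, hx, hy]
    | tmul c d => simp

theorem comul_left (v : BracketEnv bh) (u : BracketEnv bg) :
    comul bg (M.left v u) = TensorProduct.map₂ M.left M.left (comul bh v) (comul bg u) := by
  rw [left_apply, comul_fst, map_comul_inr_mul_inl]; rfl

theorem comul_right (v : BracketEnv bh) (u : BracketEnv bg) :
    comul bh (M.right v u) = TensorProduct.map₂ M.right M.right (comul bh v) (comul bg u) := by
  rw [right_apply, comul_snd, map_comul_inr_mul_inl]; rfl

theorem counit_left (v : BracketEnv bh) (u : BracketEnv bg) :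
    counit bg (M.left v u) = counit bh v * counit bg u := by
  rw [left_apply, counit_fst, map_mul, inl, inr, counit_map, counit_map]

theorem counit_right (v : BracketEnv bh) (u : BracketEnv bg) :
    counit bh (M.right v u) = counit bh v * counit bg u := by
  rw [right_apply, counit_snd, map_mul, inl, inr, counit_map, counit_map]

/-- The reordering formula vu = ∑ (v₁ ▷ u₁)(v₂ ◁ u₂): the factorisation of vu is computed from its
coproduct. -/
theorem unfactor_left_right (v : BracketEnv bh) (u : BracketEnv bg) :
    M.unfactor (TensorProduct.map₂ M.left M.right (comul bh v) (comul bg u))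
      = M.inr v * M.inl u := by
  refine Eq.trans (congrArg M.unfactor ?_) (M.unfactor_factor _)
  rw [← map_fst_snd_comul, map_comul_inr_mul_inl]; rfl

/-- Reorder vu inside (vu)u' and project: `fst` is left `U(g)`-linear, so v₁ ▷ u₁ comes out and (v₂
◁ u₂)u' projects to the iterated action. -/
theorem left_mul (v : BracketEnv bh) (u u' : BracketEnv bg) :
    M.left v (u * u') = TensorProduct.lift ((LinearMap.mul k _).compl₂ (M.left.flip u'))
      (TensorProduct.map₂ M.left M.right (comul bh v) (comul bg u)) := by
  rw [left_apply, map_mul M.inl, ← mul_assoc, ← unfactor_left_right]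
  induction TensorProduct.map₂ M.left M.right (comul bh v) (comul bg u) with
  | zero => simp
  | add x y hx hy => simp only [map_add, add_mul, hx, hy]
  | tmul a b => simp [mul_assoc, fst_inl_mul, left_apply]

/-- The same argument for v(v'u), using that `snd` is right `U(h)`-linear. -/
theorem right_mul_comul (v v' : BracketEnv bh) (u : BracketEnv bg) :
    M.right (v * v') u = TensorProduct.lift (LinearMap.mul k _ ∘ₗ M.right v)
      (TensorProduct.map₂ M.left M.right (comul bh v') (comul bg u)) := by
  rw [right_apply, map_mul M.inr, mul_assoc, ← unfactor_left_right]
  induction TensorProduct.map₂ M.left M.right (comul bh v') (comul bg u) with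
  | zero => simp
  | add x y hx hy => simp only [map_add, mul_add, hx, hy]
  | tmul a b => simp [← mul_assoc, snd_mul_inr, right_apply]

/-- Both coproducts are cocommutative, so the Sweedler indices may be exchanged simultaneously. -/
theorem switch (v : BracketEnv bh) (u : BracketEnv bg) :
    TensorProduct.map₂ M.right M.left (comul bh v) (comul bg u)
      = TensorProduct.comm k _ _
        (TensorProduct.map₂ M.left M.right (comul bh v) (comul bg u)) := by
  conv_lhs => rw [← comm_comul v, ← comm_comul u]
  induction comul bh v with
  | zero => simp
  | add x y hx hy => simp only [map_add, LinearMap.add_apply, hx, hy]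
  | tmul a b =>
    induction comul bg u with
    | zero => simp
    | add x y hx hy => simp only [map_add, hx, hy]
    | tmul c d => simp

/-! ### The actions on the spaces of generators -/

/-- The right action of `U(g)` on `h`. -/
def rightLie : BracketEnv bg →ₐ[k] (Module.End k h)ᵐᵒᵖ :=
  BracketEnv.lift ((MulOpposite.opLinearEquiv k).toLinearMap ∘ₗ M.ract.flip) fun ξ ξ' =>
    MulOpposite.unop_injective (LinearMap.ext fun η => by simp [M.ract_bracket])

/-- The left action of `U(h)` on `g`. -/
def leftLie : BracketEnv bh →ₐ[k] Module.End k g :=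
  BracketEnv.lift M.lact fun η η' => LinearMap.ext fun ξ => by simp [M.bracket_lact]

/-- `rightLie` lives on `h` itself and is not obtained by restricting `right`; the comparison made
here therefore does not require `ι` to be injective. -/
theorem right_ι (η : h) (u : BracketEnv bg) :
    M.right (ι bh η) u = ι bh ((M.rightLie u).unop η) := by
  induction u using induction_right with
  | one => simp [right_one]
  | add x y hx hy => simp [hx, hy]
  | smul r x hx => simp [hx]
  | mul x ξ hx => rw [right_mul, hx, right_ι_ι, map_mul]; simp [rightLie]

theorem left_ι (v : BracketEnv bh) (ξ : g) : M.left v (ι bg ξ) = ι bg (M.leftLie v ξ) := by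
  induction v using induction_left with
  | one => simp [one_left]
  | add x y hx hy => simp [hx, hy]
  | smul r x hx => simp [hx]
  | mul η x hx => rw [mul_left, hx, left_ι_ι, map_mul]; simp [leftLie]

/-! ### Equivariance under endomorphisms of the matched pair -/

section Equivariance

variable {f : g →ₗ[k] g} {f' : h →ₗ[k] h} (hf : ∀ x y, f (bg x y) = bg (f x) (f y))
  (hf' : ∀ x y, f' (bh x y) = bh (f' x) (f' y))
  (hl : ∀ η ξ, f (M.lact η ξ) = M.lact (f' η) (f ξ))
  (hr : ∀ η ξ, f' (M.ract η ξ) = M.ract (f' η) (f ξ))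

include hf hf' hl hr in
theorem prodMap_dbl (x y : g × h) :
    f.prodMap f' (M.dbl x y) = M.dbl (f.prodMap f' x) (f.prodMap f' y) := by
  simp [dbl_apply, hf, hf', hl, hr]

theorem map_prodMap_mul (u : BracketEnv bg) (v : BracketEnv bh) :
    BracketEnv.map (f.prodMap f') (M.prodMap_dbl hf hf' hl hr) (M.inl u * M.inr v)
      = M.inl (BracketEnv.map f hf u) * M.inr (BracketEnv.map f' hf' v) := by
  have h1 : (BracketEnv.map (f.prodMap f') (M.prodMap_dbl hf hf' hl hr)).comp M.inl
      = M.inl.comp (BracketEnv.map f hf) := algHom_ext fun x => by simp [inl_ι]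
  have h2 : (BracketEnv.map (f.prodMap f') (M.prodMap_dbl hf hf' hl hr)).comp M.inr
      = M.inr.comp (BracketEnv.map f' hf') := algHom_ext fun x => by simp [inr_ι]
  rw [map_mul]
  exact congrArg₂ _ (DFunLike.congr_fun h1 u) (DFunLike.congr_fun h2 v)

theorem map_prodMap_mul' (v : BracketEnv bh) (u : BracketEnv bg) :
    BracketEnv.map (f.prodMap f') (M.prodMap_dbl hf hf' hl hr) (M.inr v * M.inl u)
      = M.inr (BracketEnv.map f' hf' v) * M.inl (BracketEnv.map f hf u) := by
  have h1 := M.map_prodMap_mul hf hf' hl hr u 1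
  have h2 := M.map_prodMap_mul hf hf' hl hr 1 v
  simp only [map_one, mul_one, one_mul] at h1 h2
  rw [map_mul, h1, h2]

-- The endomorphism f × f' of the double induces an algebra map that preserves ordered products and
-- counits, hence commutes with `fst`.
include hl hr in
theorem map_left (v : BracketEnv bh) (u : BracketEnv bg) : BracketEnv.map f hf (M.left v u)
    = M.left (BracketEnv.map f' hf' v) (BracketEnv.map f hf u) := by
  rw [left_apply, left_apply, ← M.map_prodMap_mul' hf hf' hl hr]
  induction M.inr v * M.inl u using dbl_induction with
  | add x y hx hy => simp only [map_add, hx, hy]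
  | mul a b => rw [M.map_prodMap_mul hf hf' hl hr, fst_mul, fst_mul, map_smul, counit_map]

include hl hr in
theorem map_right (v : BracketEnv bh) (u : BracketEnv bg) : BracketEnv.map f' hf' (M.right v u)
    = M.right (BracketEnv.map f' hf' v) (BracketEnv.map f hf u) := by
  rw [right_apply, right_apply, ← M.map_prodMap_mul' hf hf' hl hr]
  induction M.inr v * M.inl u using dbl_induction with
  | add x y hx hy => simp only [map_add, hx, hy]
  | mul a b => rw [M.map_prodMap_mul hf hf' hl hr, snd_mul, snd_mul, map_smul, counit_map]

end Equivariance

end BracketMatchedPair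

/-! ### Untwisting the enveloping Hom-Hopf algebra -/

section LinInv

variable {k V : Type*} [Field k] [AddCommGroup V] [Module k V] {f : V →ₗ[k] V}

theorem linInv_apply_self (hf : Function.Bijective f) (x : V) : linInv f (f x) = x := by
  rw [linInv, dif_pos hf]
  exact (LinearEquiv.ofBijective f hf).symm_apply_apply x

theorem apply_linInv_self (hf : Function.Bijective f) (x : V) : f (linInv f x) = x := by
  rw [linInv, dif_pos hf]
  exact (LinearEquiv.ofBijective f hf).apply_symm_apply x

theorem linInv_id : linInv (LinearMap.id : V →ₗ[k] V) = LinearMap.id :=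
  LinearMap.ext fun x => linInv_apply_self (f := LinearMap.id) Function.bijective_id x

end LinInv

namespace HomLieAlg

variable {k g : Type*} [Field k] [AddCommGroup g] [Module k g] (G : HomLieAlg k g)

/-- The untwisted bracket `φ⁻¹[x, y]`. -/
def untwist : g →ₗ[k] g →ₗ[k] g := G.bracket.compr₂ (linInv G.twist)

variable {G} (hφ : Function.Bijective G.twist)

include hφ in
theorem twist_untwist (x y : g) : G.twist (G.untwist x y) = G.bracket x y :=
  apply_linInv_self hφ _

-- φ is an automorphism of the untwisted bracket as well; this is what allows the products to be
-- twisted back.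
include hφ in
theorem untwist_twist (x y : g) : G.twist (G.untwist x y) = G.untwist (G.twist x) (G.twist y) := by
  rw [twist_untwist hφ, untwist, LinearMap.compr₂_apply, ← G.twist_bracket, linInv_apply_self hφ]

include hφ in
theorem linInv_bracket (x y : g) : linInv G.twist (G.bracket x y)
    = G.bracket (linInv G.twist x) (linInv G.twist y) := by
  apply hφ.injective
  rw [G.twist_bracket, apply_linInv_self hφ, apply_linInv_self hφ, apply_linInv_self hφ]

/-- The automorphism of the untwisted enveloping algebra induced by `φ`. -/
def envAut : BracketEnv G.untwist →ₐ[k] BracketEnv G.untwist :=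
  BracketEnv.map G.twist (untwist_twist hφ)

@[simp] theorem envAut_ι (x : g) :
    envAut hφ (BracketEnv.ι G.untwist x) = BracketEnv.ι G.untwist (G.twist x) :=
  BracketEnv.map_ι _ _ x

theorem envAut_injective : Function.Injective (envAut hφ) := by
  have hf : ∀ x y, linInv G.twist (G.untwist x y)
      = G.untwist (linInv G.twist x) (linInv G.twist y) := fun x y => by
    rw [untwist, LinearMap.compr₂_apply, linInv_bracket hφ]; rfl
  have : (BracketEnv.map (linInv G.twist) hf).comp (envAut hφ) = AlgHom.id k _ :=
    BracketEnv.algHom_ext fun x => by simp [linInv_apply_self hφ]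
  exact Function.LeftInverse.injective (DFunLike.congr_fun this)

/-! #### The inverse of the twist of `U(g)` -/

-- Grafting with 1 applies φ to the labels, so the point is that relabelling by φ⁻¹ commutes with
-- relabelling by φ.
include hφ in
theorem graft_map_linInv (a b : Option (WTree g)) :
    (graft G a b).map (WTree.map (linInv G.twist))
      = graft G (a.map (WTree.map (linInv G.twist))) (b.map (WTree.map (linInv G.twist))) := by
  have h : ∀ t : WTree g, (t.map G.twist).map (linInv G.twist)
      = (t.map (linInv G.twist)).map G.twist := by
    intro t
    induction t with
    | leaf s ξ => simp only [WTree.map, linInv_apply_self hφ, apply_linInv_self hφ]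
    | node l r hl hr => simp only [WTree.map, hl, hr]
  rcases a with _ | a <;> rcases b with _ | b <;> simp [graft, treeTwist, WTree.map, h]

/-- The inverse of the twist of `U(g)`. -/
def envTwistInv : Env G →ₗ[k] Env G :=
  (envIdeal G).liftQ (envMk G ∘ₗ Finsupp.linearCombination k fun b =>
    basisVec k (b.map (WTree.map (linInv G.twist)))) (by
  refine kills_envIdeal (envMul G) _ ?_ ?_ ?_ ?_ ?_ ?_
  · intro a b
    simp [graft_map_linInv hφ]
  · intro s ξ ξ'
    simpa [WTree.map] using envMk_leaf_add s (linInv G.twist ξ) (linInv G.twist ξ')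
  · intro s c ξ
    simpa [WTree.map] using envMk_leaf_smul s c (linInv G.twist ξ)
  · intro x y z
    have := envMk_rel (EnvRel.assoc (G := G) (x.map (linInv G.twist)) (y.map (linInv G.twist))
      (z.map (linInv G.twist)))
    rw [map_sub, sub_eq_zero] at this
    simpa [WTree.map, map_shift] using this
  · intro s ξ
    have h : (G.twist ^ s) (linInv G.twist ξ) = linInv G.twist ((G.twist ^ s) ξ) := by
      apply hφ.injective
      rw [twist_pow_comm, apply_linInv_self hφ, apply_linInv_self hφ]
    have := envMk_leaf (G := G) s (linInv G.twist ξ)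
    simpa [WTree.map, h] using this
  · intro ξ ξ'
    have := envMk_bracket (G := G) (linInv G.twist ξ) (linInv G.twist ξ')
    simpa [WTree.map, linInv_bracket hφ] using this)

theorem envTwistInv_twist (x : Env G) : envTwistInv hφ (envTwist G x) = x := by
  have : envTwistInv hφ ∘ₗ envTwist G = LinearMap.id := env_ext fun b => by
    have h : ∀ t : WTree g, (t.map G.twist).map (linInv G.twist) = t := by
      intro t
      induction t with
      | leaf s ξ => simp only [WTree.map, linInv_apply_self hφ]
      | node l r hl hr => simp only [WTree.map, hl, hr]
    change envMk G (Finsupp.linearCombination k _ (treeTwistLin G (basisVec k b))) = _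
    rw [treeTwistLin_basis]
    rcases b with _ | b <;> simp [treeTwist, h]
  exact LinearMap.congr_fun this x

theorem envTwist_inv (x : Env G) : envTwist G (envTwistInv hφ x) = x := by
  have : envTwist G ∘ₗ envTwistInv hφ = LinearMap.id := env_ext fun b => by
    have h : ∀ t : WTree g, (t.map (linInv G.twist)).map G.twist = t := by
      intro t
      induction t with
      | leaf s ξ => simp only [WTree.map, apply_linInv_self hφ]
      | node l r hl hr => simp only [WTree.map, hl, hr]
    change envTwist G (envMk G (Finsupp.linearCombination k _ (basisVec k b))) = _
    rw [Finsupp.linearCombination_single, one_smul, envTwist_mk, treeTwistLin_basis]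
    rcases b with _ | b <;> simp [treeTwist, h]
  exact LinearMap.congr_fun this x

include hφ in
theorem envTwist_bijective : Function.Bijective (envTwist G) :=
  Function.bijective_iff_has_inverse.2 ⟨_, envTwistInv_twist hφ, envTwist_inv hφ⟩

/-! #### The isomorphism with the untwisted enveloping algebra -/

/-- The value of a tree in the untwisted enveloping algebra. -/
def evalTree : WTree g → BracketEnv G.untwist
  | WTree.leaf s ξ => BracketEnv.ι G.untwist ((G.twist ^ s) ξ)
  | WTree.node l r => envAut hφ (evalTree l * evalTree r)

/-- The linear extension of `evalTree`. -/
def evalLin : TreeSpace k g →ₗ[k] BracketEnv G.untwist :=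
  Finsupp.linearCombination k fun b => match b with
    | none => 1
    | some t => evalTree hφ t

@[simp] theorem evalLin_none : evalLin hφ (basisVec k none) = 1 := by simp [evalLin]

@[simp] theorem evalLin_some (t : WTree g) : evalLin hφ (treeVec k t) = evalTree hφ t := by
  simp [evalLin]

theorem evalTree_map (t : WTree g) :
    evalTree hφ (t.map G.twist) = envAut hφ (evalTree hφ t) := by
  induction t with
  | leaf s ξ => simp only [WTree.map, evalTree, envAut_ι, twist_pow_comm]
  | node l r hl hr => simp only [WTree.map, evalTree, hl, hr, map_mul]

theorem evalTree_shift (t : WTree g) : evalTree hφ t.shift = envAut hφ (evalTree hφ t) := by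
  induction t with
  | leaf s ξ => simp only [WTree.shift, evalTree, envAut_ι, pow_succ']; rfl
  | node l r hl hr => simp only [WTree.shift, evalTree, hl, hr, map_mul]

theorem evalLin_treeTwist (b : Option (WTree g)) :
    evalLin hφ (basisVec k (treeTwist G b)) = envAut hφ (evalLin hφ (basisVec k b)) := by
  rcases b with _ | b
  · rw [treeTwist, Option.map_none, evalLin_none, map_one]
  · rw [treeTwist, Option.map_some, evalLin_some, evalLin_some, evalTree_map]

/-- The rule x ∨ y ↦ φ(xy) also accounts for the convention 1 ∨ t = t ∨ 1 = φ(t), because φ(1 · t) =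
φ(t). -/
theorem evalLin_graft (a b : Option (WTree g)) : evalLin hφ (basisVec k (graft G a b))
    = envAut hφ (evalLin hφ (basisVec k a) * evalLin hφ (basisVec k b)) := by
  rcases a with _ | a
  · rw [evalLin_none, one_mul, ← evalLin_treeTwist]
    simp [graft]
  · rcases b with _ | b
    · rw [evalLin_none, mul_one, ← evalLin_treeTwist]
      rfl
    · rw [graft, evalLin_some, evalLin_some, evalLin_some, evalTree]

/-- The canonical map from `U(g)` to the untwisted enveloping algebra. -/
def toBracketEnv : Env G →ₗ[k] BracketEnv G.untwist :=
  (envIdeal G).liftQ (evalLin hφ) (by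
    refine kills_envIdeal ((LinearMap.mul k _).compr₂ (envAut hφ).toLinearMap) _
      (evalLin_graft hφ) ?_ ?_ ?_ ?_ ?_
    · intro s ξ ξ'
      simp only [evalLin_some, evalTree, map_add]
    · intro s c ξ
      simp only [evalLin_some, evalTree, map_smul]
    · intro x y z
      -- Raising weights acts as φ, so both trees evaluate to φ²(x)φ²(y)φ²(z).
      simp only [evalLin_some, evalTree, evalTree_shift, map_mul, mul_assoc]
    · intro s ξ
      simp only [evalLin_some, evalTree, pow_zero, Module.End.one_apply]
    · intro ξ ξ'
      simp only [evalLin_some, evalTree, pow_zero, Module.End.one_apply]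
      -- The commutator of the two generators is φ⁻¹[ξ, ξ'], and the φ carried by grafting restores
      -- [ξ, ξ'].
      rw [← map_sub, BracketEnv.ι_mul_ι, add_sub_cancel_right, envAut_ι, twist_untwist hφ])

theorem toBracketEnv_one : toBracketEnv hφ (envMk G (basisVec k none)) = 1 := evalLin_none hφ

theorem toBracketEnv_leaf (s : ℕ) (ξ : g) :
    toBracketEnv hφ (envLeaf G s ξ) = BracketEnv.ι G.untwist ((G.twist ^ s) ξ) :=
  evalLin_some hφ _

theorem toBracketEnv_mul (x y : Env G) : toBracketEnv hφ (envMul G x y)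
    = envAut hφ (toBracketEnv hφ x * toBracketEnv hφ y) := by
  have : (envMul G).compr₂ (toBracketEnv hφ)
      = ((LinearMap.mul k _).compr₂ (envAut hφ).toLinearMap).compl₁₂ (toBracketEnv hφ)
        (toBracketEnv hφ) := env_ext fun a => env_ext fun b => by
    simp only [LinearMap.compr₂_apply, LinearMap.compl₁₂_apply, envMul_mk, treeMul_basis]
    exact evalLin_graft hφ a b
  exact LinearMap.congr_fun₂ this x y

theorem toBracketEnv_twist (x : Env G) :
    toBracketEnv hφ (envTwist G x) = envAut hφ (toBracketEnv hφ x) := by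
  rw [← envOne_mul, toBracketEnv_mul, toBracketEnv_one, one_mul]

theorem envLeaf_zero_twist (ξ : g) : envTwist G (envLeaf G 0 ξ) = envLeaf G 0 (G.twist ξ) := by
  rw [envLeaf, envTwist_mk, treeTwistLin_basis]
  rfl

variable (G) in
/-- The map `ξ ↦ (0, ξ)`. -/
def envGen : g →ₗ[k] Env G where
  toFun := envLeaf G 0
  map_add' := envMk_leaf_add 0
  map_smul' := envMk_leaf_smul 0

@[simp] theorem envGen_apply (ξ : g) : envGen G ξ = envLeaf G 0 ξ := rfl

/-- The action of a generator on `U(g)` by untwisted left multiplication. -/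
def genOp : g →ₗ[k] Module.End k (Env G) :=
  ((envMul G).compr₂ (envTwistInv hφ)) ∘ₗ envGen G

theorem genOp_apply (ξ : g) (x : Env G) :
    genOp hφ ξ x = envTwistInv hφ (envMul G (envLeaf G 0 ξ) x) := rfl

/-- The product φ⁻¹(x ∨ y) is associative: applying φ² turns the claim into Hom-associativity of ∨.
-/
theorem untwisted_assoc (x y z : Env G) :
    envTwistInv hφ (envMul G x (envTwistInv hφ (envMul G y z)))
      = envTwistInv hφ (envMul G (envTwistInv hφ (envMul G x y)) z) := by
  apply (envTwist_bijective hφ).injective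
  apply (envTwist_bijective hφ).injective
  rw [envTwist_inv, envTwist_inv, envTwist_mul, envTwist_mul, envTwist_inv, envTwist_inv,
    envMul_assoc]

/-- By `untwisted_assoc` the relation reduces to one between two generators, namely φ⁻¹ of the
bracket relation of `Env`. -/
theorem genOp_comm (ξ ξ' : g) :
    genOp hφ ξ * genOp hφ ξ' = genOp hφ (G.untwist ξ ξ') + genOp hφ ξ' * genOp hφ ξ := by
  refine LinearMap.ext fun x => ?_
  have h : envTwistInv hφ (envMul G (envLeaf G 0 ξ) (envLeaf G 0 ξ'))
      = envLeaf G 0 (G.untwist ξ ξ')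
        + envTwistInv hφ (envMul G (envLeaf G 0 ξ') (envLeaf G 0 ξ)) := by
    apply (envTwist_bijective hφ).injective
    rw [map_add, envTwist_inv, envTwist_inv, envLeaf_zero_twist, twist_untwist hφ,
      ← sub_eq_iff_eq_add, envLeaf, envLeaf, ← envMk_node, ← envMk_node, envMk_bracket, envLeaf]
  simp only [Module.End.mul_apply, LinearMap.add_apply, genOp_apply, untwisted_assoc, h, map_add]

/-- The canonical map from the untwisted enveloping algebra to `U(g)`. -/
def ofBracketEnv : BracketEnv G.untwist →ₗ[k] Env G :=
  (BracketEnv.lift (genOp hφ) (genOp_comm hφ)).toLinearMap.flip (envMk G (basisVec k none))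

theorem ofBracketEnv_one : ofBracketEnv hφ 1 = envMk G (basisVec k none) := by
  simp [ofBracketEnv]

theorem ofBracketEnv_ι_mul (ξ : g) (x : BracketEnv G.untwist) :
    ofBracketEnv hφ (BracketEnv.ι G.untwist ξ * x) = genOp hφ ξ (ofBracketEnv hφ x) := by
  simp [ofBracketEnv]

theorem ofBracketEnv_ι (ξ : g) : ofBracketEnv hφ (BracketEnv.ι G.untwist ξ) = envLeaf G 0 ξ := by
  rw [← mul_one (BracketEnv.ι G.untwist ξ), ofBracketEnv_ι_mul, ofBracketEnv_one, genOp_apply,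
    envMul_one, envTwistInv_twist]

theorem toBracketEnv_ofBracketEnv (x : BracketEnv G.untwist) :
    toBracketEnv hφ (ofBracketEnv hφ x) = x := by
  induction x using BracketEnv.induction_left with
  | one => rw [ofBracketEnv_one, toBracketEnv_one]
  | add x y hx hy => rw [map_add, map_add, hx, hy]
  | smul r x hx => rw [map_smul, map_smul, hx]
  | mul ξ x hx =>
    apply envAut_injective hφ
    rw [ofBracketEnv_ι_mul, genOp_apply, ← toBracketEnv_twist, envTwist_inv, toBracketEnv_mul, hx,
      toBracketEnv_leaf, pow_zero, Module.End.one_apply]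

/-- The map was defined by acting on 1; associativity of the untwisted product makes it
multiplicative for that product. -/
theorem ofBracketEnv_mul (x y : BracketEnv G.untwist) : ofBracketEnv hφ (x * y)
    = envTwistInv hφ (envMul G (ofBracketEnv hφ x) (ofBracketEnv hφ y)) := by
  induction x using BracketEnv.induction_left with
  | one => rw [one_mul, ofBracketEnv_one, envOne_mul, envTwistInv_twist]
  | add x y hx hy => rw [add_mul, map_add, hx, hy, map_add, map_add, LinearMap.add_apply, map_add]
  | smul r x hx =>
    rw [smul_mul_assoc, map_smul, hx, map_smul, map_smul, LinearMap.smul_apply, map_smul]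
  | mul ξ x hx =>
    rw [mul_assoc, ofBracketEnv_ι_mul, ofBracketEnv_ι_mul, hx, genOp_apply, genOp_apply,
      untwisted_assoc]

theorem ofBracketEnv_envAut (x : BracketEnv G.untwist) :
    ofBracketEnv hφ (envAut hφ x) = envTwist G (ofBracketEnv hφ x) := by
  induction x using BracketEnv.induction_left with
  | one => rw [map_one, ofBracketEnv_one, envTwist_mk, treeTwistLin_basis]; rfl
  | add x y hx hy => simp only [map_add, hx, hy]
  | smul r x hx => simp only [map_smul, hx]
  | mul ξ x hx =>
    rw [map_mul, envAut_ι, ofBracketEnv_ι_mul, hx, ofBracketEnv_ι_mul, genOp_apply, genOp_apply,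
      ← envLeaf_zero_twist, ← envTwist_mul, envTwist_inv, envTwistInv_twist]

theorem ofBracketEnv_toBracketEnv (x : Env G) : ofBracketEnv hφ (toBracketEnv hφ x) = x := by
  have : ofBracketEnv hφ ∘ₗ toBracketEnv hφ = LinearMap.id := env_ext fun b => by
    change ofBracketEnv hφ (evalLin hφ (basisVec k b)) = envMk G (basisVec k b)
    rcases b with _ | t
    · rw [evalLin_none, ofBracketEnv_one]
    · rw [evalLin_some]
      induction t with
      | leaf s ξ => rw [evalTree, ofBracketEnv_ι, envMk_leaf]; rfl
      | node l r hl hr =>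
        rw [evalTree, ofBracketEnv_envAut, ofBracketEnv_mul, envTwist_inv, hl, hr, envMk_node]
  exact LinearMap.congr_fun this x

/-- `U(g)` is linearly isomorphic to the untwisted enveloping algebra. -/
def envEquiv : Env G ≃ₗ[k] BracketEnv G.untwist :=
  LinearEquiv.ofLinearMap (toBracketEnv hφ) (ofBracketEnv hφ)
    (LinearMap.ext (toBracketEnv_ofBracketEnv hφ)) (LinearMap.ext (ofBracketEnv_toBracketEnv hφ))

theorem envEquiv_one : envEquiv hφ (envMk G (basisVec k none)) = 1 := toBracketEnv_one hφ

theorem envEquiv_leaf (s : ℕ) (ξ : g) :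
    envEquiv hφ (envLeaf G s ξ) = BracketEnv.ι G.untwist ((G.twist ^ s) ξ) :=
  toBracketEnv_leaf hφ s ξ

theorem envEquiv_mul (x y : Env G) :
    envEquiv hφ (envMul G x y) = envAut hφ (envEquiv hφ x * envEquiv hφ y) :=
  toBracketEnv_mul hφ x y

theorem envEquiv_twist (x : Env G) :
    envEquiv hφ (envTwist G x) = envAut hφ (envEquiv hφ x) := toBracketEnv_twist hφ x

end HomLieAlg

/-! ### The Hom-Hopf structure of `U(g)` -/

namespace HomLieAlg

variable {k g : Type*} [Field k] [AddCommGroup g] [Module k g] {G : HomLieAlg k g}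

/-! ### Structure maps of `Env` on generators and products -/

@[elab_as_elim]
theorem env_induction {C : Env G → Prop} (x : Env G) (one : C (envMk G (basisVec k none)))
    (leaf : ∀ s ξ, C (envLeaf G s ξ)) (mul : ∀ x y, C x → C y → C (envMul G x y))
    (add : ∀ x y, C x → C y → C (x + y)) (smul : ∀ (c : k) x, C x → C (c • x)) : C x := by
  have htree : ∀ t : WTree g, C (envMk G (treeVec k t)) := by
    intro t
    induction t with
    | leaf s ξ => exact leaf s ξ
    | node l r hl hr => rw [envMk_node]; exact mul _ _ hl hr
  obtain ⟨y, rfl⟩ := (envIdeal G).mkQ_surjective x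
  change C (envMk G y)
  induction y using Finsupp.induction_linear with
  | zero => simpa using smul 0 _ one
  | add a b ha hb => rw [map_add]; exact add _ _ ha hb
  | single b c =>
    have : (Finsupp.single b c : TreeSpace k g) = c • basisVec k b := by simp
    rw [this, map_smul]
    rcases b with _ | t
    · exact smul c _ one
    · exact smul c _ (htree t)

theorem envTwist_one : envTwist G (envMk G (basisVec k none)) = envMk G (basisVec k none) := by
  rw [envTwist_mk, treeTwistLin_basis]; rfl

theorem envLeaf_eq (s : ℕ) (ξ : g) : envLeaf G s ξ = envLeaf G 0 ((G.twist ^ s) ξ) :=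
  envMk_leaf s ξ

theorem envComul_one : envComul G (envMk G (basisVec k none))
    = envMk G (basisVec k none) ⊗ₜ[k] envMk G (basisVec k none) := preComul_none

theorem envComul_leaf (s : ℕ) (ξ : g) : envComul G (envLeaf G s ξ)
    = envLeaf G s ξ ⊗ₜ[k] envMk G (basisVec k none)
      + envMk G (basisVec k none) ⊗ₜ[k] envLeaf G s ξ := preComul_leaf s ξ

theorem envComul_mul (x y : Env G) : envComul G (envMul G x y)
    = TensorProduct.map₂ (envMul G) (envMul G) (envComul G x) (envComul G y) := by
  have : (envMul G).compr₂ (envComul G)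
      = (TensorProduct.map₂ (envMul G) (envMul G)).compl₁₂ (envComul G) (envComul G) :=
    env_ext fun a => env_ext fun b => by
      simp only [LinearMap.compr₂_apply, LinearMap.compl₁₂_apply, envMul_mk, treeMul_basis]
      exact preComul_graft a b
  exact LinearMap.congr_fun₂ this x y

theorem envCounit_one : envCounit G (envMk G (basisVec k none)) = 1 := by
  change treeCounit k g _ = 1
  simp [treeCounit]

theorem envCounit_leaf (s : ℕ) (ξ : g) : envCounit G (envLeaf G s ξ) = 0 := by
  change treeCounit k g _ = 0
  simp [treeCounit]

theorem envCounit_mul (x y : Env G) :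
    envCounit G (envMul G x y) = envCounit G x * envCounit G y := by
  have : (envMul G).compr₂ (envCounit G)
      = (LinearMap.mul k k).compl₁₂ (envCounit G) (envCounit G) :=
    env_ext fun a => env_ext fun b => by
      change treeCounit k g (treeMul G (basisVec k a) (basisVec k b))
        = treeCounit k g (basisVec k a) * treeCounit k g (basisVec k b)
      rw [treeMul_basis]
      rcases a with _ | a <;> rcases b with _ | b <;> simp [treeCounit, graft, treeTwist]
  exact LinearMap.congr_fun₂ this x y

theorem envAntipode_one :
    envAntipode G (envMk G (basisVec k none)) = envMk G (basisVec k none) := by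
  change envMk G (treeAntipode G _) = _
  simp [treeAntipode]

theorem envAntipode_tree (t : WTree g) :
    envAntipode G (envMk G (treeVec k t)) = envMk G (antipodeTree G t) := by
  change envMk G (treeAntipode G _) = _
  simp [treeAntipode]

theorem envAntipode_leaf (s : ℕ) (ξ : g) : envAntipode G (envLeaf G s ξ) = -envLeaf G s ξ := by
  rw [envLeaf, envAntipode_tree, preAntipode_leaf]

theorem envAntipode_twist (x : Env G) :
    envAntipode G (envTwist G x) = envTwist G (envAntipode G x) := by
  have : envAntipode G ∘ₗ envTwist G = envTwist G ∘ₗ envAntipode G := env_ext fun b => by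
    rw [LinearMap.comp_apply, LinearMap.comp_apply, envTwist_mk, treeTwistLin_basis]
    rcases b with _ | t
    · rw [envAntipode_one, envTwist_one]; exact envAntipode_one
    · rw [envAntipode_tree, envTwist_mk, ← antipodeTree_map]
      exact envAntipode_tree _
  exact LinearMap.congr_fun this x

theorem envAntipode_mul (x y : Env G) : envAntipode G (envMul G x y)
    = envMul G (envAntipode G y) (envAntipode G x) := by
  have : (envMul G).compr₂ (envAntipode G)
      = (envMul G).flip.compl₁₂ (envAntipode G) (envAntipode G) :=
    env_ext fun a => env_ext fun b => by
      simp only [LinearMap.compr₂_apply, LinearMap.compl₁₂_apply, LinearMap.flip_apply]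
      rcases a with _ | a
      · rw [envOne_mul, envAntipode_one, envMul_one, envAntipode_twist]
      · rcases b with _ | b
        · rw [envMul_one, envAntipode_one, envOne_mul, envAntipode_twist]
        · rw [← envMk_node, envAntipode_tree, envAntipode_tree, envAntipode_tree,
            preAntipode_node]
  exact LinearMap.congr_fun₂ this x y

/-! ### Transport of the Hopf laws along `envEquiv` -/

section

variable (hφ : Function.Bijective G.twist)

theorem comul_envAut (x : BracketEnv G.untwist) : BracketEnv.comul _ (envAut hφ x)
    = TensorProduct.map (envAut hφ).toLinearMap (envAut hφ).toLinearMap (BracketEnv.comul _ x) :=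
  BracketEnv.comul_map _ _ x

theorem counit_envAut (x : BracketEnv G.untwist) :
    BracketEnv.counit _ (envAut hφ x) = BracketEnv.counit _ x :=
  BracketEnv.counit_map _ _ x

/-- Leaves go to primitive elements, and φ is a coalgebra map, so the twist in x ∨ y ↦ φ(xy) does
not disturb Δ. -/
theorem comul_envEquiv (x : Env G) : BracketEnv.comul _ (envEquiv hφ x)
    = TensorProduct.map (envEquiv hφ).toLinearMap (envEquiv hφ).toLinearMap (envComul G x) := by
  induction x using env_induction with
  | one => simp [envEquiv_one, envComul_one, Algebra.TensorProduct.one_def]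
  | leaf s ξ => simp [envEquiv_leaf, envComul_leaf, envEquiv_one]
  | add x y hx hy => simp only [map_add, hx, hy]
  | smul c x hx => simp only [map_smul, hx]
  | mul x y hx hy =>
    rw [envEquiv_mul, comul_envAut, map_mul, hx, hy, envComul_mul]
    induction envComul G x with
    | zero => simp
    | add a b ha hb => simp only [map_add, add_mul, LinearMap.add_apply, ha, hb]
    | tmul a b =>
      induction envComul G y with
      | zero => simp
      | add c d hc hd => simp only [map_add, mul_add, hc, hd]
      | tmul c d => simp [envEquiv_mul]

theorem counit_envEquiv (x : Env G) :
    BracketEnv.counit _ (envEquiv hφ x) = envCounit G x := by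
  induction x using env_induction with
  | one => rw [envEquiv_one, map_one, envCounit_one]
  | leaf s ξ => rw [envEquiv_leaf, BracketEnv.counit_ι, envCounit_leaf]
  | add x y hx hy => simp only [map_add, hx, hy]
  | smul c x hx => simp only [map_smul, hx]
  | mul x y hx hy => rw [envEquiv_mul, counit_envAut, map_mul, hx, hy, envCounit_mul]

theorem envComul_envEquiv_symm (x : BracketEnv G.untwist) : envComul G ((envEquiv hφ).symm x)
    = TensorProduct.map (envEquiv hφ).symm.toLinearMap (envEquiv hφ).symm.toLinearMap
      (BracketEnv.comul _ x) := by
  obtain ⟨y, rfl⟩ := (envEquiv hφ).surjective x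
  rw [LinearEquiv.symm_apply_apply, comul_envEquiv]
  induction envComul G y with
  | zero => simp
  | add a b ha hb => rw [map_add, map_add, ← ha, ← hb]
  | tmul a b => simp

include hφ in
theorem envComul_coassoc (x : Env G) : TensorProduct.assoc k _ _ _
      (TensorProduct.map (envComul G) LinearMap.id (envComul G x))
    = TensorProduct.map LinearMap.id (envComul G) (envComul G x) := by
  obtain ⟨y, rfl⟩ := (envEquiv hφ).symm.surjective x
  set e := (envEquiv hφ).symm.toLinearMap
  have h := congrArg (TensorProduct.map e (TensorProduct.map e e)) (BracketEnv.coassoc y)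
  rw [envComul_envEquiv_symm]
  have h1 : ∀ s, TensorProduct.map e (TensorProduct.map e e) (TensorProduct.assoc k _ _ _
      (TensorProduct.map (BracketEnv.comul G.untwist).toLinearMap LinearMap.id s))
      = TensorProduct.assoc k _ _ _
        (TensorProduct.map (envComul G) LinearMap.id (TensorProduct.map e e s)) := by
    intro s
    induction s with
    | zero => simp
    | add a b ha hb => simp only [map_add, ha, hb]
    | tmul a b =>
      have : envComul G (e a) = _ := envComul_envEquiv_symm hφ a
      simp only [TensorProduct.map_tmul, this, AlgHom.toLinearMap_apply, LinearMap.id_apply]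
      induction BracketEnv.comul G.untwist a with
      | zero => simp
      | add c d hc hd => simp only [map_add, TensorProduct.add_tmul, hc, hd]
      | tmul c d => simp [e]
  have h2 : ∀ s, TensorProduct.map e (TensorProduct.map e e)
      (TensorProduct.map LinearMap.id (BracketEnv.comul G.untwist).toLinearMap s)
      = TensorProduct.map LinearMap.id (envComul G) (TensorProduct.map e e s) := by
    intro s
    induction s with
    | zero => simp
    | add a b ha hb => simp only [map_add, ha, hb]
    | tmul a b =>
      have : envComul G (e b) = _ := envComul_envEquiv_symm hφ b
      simp only [TensorProduct.map_tmul, this, AlgHom.toLinearMap_apply, LinearMap.id_apply]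
      rfl
  rw [h1, h2] at h
  exact h

include hφ in
theorem envCounit_rTensor (x : Env G) :
    TensorProduct.lid k _ ((envCounit G).rTensor _ (envComul G x)) = x := by
  apply (envEquiv hφ).injective
  rw [← BracketEnv.counit_rTensor (envEquiv hφ x), comul_envEquiv]
  induction envComul G x with
  | zero => simp
  | add a b ha hb => simp only [map_add, ha, hb]
  | tmul a b => simp [counit_envEquiv]

include hφ in
theorem envCounit_lTensor (x : Env G) :
    TensorProduct.rid k _ ((envCounit G).lTensor _ (envComul G x)) = x := by
  apply (envEquiv hφ).injective
  rw [← BracketEnv.counit_lTensor (envEquiv hφ x), comul_envEquiv]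
  induction envComul G x with
  | zero => simp
  | add a b ha hb => simp only [map_add, ha, hb]
  | tmul a b => simp [counit_envEquiv]

/-- The twist is left multiplication by 1, and 1 is grouplike. -/
theorem envComul_twist (x : Env G) : envComul G (envTwist G x)
    = TensorProduct.map (envTwist G) (envTwist G) (envComul G x) := by
  rw [← envOne_mul, envComul_mul, envComul_one, TensorProduct.map₂_apply_tmul]
  rw [show envMul G (envMk G (basisVec k none)) = envTwist G from LinearMap.ext envOne_mul]

theorem envCounit_twist (x : Env G) : envCounit G (envTwist G x) = envCounit G x := by
  rw [← envOne_mul, envCounit_mul, envCounit_one, one_mul]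

/-- The antipode on the untwisted enveloping algebra. -/
def untwistAntipode : BracketEnv G.untwist →ₗ[k] BracketEnv G.untwist :=
  (envEquiv hφ).toLinearMap ∘ₗ envAntipode G ∘ₗ (envEquiv hφ).symm.toLinearMap

theorem untwistAntipode_envEquiv (x : Env G) :
    untwistAntipode hφ (envEquiv hφ x) = envEquiv hφ (envAntipode G x) := by
  simp [untwistAntipode]

theorem untwistAntipode_one : untwistAntipode hφ 1 = 1 := by
  rw [← envEquiv_one hφ, untwistAntipode_envEquiv, envAntipode_one]

theorem untwistAntipode_ι (ξ : g) :
    untwistAntipode hφ (BracketEnv.ι _ ξ) = -BracketEnv.ι _ ξ := by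
  have h := envEquiv_leaf hφ 0 ξ
  rw [pow_zero, Module.End.one_apply] at h
  rw [← h, untwistAntipode_envEquiv, envAntipode_leaf, map_neg]

theorem untwistAntipode_mul (x y : BracketEnv G.untwist) :
    untwistAntipode hφ (x * y) = untwistAntipode hφ y * untwistAntipode hφ x := by
  obtain ⟨x, rfl⟩ := (envEquiv hφ).surjective x
  obtain ⟨y, rfl⟩ := (envEquiv hφ).surjective y
  apply envAut_injective hφ
  simp only [untwistAntipode_envEquiv]
  -- After φ is applied, both products are images of ∨, for which the antipode is
  -- antimultiplicative; it remains to move φ past the antipode.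
  rw [← envEquiv_mul, ← envAntipode_mul, ← untwistAntipode_envEquiv, envEquiv_mul]
  generalize envEquiv hφ x * envEquiv hφ y = z
  obtain ⟨z, rfl⟩ := (envEquiv hφ).surjective z
  rw [← envEquiv_twist, untwistAntipode_envEquiv, untwistAntipode_envEquiv, envAntipode_twist,
    envEquiv_twist]

include hφ in
theorem envAntipode_left (x : Env G) : TensorProduct.lift (envMul G)
    (TensorProduct.map (envAntipode G) LinearMap.id (envComul G x))
      = envCounit G x • envMk G (basisVec k none) := by
  apply (envEquiv hφ).injective
  -- The unit is rewritten as φ(1): the product ∨ contributes one φ on the other side, so the claim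
  -- becomes φ of the untwisted antipode law.
  rw [map_smul, envEquiv_one, ← counit_envEquiv hφ, ← map_one (envAut hφ), ← map_smul,
    ← BracketEnv.antipode_left _ (untwistAntipode_one hφ) (untwistAntipode_mul hφ)
      (untwistAntipode_ι hφ), comul_envEquiv]
  induction envComul G x with
  | zero => simp
  | add a b ha hb => simp only [map_add, ha, hb]
  | tmul a b => simp [envEquiv_mul, untwistAntipode_envEquiv]

include hφ in
theorem envAntipode_right (x : Env G) : TensorProduct.lift (envMul G)
    (TensorProduct.map LinearMap.id (envAntipode G) (envComul G x))
      = envCounit G x • envMk G (basisVec k none) := by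
  apply (envEquiv hφ).injective
  rw [map_smul, envEquiv_one, ← counit_envEquiv hφ, ← map_one (envAut hφ), ← map_smul,
    ← BracketEnv.antipode_right _ (untwistAntipode_one hφ) (untwistAntipode_mul hφ)
      (untwistAntipode_ι hφ), comul_envEquiv]
  induction envComul G x with
  | zero => simp
  | add a b ha hb => simp only [map_add, ha, hb]
  | tmul a b => simp [envEquiv_mul, untwistAntipode_envEquiv]

include hφ in
theorem isHomHopf_envHopf : IsHomHopf (envHopf G) where
  hom_assoc x y z := (envMul_assoc x y z).symm
  one_mul := envOne_mul
  mul_one := envMul_one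
  twist_one := envTwist_one
  hom_coassoc := envComul_coassoc hφ
  counit_left := envCounit_rTensor hφ
  counit_right := envCounit_lTensor hφ
  counit_cotwist _ := rfl
  comul_one := envComul_one
  comul_mul := envComul_mul
  comul_twist := envComul_twist
  counit_one := envCounit_one
  counit_mul := envCounit_mul
  counit_twist := envCounit_twist
  cotwist_one := rfl
  cotwist_mul _ _ := rfl
  cotwist_twist _ := rfl
  antipode_left := envAntipode_left hφ
  antipode_right := envAntipode_right hφ
  antipode_twist := envAntipode_twist
  antipode_cotwist _ := rfl

end

end HomLieAlg

/-! ### Uniqueness of the induced actions -/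

namespace HomLieAlg

variable {k g : Type*} [Field k] [AddCommGroup g] [Module k g] {G : HomLieAlg k g}

theorem envLeaf_twist (s : ℕ) (ξ : g) : envTwist G (envLeaf G s ξ) = envLeaf G s (G.twist ξ) := by
  rw [envLeaf, envTwist_mk, treeTwistLin_basis]
  rfl

/-- Induction on `U(g)` in which the hypotheses are also available for the twisted factors. -/
@[elab_as_elim]
theorem env_induction_twist {C : Env G → Prop} (x : Env G) (one : C (envMk G (basisVec k none)))
    (leaf : ∀ s ξ, C (envLeaf G s ξ))
    (mul : ∀ x y, C x → C y → C (envTwist G x) → C (envTwist G y) → C (envMul G x y))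
    (add : ∀ x y, C x → C y → C (x + y)) (smul : ∀ (c : k) x, C x → C (c • x)) : C x := by
  suffices h : ∀ n : ℕ, C ((envTwist G ^ n) x) from h 0
  have succ : ∀ (n : ℕ) y, (envTwist G ^ (n + 1)) y = envTwist G ((envTwist G ^ n) y) :=
    fun n y => by rw [pow_succ']; rfl
  induction x using env_induction with
  | one =>
    have h : ∀ n : ℕ, (envTwist G ^ n) (envMk G (basisVec k none)) = envMk G (basisVec k none) := by
      intro n
      induction n with
      | zero => rfl
      | succ n ih => rw [succ, ih, envTwist_one]
    exact fun n => by rw [h]; exact one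
  | leaf s ξ =>
    have h : ∀ n : ℕ, (envTwist G ^ n) (envLeaf G s ξ) = envLeaf G s ((G.twist ^ n) ξ) := by
      intro n
      induction n with
      | zero => rfl
      | succ n ih => rw [succ, ih, envLeaf_twist, pow_succ']; rfl
    exact fun n => by rw [h]; exact leaf s _
  | mul x y hx hy =>
    have h : ∀ n : ℕ, (envTwist G ^ n) (envMul G x y)
        = envMul G ((envTwist G ^ n) x) ((envTwist G ^ n) y) := by
      intro n
      induction n with
      | zero => rfl
      | succ n ih => rw [succ, ih, envTwist_mul, succ, succ]
    exact fun n => by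
      rw [h]
      exact mul _ _ (hx n) (hy n) (succ n x ▸ hx (n + 1)) (succ n y ▸ hy (n + 1))
  | add x y hx hy => exact fun n => by rw [map_add]; exact add _ _ (hx n) (hy n)
  | smul c x hx => exact fun n => by rw [map_smul]; exact smul _ _ (hx n)

variable (hφ : Function.Bijective G.twist)

include hφ in
theorem linInv_envTwist_leaf (ξ : g) :
    linInv (envTwist G) (envLeaf G 0 ξ) = envLeaf G 0 (linInv G.twist ξ) := by
  apply (envTwist_bijective hφ).injective
  rw [apply_linInv_self (envTwist_bijective hφ), envLeaf_twist, apply_linInv_self hφ]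

include hφ in
theorem linInv_envTwist_one :
    linInv (envTwist G) (envMk G (basisVec k none)) = envMk G (basisVec k none) := by
  apply (envTwist_bijective hφ).injective
  rw [apply_linInv_self (envTwist_bijective hφ), envTwist_one]

theorem pow_linInv {k V : Type*} [Field k] [AddCommGroup V] [Module k V] {f : V →ₗ[k] V}
    (hf : Function.Bijective f) (s : ℕ) (x : V) : (f ^ s) ((linInv f ^ s) x) = x := by
  induction s generalizing x with
  | zero => rfl
  | succ s ih =>
    rw [pow_succ, pow_succ', Module.End.mul_apply, Module.End.mul_apply, apply_linInv_self hf, ih]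

end HomLieAlg

namespace InducedActions

open HomLieAlg

variable {k g h : Type*} [Field k] [AddCommGroup g] [Module k g] [AddCommGroup h] [Module k h]
  {G : HomLieAlg k g} {H : HomLieAlg k h} {M : HomLieMatchedPair G H}

/-- The formula for α(η) ◁ (x ∨ y) uses the values on x and φ(y), and φ(y) is not a factor of x ∨ y;
hence the induction over twists. Surjectivity of α makes the formula cover every element of `h`. -/
theorem ractLie_unique (hα : Function.Bijective H.twist) (A B : InducedActions M) :
    A.ractLie = B.ractLie := by
  refine LinearMap.ext₂ fun η x => ?_
  induction x using env_induction_twist generalizing η with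
  | one => exact (A.ractLie_one η).trans (B.ractLie_one η).symm
  | leaf s ξ => rw [A.ractLie_leaf, B.ractLie_leaf]
  | add x y hx hy => rw [map_add, map_add, hx, hy]
  | smul c x hx => rw [map_smul, map_smul, hx]
  | mul x y hx _ _ hy =>
    obtain ⟨η, rfl⟩ := hα.surjective η
    rw [A.ractLie_mul, B.ractLie_mul, hx, hy]

theorem lactLie_unique (hφ : Function.Bijective G.twist) (A B : InducedActions M) :
    A.lactLie = B.lactLie := by
  refine LinearMap.ext₂ fun v ξ => ?_
  induction v using env_induction_twist generalizing ξ with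
  | one => exact (A.lactLie_one ξ).trans (B.lactLie_one ξ).symm
  | leaf s η => rw [A.lactLie_leaf, B.lactLie_leaf]
  | add x y hx hy => simp only [map_add, LinearMap.add_apply, hx, hy]
  | smul c x hx => simp only [map_smul, LinearMap.smul_apply, hx]
  | mul v w _ hw hv _ =>
    obtain ⟨ξ, rfl⟩ := hφ.surjective ξ
    rw [A.lactLie_mul, B.lactLie_mul, hw, hv]

/-- This recursion calls only x and y themselves, but at other elements of `h` that depend on
`ractLie`, whose uniqueness must come first. -/
theorem lieLact_unique (hα : Function.Bijective H.twist) (A B : InducedActions M) :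
    A.lieLact = B.lieLact := by
  refine LinearMap.ext₂ fun η x => ?_
  induction x using env_induction generalizing η with
  | one => exact (A.lieLact_one η).trans (B.lieLact_one η).symm
  | leaf s ξ => rw [A.lieLact_leaf, B.lieLact_leaf]
  | add x y hx hy => rw [map_add, map_add, hx, hy]
  | smul c x hx => rw [map_smul, map_smul, hx]
  | mul x y hx hy =>
    have h : A.lieLact.flip y = B.lieLact.flip y := LinearMap.ext hy
    rw [A.lieLact_mul, B.lieLact_mul, hx, h, A.ractLie_unique hα B]

theorem lieRact_unique (hφ : Function.Bijective G.twist) (A B : InducedActions M) :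
    A.lieRact = B.lieRact := by
  refine LinearMap.ext₂ fun v ξ => ?_
  induction v using env_induction generalizing ξ with
  | one => exact (A.lieRact_one ξ).trans (B.lieRact_one ξ).symm
  | leaf s η => rw [A.lieRact_leaf, B.lieRact_leaf]
  | add x y hx hy => simp only [map_add, LinearMap.add_apply, hx, hy]
  | smul c x hx => simp only [map_smul, LinearMap.smul_apply, hx]
  | mul v w hv hw =>
    have h : A.lieRact v = B.lieRact v := LinearMap.ext hv
    rw [A.lieRact_mul, B.lieRact_mul, hw, h, A.lactLie_unique hφ B]

theorem lact_unique (hφ : Function.Bijective G.twist) (hα : Function.Bijective H.twist)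
    (A B : InducedActions M) : A.lact = B.lact := by
  refine LinearMap.ext₂ fun v u => ?_
  induction v using env_induction_twist generalizing u with
  | one => exact (A.lact_one u).trans (B.lact_one u).symm
  | leaf s η => rw [A.lact_leaf, B.lact_leaf, A.lieLact_unique hα B]
  | add x y hx hy => simp only [map_add, LinearMap.add_apply, hx, hy]
  | smul c x hx => simp only [map_smul, LinearMap.smul_apply, hx]
  | mul v w _ hw hv _ =>
    obtain ⟨u, rfl⟩ := (envTwist_bijective hφ).surjective u
    rw [A.lact_mul, B.lact_mul, hw, hv]

theorem ract_unique (hφ : Function.Bijective G.twist) (hα : Function.Bijective H.twist)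
    (A B : InducedActions M) : A.ract = B.ract := by
  refine LinearMap.ext₂ fun v x => ?_
  induction x using env_induction_twist generalizing v with
  | one => exact (A.ract_one v).trans (B.ract_one v).symm
  | leaf s ξ => rw [A.ract_leaf, B.ract_leaf, A.lieRact_unique hφ B]
  | add x y hx hy => rw [map_add, map_add, hx, hy]
  | smul c x hx => rw [map_smul, map_smul, hx]
  | mul x y hx _ _ hy =>
    obtain ⟨v, rfl⟩ := (envTwist_bijective hα).surjective v
    rw [A.ract_mul, B.ract_mul, hx, hy]

theorem unique (hφ : Function.Bijective G.twist) (hα : Function.Bijective H.twist)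
    (A B : InducedActions M) : A = B := by
  have h1 := ractLie_unique hα A B
  have h2 := lieLact_unique hα A B
  have h3 := lactLie_unique hφ A B
  have h4 := lieRact_unique hφ A B
  have h5 := lact_unique hφ hα A B
  have h6 := ract_unique hφ hα A B
  cases A
  cases B
  simp only at h1 h2 h3 h4 h5 h6
  subst h1 h2 h3 h4 h5 h6
  rfl

end InducedActions

/-! ### Existence of the induced actions -/

namespace HomLieMatchedPair

open HomLieAlg

variable {k g h : Type*} [Field k] [AddCommGroup g] [Module k g] [AddCommGroup h] [Module k h]
  {G : HomLieAlg k g} {H : HomLieAlg k h} (M : HomLieMatchedPair G H)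
  (hφ : Function.Bijective G.twist) (hα : Function.Bijective H.twist)

/-- The underlying matched pair of untwisted brackets. -/
def untwist : BracketMatchedPair G.untwist H.untwist :=
  have hl : ∀ η ξ, G.twist (M.lact.compr₂ (linInv G.twist) η ξ) = M.lact η ξ :=
    fun _ _ => apply_linInv_self hφ _
  have hr : ∀ η ξ, H.twist (M.ract.compr₂ (linInv H.twist) η ξ) = M.ract η ξ :=
    fun _ _ => apply_linInv_self hα _
  { lact := M.lact.compr₂ (linInv G.twist)
    ract := M.ract.compr₂ (linInv H.twist)
    bracket_lact := fun η η' ξ => by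
      -- Each term contains two untwisted operations, so two applications of φ are needed to clear
      -- the inverses.
      apply hφ.injective
      apply hφ.injective
      simp only [map_sub, hl, M.twist_lact, twist_untwist hα, M.bracket_lact]
    ract_bracket := fun η ξ ξ' => by
      apply hα.injective
      apply hα.injective
      simp only [map_sub, hr, M.twist_ract, twist_untwist hφ, M.ract_bracket]
    lact_bracket := fun η ξ ξ' => by
      apply hφ.injective
      apply hφ.injective
      simp only [map_sub, map_add, hl, hr, M.twist_lact, twist_untwist hφ, G.twist_bracket,
        M.lact_bracket]
    bracket_ract := fun η η' ξ => by
      apply hα.injective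
      apply hα.injective
      simp only [map_sub, map_add, hl, hr, M.twist_ract, twist_untwist hα, H.twist_bracket,
        M.bracket_ract] }

theorem twist_untwist_lact (η : h) (ξ : g) :
    G.twist ((M.untwist hφ hα).lact η ξ) = M.lact η ξ := apply_linInv_self hφ _

theorem twist_untwist_ract (η : h) (ξ : g) :
    H.twist ((M.untwist hφ hα).ract η ξ) = M.ract η ξ := apply_linInv_self hα _

theorem untwist_lact_twist (η : h) (ξ : g) : G.twist ((M.untwist hφ hα).lact η ξ)
    = (M.untwist hφ hα).lact (H.twist η) (G.twist ξ) := by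
  apply hφ.injective
  rw [twist_untwist_lact, twist_untwist_lact, M.twist_lact]

theorem untwist_ract_twist (η : h) (ξ : g) : H.twist ((M.untwist hφ hα).ract η ξ)
    = (M.untwist hφ hα).ract (H.twist η) (G.twist ξ) := by
  apply hα.injective
  rw [twist_untwist_ract, twist_untwist_ract, M.twist_ract]

theorem envAut_left (v : BracketEnv H.untwist) (u : BracketEnv G.untwist) :
    envAut hφ ((M.untwist hφ hα).left v u)
      = (M.untwist hφ hα).left (envAut hα v) (envAut hφ u) :=
  (M.untwist hφ hα).map_left (untwist_twist hφ) (untwist_twist hα) (M.untwist_lact_twist hφ hα)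
    (M.untwist_ract_twist hφ hα) v u

theorem envAut_right (v : BracketEnv H.untwist) (u : BracketEnv G.untwist) :
    envAut hα ((M.untwist hφ hα).right v u)
      = (M.untwist hφ hα).right (envAut hα v) (envAut hφ u) :=
  (M.untwist hφ hα).map_right (untwist_twist hφ) (untwist_twist hα) (M.untwist_lact_twist hφ hα)
    (M.untwist_ract_twist hφ hα) v u

/-! ### The retwisted actions and their matched pair laws -/

/-- The left action of `U(h)` on `U(g)`. -/
def envLact : Env H →ₗ[k] Env G →ₗ[k] Env G :=
  ((M.untwist hφ hα).left.compl₁₂ (envEquiv hα).toLinearMap (envEquiv hφ).toLinearMap).compr₂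
    (envTwist G ∘ₗ (envEquiv hφ).symm.toLinearMap)

/-- The right action of `U(g)` on `U(h)`. -/
def envRact : Env H →ₗ[k] Env G →ₗ[k] Env H :=
  ((M.untwist hφ hα).right.compl₁₂ (envEquiv hα).toLinearMap (envEquiv hφ).toLinearMap).compr₂
    (envTwist H ∘ₗ (envEquiv hα).symm.toLinearMap)

theorem envEquiv_lact (v : Env H) (u : Env G) : envEquiv hφ (M.envLact hφ hα v u)
    = envAut hφ ((M.untwist hφ hα).left (envEquiv hα v) (envEquiv hφ u)) := by
  change envEquiv hφ (envTwist G ((envEquiv hφ).symm _)) = _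
  rw [envEquiv_twist, LinearEquiv.apply_symm_apply]
  rfl

theorem envEquiv_ract (v : Env H) (u : Env G) : envEquiv hα (M.envRact hφ hα v u)
    = envAut hα ((M.untwist hφ hα).right (envEquiv hα v) (envEquiv hφ u)) := by
  change envEquiv hα (envTwist H ((envEquiv hα).symm _)) = _
  rw [envEquiv_twist, LinearEquiv.apply_symm_apply]
  rfl

theorem envLact_one (v : Env H) : M.envLact hφ hα v (envMk G (basisVec k none))
    = envCounit H v • envMk G (basisVec k none) := by
  apply (envEquiv hφ).injective
  rw [envEquiv_lact, envEquiv_one, BracketMatchedPair.left_one, map_smul, map_smul, map_one,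
    envEquiv_one, counit_envEquiv]

theorem one_envLact (u : Env G) :
    M.envLact hφ hα (envMk H (basisVec k none)) u = envTwist G u := by
  apply (envEquiv hφ).injective
  rw [envEquiv_lact, envEquiv_one, BracketMatchedPair.one_left, envEquiv_twist]

theorem one_envRact (u : Env G) : M.envRact hφ hα (envMk H (basisVec k none)) u
    = envCounit G u • envMk H (basisVec k none) := by
  apply (envEquiv hα).injective
  rw [envEquiv_ract, envEquiv_one, BracketMatchedPair.one_right, map_smul, map_smul, map_one,
    envEquiv_one, counit_envEquiv]

theorem envRact_one (v : Env H) :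
    M.envRact hφ hα v (envMk G (basisVec k none)) = envTwist H v := by
  apply (envEquiv hα).injective
  rw [envEquiv_ract, envEquiv_one, BracketMatchedPair.right_one, envEquiv_twist]

theorem twist_envLact (v : Env H) (u : Env G) : envTwist G (M.envLact hφ hα v u)
    = M.envLact hφ hα (envTwist H v) (envTwist G u) := by
  apply (envEquiv hφ).injective
  simp only [envEquiv_lact, envEquiv_twist, envAut_left]

theorem twist_envRact (v : Env H) (u : Env G) : envTwist H (M.envRact hφ hα v u)
    = M.envRact hφ hα (envTwist H v) (envTwist G u) := by
  apply (envEquiv hα).injective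
  simp only [envEquiv_ract, envEquiv_twist, envAut_right]

/-- Both sides are φ² of the untwisted action law, since each product and each action contributes
one φ. -/
theorem mul_envLact (v w : Env H) (u : Env G) :
    M.envLact hφ hα (envMul H v w) (envTwist G u)
      = M.envLact hφ hα (envTwist H v) (M.envLact hφ hα w u) := by
  apply (envEquiv hφ).injective
  simp only [envEquiv_lact, envEquiv_twist, envEquiv_mul, map_mul, BracketMatchedPair.mul_left,
    envAut_left]

theorem envRact_mul (v : Env H) (x y : Env G) :
    M.envRact hφ hα (envTwist H v) (envMul G x y)
      = M.envRact hφ hα (M.envRact hφ hα v x) (envTwist G y) := by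
  apply (envEquiv hα).injective
  simp only [envEquiv_ract, envEquiv_twist, envEquiv_mul, map_mul, BracketMatchedPair.right_mul,
    envAut_right]

theorem envComul_lact (v : Env H) (u : Env G) : envComul G (M.envLact hφ hα v u)
    = TensorProduct.map₂ (M.envLact hφ hα) (M.envLact hφ hα) (envComul H v) (envComul G u) := by
  have h : M.envLact hφ hα v u = envTwist G ((envEquiv hφ).symm
    ((M.untwist hφ hα).left (envEquiv hα v) (envEquiv hφ u))) := rfl
  rw [h, envComul_twist, envComul_envEquiv_symm, BracketMatchedPair.comul_left, comul_envEquiv,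
    comul_envEquiv]
  induction envComul H v with
  | zero => simp
  | add a b ha hb => simp only [map_add, LinearMap.add_apply, ha, hb]
  | tmul a b =>
    induction envComul G u with
    | zero => simp
    | add c d hc hd => simp only [map_add, hc, hd]
    | tmul c d => rfl

theorem envComul_ract (v : Env H) (u : Env G) : envComul H (M.envRact hφ hα v u)
    = TensorProduct.map₂ (M.envRact hφ hα) (M.envRact hφ hα) (envComul H v) (envComul G u) := by
  have h : M.envRact hφ hα v u = envTwist H ((envEquiv hα).symm
    ((M.untwist hφ hα).right (envEquiv hα v) (envEquiv hφ u))) := rfl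
  rw [h, envComul_twist, envComul_envEquiv_symm, BracketMatchedPair.comul_right, comul_envEquiv,
    comul_envEquiv]
  induction envComul H v with
  | zero => simp
  | add a b ha hb => simp only [map_add, LinearMap.add_apply, ha, hb]
  | tmul a b =>
    induction envComul G u with
    | zero => simp
    | add c d hc hd => simp only [map_add, hc, hd]
    | tmul c d => rfl

theorem envCounit_lact (v : Env H) (u : Env G) :
    envCounit G (M.envLact hφ hα v u) = envCounit H v * envCounit G u := by
  rw [← counit_envEquiv hφ, envEquiv_lact, counit_envAut, BracketMatchedPair.counit_left,
    counit_envEquiv, counit_envEquiv]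

theorem envCounit_ract (v : Env H) (u : Env G) :
    envCounit H (M.envRact hφ hα v u) = envCounit H v * envCounit G u := by
  rw [← counit_envEquiv hα, envEquiv_ract, counit_envAut, BracketMatchedPair.counit_right,
    counit_envEquiv, counit_envEquiv]

theorem envAut_envEquiv_linInv (x : Env G) :
    envAut hφ (envEquiv hφ (linInv (envTwist G) x)) = envEquiv hφ x := by
  rw [← envEquiv_twist, apply_linInv_self (envTwist_bijective hφ)]

/-- In untwisted terms the left side is φ applied to ∑ (v₁ ▷ φx₁)((v₂ ◁ φx₂) ▷ φy). The negative
powers cancel the twists carried by the actions: one for v₁, and two for v₂, which passes through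
both ◁ and ▷. -/
theorem envLact_mul (v : Env H) (x y : Env G) : M.envLact hφ hα v (envMul G x y)
    = TensorProduct.lift ((envMul G).compl₂ ((M.envLact hφ hα).flip y))
        (TensorProduct.map₂
          ((M.envLact hφ hα).compl₁₂ (linInv (envTwist H)) LinearMap.id)
          ((M.envRact hφ hα).compl₁₂ (linInv (envTwist H) ∘ₗ linInv (envTwist H))
            (linInv (envTwist G)))
          (envComul H v) (envComul G x)) := by
  apply (envEquiv hφ).injective
  rw [envEquiv_lact, envEquiv_mul, map_mul, BracketMatchedPair.left_mul, comul_envAut,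
    comul_envEquiv, comul_envEquiv]
  induction envComul H v with
  | zero => simp
  | add a b ha hb => simp only [map_add, LinearMap.add_apply, ha, hb]
  | tmul a b =>
    induction envComul G x with
    | zero => simp
    | add c d hc hd => simp only [map_add, hc, hd]
    | tmul c d =>
      simp only [TensorProduct.map_tmul, TensorProduct.map₂_apply_tmul, TensorProduct.lift.tmul,
        LinearMap.compl₂_apply, LinearMap.compl₁₂_apply, LinearMap.flip_apply,
        LinearMap.comp_apply, LinearMap.id_apply, LinearMap.mul_apply', LinearEquiv.coe_coe,
        AlgHom.toLinearMap_apply, envEquiv_mul, envEquiv_lact, envEquiv_ract, envAut_left,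
        envAut_right, envAut_envEquiv_linInv, map_mul]

theorem mul_envRact (v w : Env H) (u : Env G) : M.envRact hφ hα (envMul H v w) u
    = TensorProduct.lift (envMul H ∘ₗ M.envRact hφ hα v)
        (TensorProduct.map₂
          ((M.envLact hφ hα).compl₁₂ (linInv (envTwist H))
            (linInv (envTwist G) ∘ₗ linInv (envTwist G)))
          ((M.envRact hφ hα).compl₁₂ LinearMap.id (linInv (envTwist G)))
          (envComul H w) (envComul G u)) := by
  apply (envEquiv hα).injective
  -- With u written as φ(u), one inverse twist disappears from each occurrence of its Sweedler
  -- components.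
  obtain ⟨u, rfl⟩ := (envTwist_bijective hφ).surjective u
  rw [envEquiv_ract, envEquiv_mul, envEquiv_twist, ← envAut_right,
    BracketMatchedPair.right_mul_comul, envComul_twist, comul_envEquiv, comul_envEquiv]
  induction envComul H w with
  | zero => simp
  | add a b ha hb => simp only [map_add, LinearMap.add_apply, ha, hb]
  | tmul a b =>
    induction envComul G u with
    | zero => simp
    | add c d hc hd => simp only [map_add, hc, hd]
    | tmul c d =>
      simp only [TensorProduct.map_tmul, TensorProduct.map₂_apply_tmul, TensorProduct.lift.tmul,
        LinearMap.compl₁₂_apply, LinearMap.comp_apply, LinearMap.id_apply, LinearMap.mul_apply',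
        LinearEquiv.coe_coe, envEquiv_mul, envEquiv_lact, envEquiv_ract,
        linInv_apply_self (envTwist_bijective hφ), envAut_left, envAut_right,
        envAut_envEquiv_linInv, map_mul]

theorem envSwitch (v : Env H) (u : Env G) :
    TensorProduct.map₂ (M.envRact hφ hα) (M.envLact hφ hα) (envComul H v) (envComul G u)
      = TensorProduct.comm k _ _
        (TensorProduct.map₂ (M.envLact hφ hα) (M.envRact hφ hα) (envComul H v) (envComul G u)) := by
  -- The untwisted switch identity is pushed forward by the two maps with which the retwisted
  -- actions end.
  have h := congrArg (TensorProduct.map (envTwist H ∘ₗ (envEquiv hα).symm.toLinearMap)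
      (envTwist G ∘ₗ (envEquiv hφ).symm.toLinearMap))
    ((M.untwist hφ hα).switch (envEquiv hα v) (envEquiv hφ u))
  rw [comul_envEquiv, comul_envEquiv] at h
  refine Eq.trans ?_ (h.trans ?_)
  · clear h
    induction envComul H v with
    | zero => simp
    | add a b ha hb => simp only [map_add, LinearMap.add_apply, ha, hb]
    | tmul a b =>
      induction envComul G u with
      | zero => simp
      | add c d hc hd => simp only [map_add, hc, hd]
      | tmul c d => rfl
  · clear h
    induction envComul H v with
    | zero => simp
    | add a b ha hb => simp only [map_add, LinearMap.add_apply, ha, hb]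
    | tmul a b =>
      induction envComul G u with
      | zero => simp
      | add c d hc hd => simp only [map_add, hc, hd]
      | tmul c d => rfl

theorem isHomHopfMatchedPair : IsHomHopfMatchedPair (envHopf G) (envHopf H)
    (M.envLact hφ hα) (M.envRact hφ hα) where
  left_isHomHopf := isHomHopf_envHopf hφ
  right_isHomHopf := isHomHopf_envHopf hα
  left_twist_bijective := envTwist_bijective hφ
  left_cotwist_bijective := Function.bijective_id
  right_twist_bijective := envTwist_bijective hα
  right_cotwist_bijective := Function.bijective_id
  left_module :=
    { coalgEnd := ⟨envComul_twist, envCounit_twist, fun _ => rfl⟩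
      act_act := fun v w u => (M.mul_envLact hφ hα v w u).symm
      one_act := M.one_envLact hφ hα
      cotwist_act := fun _ _ => rfl
      comul_act := M.envComul_lact hφ hα
      counit_act := M.envCounit_lact hφ hα }
  twist_left := M.twist_envLact hφ hα
  right_module :=
    { coalgEnd := ⟨envComul_twist, envCounit_twist, fun _ => rfl⟩
      act_act := fun v x y => (M.envRact_mul hφ hα v x y).symm
      act_one := M.envRact_one hφ hα
      cotwist_act := fun _ _ => rfl
      comul_act := M.envComul_ract hφ hα
      counit_act := M.envCounit_ract hφ hα }
  twist_right := M.twist_envRact hφ hα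
  left_mul v x y := by
    simp only [envHopf, linInv_id, LinearMap.comp_id]
    exact M.envLact_mul hφ hα v x y
  mul_right v w u := by
    simp only [envHopf, linInv_id, LinearMap.comp_id]
    exact M.mul_envRact hφ hα v w u
  switch := M.envSwitch hφ hα
  left_one := M.envLact_one hφ hα
  one_right := M.one_envRact hφ hα

/-! ### The intermediate actions and their recursive formulas -/

/-- The right action of `U(g)` on `h`. -/
def envRactLie : h →ₗ[k] Env G →ₗ[k] h :=
  LinearMap.compr₂ (LinearMap.flip ((MulOpposite.opLinearEquiv k).symm.toLinearMap ∘ₗ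
    (M.untwist hφ hα).rightLie.toLinearMap ∘ₗ (envEquiv hφ).toLinearMap)) H.twist

theorem envRactLie_apply (η : h) (u : Env G) : M.envRactLie hφ hα η u
    = H.twist (((M.untwist hφ hα).rightLie (envEquiv hφ u)).unop η) := rfl

/-- The left action of `U(h)` on `g`. -/
def envLactLie : Env H →ₗ[k] g →ₗ[k] g :=
  ((M.untwist hφ hα).leftLie.toLinearMap ∘ₗ (envEquiv hα).toLinearMap).compr₂ G.twist

theorem envLactLie_apply (v : Env H) (ξ : g) : M.envLactLie hφ hα v ξ
    = G.twist ((M.untwist hφ hα).leftLie (envEquiv hα v) ξ) := rfl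

theorem rightLie_envAut (u : BracketEnv G.untwist) (η : h) :
    ((M.untwist hφ hα).rightLie (envAut hφ u)).unop (H.twist η)
      = H.twist (((M.untwist hφ hα).rightLie u).unop η) := by
  induction u using BracketEnv.induction_left generalizing η with
  | one => simp
  | add x y hx hy => simp [hx, hy]
  | smul r x hx => simp [hx]
  | mul ξ x hx =>
    rw [map_mul, map_mul, map_mul, MulOpposite.unop_mul, MulOpposite.unop_mul,
      Module.End.mul_apply, Module.End.mul_apply, ← hx]
    simp [BracketMatchedPair.rightLie, untwist_ract_twist]

theorem leftLie_envAut (v : BracketEnv H.untwist) (ξ : g) :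
    (M.untwist hφ hα).leftLie (envAut hα v) (G.twist ξ)
      = G.twist ((M.untwist hφ hα).leftLie v ξ) := by
  induction v using BracketEnv.induction_right generalizing ξ with
  | one => simp
  | add x y hx hy => simp [hx, hy]
  | smul r x hx => simp [hx]
  | mul x η hx =>
    rw [map_mul, map_mul, map_mul, Module.End.mul_apply, Module.End.mul_apply, ← hx]
    simp [BracketMatchedPair.leftLie, untwist_lact_twist]

theorem envRact_gen (η : h) (u : Env G) :
    M.envRact hφ hα (envLeaf H 0 η) u = envLeaf H 0 (M.envRactLie hφ hα η u) := by
  apply (envEquiv hα).injective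
  rw [envEquiv_ract, envEquiv_leaf, envEquiv_leaf, pow_zero, Module.End.one_apply,
    Module.End.one_apply, BracketMatchedPair.right_ι, envAut_ι]
  rfl

theorem envLact_gen (v : Env H) (ξ : g) :
    M.envLact hφ hα v (envLeaf G 0 ξ) = envLeaf G 0 (M.envLactLie hφ hα v ξ) := by
  apply (envEquiv hφ).injective
  rw [envEquiv_lact, envEquiv_leaf, envEquiv_leaf, pow_zero, Module.End.one_apply,
    Module.End.one_apply, BracketMatchedPair.left_ι, envAut_ι]
  rfl

theorem envRactLie_leaf (η : h) (s : ℕ) (ξ : g) :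
    M.envRactLie hφ hα η (envLeaf G s ξ) = M.ract η ((G.twist ^ s) ξ) := by
  rw [envRactLie_apply, envEquiv_leaf, ← M.twist_untwist_ract hφ hα]
  simp [BracketMatchedPair.rightLie]

theorem envLactLie_leaf (s : ℕ) (η : h) (ξ : g) :
    M.envLactLie hφ hα (envLeaf H s η) ξ = M.lact ((H.twist ^ s) η) ξ := by
  rw [envLactLie_apply, envEquiv_leaf, ← M.twist_untwist_lact hφ hα]
  simp [BracketMatchedPair.leftLie]

theorem twist_pow_lact (s : ℕ) (η : h) (ξ : g) : (G.twist ^ s) (M.lact η ξ)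
    = M.lact ((H.twist ^ s) η) ((G.twist ^ s) ξ) := by
  induction s with
  | zero => rfl
  | succ s ih => simp only [pow_succ', Module.End.mul_apply, ih, M.twist_lact]

theorem twist_pow_ract (s : ℕ) (η : h) (ξ : g) : (H.twist ^ s) (M.ract η ξ)
    = M.ract ((H.twist ^ s) η) ((G.twist ^ s) ξ) := by
  induction s with
  | zero => rfl
  | succ s ih => simp only [pow_succ', Module.End.mul_apply, ih, M.twist_ract]

/-- The product formula at a primitive η. In the summand η ⊗ 1 the factor 1 ◁ φ⁻¹(x₂) is ε(x₂)1,
giving the first term; in 1 ⊗ η the factor 1 ▷ x₁ is φ(x₁), giving the second. -/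
theorem envLact_leaf_mul (η : h) (x y : Env G) :
    M.envLact hφ hα (envLeaf H 0 η) (envMul G x y)
      = envMul G (M.envLact hφ hα (envLeaf H 0 (linInv H.twist η)) x) (envTwist G y)
      + TensorProduct.lift ((envMul G).compl₂ (((M.envLact hφ hα) ∘ₗ envGen H).flip y))
          (TensorProduct.map (envTwist G)
            (M.envRactLie hφ hα (linInv H.twist (linInv H.twist η)) ∘ₗ linInv (envTwist G))
            (envComul G x)) := by
  have hx := envCounit_lTensor hφ x
  -- Writing x = ∑ x₁ε(x₂) in the first term makes both sides linear functions of Δ(x), to be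
  -- compared on pure tensors.
  conv_rhs => enter [1, 1, 2, 2]; rw [← hx]
  rw [envLact_mul, envComul_leaf]
  refine LinearMap.congr_fun (f := TensorProduct.lift ((envMul G).compl₂ ((M.envLact hφ hα).flip y))
      ∘ₗ TensorProduct.map₂ ((M.envLact hφ hα).compl₁₂ (linInv (envTwist H)) LinearMap.id)
          ((M.envRact hφ hα).compl₁₂ (linInv (envTwist H) ∘ₗ linInv (envTwist H))
            (linInv (envTwist G)))
          (envLeaf H 0 η ⊗ₜ[k] envMk H (basisVec k none)
            + envMk H (basisVec k none) ⊗ₜ[k] envLeaf H 0 η))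
    (g := (envMul G).flip (envTwist G y)
        ∘ₗ M.envLact hφ hα (envLeaf H 0 (linInv H.twist η))
        ∘ₗ (TensorProduct.rid k (Env G)).toLinearMap ∘ₗ (envCounit G).lTensor (Env G)
      + TensorProduct.lift ((envMul G).compl₂ (((M.envLact hφ hα) ∘ₗ envGen H).flip y))
        ∘ₗ TensorProduct.map (envTwist G)
          (M.envRactLie hφ hα (linInv H.twist (linInv H.twist η)) ∘ₗ linInv (envTwist G)))
    (TensorProduct.ext' fun a b => ?_) (envComul G x)
  have hb : envCounit G (linInv (envTwist G) b) = envCounit G b := by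
    rw [← envCounit_twist, apply_linInv_self (envTwist_bijective hφ)]
  simp [linInv_envTwist_leaf hα, linInv_envTwist_one hα, one_envRact, one_envLact, hb,
    envRact_gen]

/-- The dual specialisation, at a primitive ξ: the summand 1 ⊗ ξ collapses through α⁻¹(w₁) ▷ 1 =
ε(w₁)1, and ξ ⊗ 1 through w₂ ◁ 1 = α(w₂). -/
theorem envRact_mul_leaf (v w : Env H) (ξ : g) :
    M.envRact hφ hα (envMul H v w) (envLeaf G 0 ξ)
      = envMul H (envTwist H v) (M.envRact hφ hα w (envLeaf G 0 (linInv G.twist ξ)))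
      + TensorProduct.lift (envMul H ∘ₗ ((M.envRact hφ hα).compl₂ (envGen G)) v)
          (TensorProduct.map
            ((M.envLactLie hφ hα).flip (linInv G.twist (linInv G.twist ξ)) ∘ₗ linInv (envTwist H))
            (envTwist H)
            (envComul H w)) := by
  have hw := envCounit_rTensor hα w
  conv_rhs => enter [1, 2, 1, 2]; rw [← hw]
  rw [mul_envRact, envComul_leaf]
  refine LinearMap.congr_fun
    (f := TensorProduct.lift (envMul H ∘ₗ M.envRact hφ hα v)
      ∘ₗ (TensorProduct.map₂
          ((M.envLact hφ hα).compl₁₂ (linInv (envTwist H))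
            (linInv (envTwist G) ∘ₗ linInv (envTwist G)))
          ((M.envRact hφ hα).compl₁₂ LinearMap.id (linInv (envTwist G)))).flip
          (envLeaf G 0 ξ ⊗ₜ[k] envMk G (basisVec k none)
            + envMk G (basisVec k none) ⊗ₜ[k] envLeaf G 0 ξ))
    (g := envMul H (envTwist H v)
        ∘ₗ (M.envRact hφ hα).flip (envLeaf G 0 (linInv G.twist ξ))
        ∘ₗ (TensorProduct.lid k (Env H)).toLinearMap ∘ₗ (envCounit H).rTensor (Env H)
      + TensorProduct.lift (envMul H ∘ₗ ((M.envRact hφ hα).compl₂ (envGen G)) v)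
        ∘ₗ TensorProduct.map
          ((M.envLactLie hφ hα).flip (linInv G.twist (linInv G.twist ξ)) ∘ₗ linInv (envTwist H))
          (envTwist H))
    (TensorProduct.ext' fun a b => ?_) (envComul H w)
  have ha : envCounit H (linInv (envTwist H) a) = envCounit H a := by
    rw [← envCounit_twist, apply_linInv_self (envTwist_bijective hα)]
  simp only [LinearMap.comp_apply, LinearMap.add_apply, LinearMap.flip_apply, map_add]
  -- The summand ξ ⊗ 1 produces the second term of the formula, so the order is reversed.
  rw [add_comm]
  simp [linInv_envTwist_leaf hφ, linInv_envTwist_one hφ, envRact_one, envLact_one, ha,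
    envLact_gen]

/-- The induced actions. -/
def inducedActions : InducedActions M where
  ractLie := M.envRactLie hφ hα
  lieLact := M.envLact hφ hα ∘ₗ envGen H
  lactLie := M.envLactLie hφ hα
  lieRact := (M.envRact hφ hα).compl₂ (envGen G)
  lact := M.envLact hφ hα
  ract := M.envRact hφ hα
  ractLie_one η := by
    change M.envRactLie hφ hα η (envMk G (basisVec k none)) = _
    rw [envRactLie_apply, envEquiv_one]
    simp
  ractLie_leaf := M.envRactLie_leaf hφ hα
  ractLie_mul η x y := by
    simp only [envRactLie_apply, envEquiv_mul, envEquiv_twist, rightLie_envAut, map_mul,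
      MulOpposite.unop_mul, Module.End.mul_apply]
  lieLact_one η := by
    change M.envLact hφ hα (envLeaf H 0 η) (envMk G (basisVec k none)) = _
    rw [envLact_one, envCounit_leaf, zero_smul]
  lieLact_leaf η s ξ := by
    -- At weight zero the claim is η ▷ φ^s(ξ) = φ^s(α^{-s}(η) ▷ ξ), by equivariance of the action.
    rw [LinearMap.comp_apply, envGen_apply, envLeaf_eq s ξ, envLact_gen, envLactLie_leaf, envLeaf_eq s,
      twist_pow_lact, pow_linInv hα]
    rfl
  lieLact_mul η x y := M.envLact_leaf_mul hφ hα η x y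
  lactLie_one ξ := by
    change M.envLactLie hφ hα (envMk H (basisVec k none)) ξ = _
    rw [envLactLie_apply, envEquiv_one]
    simp
  lactLie_leaf := M.envLactLie_leaf hφ hα
  lactLie_mul v w ξ := by
    simp only [envLactLie_apply, envEquiv_mul, envEquiv_twist, leftLie_envAut, map_mul,
      Module.End.mul_apply]
  lieRact_one ξ := by
    change M.envRact hφ hα (envMk H (basisVec k none)) (envLeaf G 0 ξ) = _
    rw [one_envRact, envCounit_leaf, zero_smul]
  lieRact_leaf s η ξ := by
    rw [LinearMap.compl₂_apply, envGen_apply, envLeaf_eq s η, envRact_gen, envRactLie_leaf,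
      envLeaf_eq s, twist_pow_ract, pow_linInv hφ]
    rfl
  lieRact_mul v w ξ := M.envRact_mul_leaf hφ hα v w ξ
  lact_one := M.one_envLact hφ hα
  lact_leaf s η u := by rw [envLeaf_eq]; rfl
  lact_mul := M.mul_envLact hφ hα
  ract_one := M.envRact_one hφ hα
  ract_leaf v s ξ := by rw [envLeaf_eq]; rfl
  ract_mul := M.envRact_mul hφ hα

end HomLieMatchedPair

end

theorem mainTheorem2 {k g h : Type*} [Field k] [AddCommGroup g] [Module k g]
    [AddCommGroup h] [Module k h] (G : HomLieAlg k g) (H : HomLieAlg k h)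
    (hφ : Function.Bijective G.twist) (hα : Function.Bijective H.twist)
    (M : HomLieMatchedPair G H) :
    ∃ A : InducedActions M, (∀ B : InducedActions M, B = A) ∧
      IsHomHopfMatchedPair (envHopf G) (envHopf H) A.lact A.ract :=
  ⟨M.inducedActions hφ hα, fun B => InducedActions.unique hφ hα B _,
    M.isHomHopfMatchedPair hφ hα⟩
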